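/- Let $\Bbbk$ be a commutative ring. A cubical set $X$ has faces $d_{i,\epsilon}:X_n\to X_{n-1}$ and degeneracies $s_i:X_{n-1}\to X_n$ ($1\le i\le n$, $\epsilon\in\{0,1\}$) satisfying the cubical identities. Put $LX_0=\{\star\}$ and, for $n\ge 1$, let $LX_n\subseteq X_n$ be the set of cells $x$ such that for every $1\le k\le n$ the face $d_{1,\epsilon_1}\cdots d_{1,\epsilon_k}x$ does not depend on $(\epsilon_1,\dots,\epsilon_k)\in\{0,1\}^k$. Let $CL_n(X)$ be the free $\Bbbk$-module on $LX_n$ modulo the span of the cells of $LX_n$ that are degenerate in $X$ (no quotient for $n=0$), with differential $d=\sum_{i=1}^n(-1)^{i+1}(d_{i,1}-d_{i,0})$, and let $HL_\bullet(X,\Bbbk)$ be the homology of the chain complex $CL_\bullet(X)$. Tensor products of complexes carry the Koszul signs, and $\tau(x\otimes y)=(-1)^{|x||y|}y\otimes x$. All chain maps and homotopies below are natural in the cubical set $X$. **Existence and uniqueness.** There are natural degree-$0$ chain maps $\Delta_\prec,\Delta_\succ:CL_\bullet\to CL_\bullet\otimes CL_\bullet$ given on $x\in LX_n$ by $$\Delta_{\prec}(x)=\sum_{\substack{p+q=n\\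 p,q\ge1}}\ \sum_{\sigma\in Sh_{p,q},\,\sigma(1)=1}\epsilon(\sigma)\,d_{\sigma(p+1),0}\cdots d_{\sigma(p+q),0}x\otimes d_{\sigma(1),1}\cdots d_{\sigma(p),1}x ,$$ $$\Delta_{\succ}(x)=\sum_{\substack{p+q=n\\ p,q\ge1}}\ \sum_{\sigma\in Sh_{p,q},\,\sigma(p+1)=1}\epsilon(\sigma)\,d_{\sigma(p+1),0}\cdots d_{\sigma(p+q),0}x\otimes d_{\sigma(1),1}\cdots d_{\sigma(p),1}x ,$$ where $Sh_{p,q}$ is the set of permutations $\sigma$ of $\{1,\dots,p+q\}$ with $\sigma(1)<\dots<\sigma(p)$ and $\sigma(p+1)<\dots<\sigma(p+q)$. Both vanish in degrees $0$ and $1$, and for $x\in LX_2$ one has $\Delta_\prec(x)=d_{2,0}x\otimes d_{1,1}x$ and $\Delta_\succ(x)=-d_{1,0}x\otimes d_{2,1}x$. Any two natural degree-$0$ chain maps $CL_\bullet\to CL_\bullet\otimes CL_\bullet$ that have these values of $\Delta_\prec$ (respectively of $\Delta_\succ$) in degrees $\le 2$ are naturally chain homotopic. **Theorem.** Let $\Delta_\prec,\Delta_\succ$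 be any natural degree-$0$ chain maps $CL_\bullet\to CL_\bullet\otimes CL_\bullet$ with the above values in degrees $\le2$. Then $(CL_\bullet,\Delta_\prec,\Delta_\succ)$ is a homotopy codendriform coalgebra: up to natural chain homotopy, $$(\Delta_\prec\otimes \mathrm{id})\Delta_\prec\simeq(\mathrm{id}\otimes(\Delta_\prec+\Delta_\succ))\Delta_\prec,\quad (\Delta_\succ\otimes \mathrm{id})\Delta_\prec\simeq(\mathrm{id}\otimes\Delta_\prec)\Delta_\succ,\quad (\mathrm{id}\otimes\Delta_\succ)\Delta_\succ\simeq((\Delta_\prec+\Delta_\succ)\otimes \mathrm{id})\Delta_\succ .$$ Moreover $\Delta_\succ\simeq\tau\circ\Delta_\prec$, so that it is a homotopy coZinbiel coalgebra: $(\Delta_\prec\otimes \mathrm{id})\Delta_\prec\simeq(\mathrm{id}\otimes(\Delta_\prec+\tau\Delta_\prec))\Delta_\prec$. **Corollary.** Suppose that $\Bbbk$ is a field. For every cubical set $X$, the map $\Delta_\prec$ induces a unique linear map $\delta:HL_\bullet(X,\Bbbk)\to HL_\bullet(X,\Bbbk)\otimes HL_\bullet(X,\Bbbk)$ (that is, $\delta[z]=\sum[a_i]\otimes[b_i]$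 whenever $z,a_i,b_i$ are cycles and $\Delta_\prec z$ is homologous to $\sum a_i\otimes b_i$), and $\delta$ is the reduced coproduct of a connected graded coZinbiel coalgebra. Precisely: $HL_0(X,\Bbbk)=\Bbbk\cdot 1$ with $1=[\star]$; let $c:HL_\bullet(X,\Bbbk)\to\Bbbk$ be the linear map with $c(1)=1$ that vanishes in positive degrees. Then $\delta$ preserves degrees, $\delta(1)=0$, $(\delta\otimes \mathrm{id})\delta=(\mathrm{id}\otimes(\delta+\tau\delta))\delta$; the coproduct $x\mapsto\delta(x)+x\otimes1$ on $\ker c$ satisfies $(c\otimes \mathrm{id})(\delta(x)+x\otimes1)=0$ and $(\mathrm{id}\otimes c)(\delta(x)+x\otimes1)=x$; and $\ker c=\bigcup_{r\ge1}F_r$, where $F_1=\{x\in\ker c:\delta(x)=0\}$ and $F_r=\{x\in\ker c:\delta(x)\in F_{r-1}\otimes F_{r-1}\}$ for $r>1$. -/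

import Mathlib

open scoped TensorProduct DirectSum

universe u v w

/-! ### Cubical sets and L-cells -/

/-- A cubical set, given by its cells, faces `d_{i,ε}` and degeneracies `s_i` subject to the cubical
identities (indices start at `0`; `false`, `true` stand for the end points `0`, `1`). -/
structure CubicalSet where
  cell : ℕ → Type u
  face : ∀ {n : ℕ}, Fin (n + 1) → Bool → cell (n + 1) → cell n
  degen : ∀ {n : ℕ}, Fin (n + 1) → cell n → cell (n + 1)
  face_face : ∀ {n : ℕ} (i j : Fin (n + 1)) (ε ω : Bool) (x : cell (n + 2)), i ≤ j →
    face j ω (face i.castSucc ε x) = face i ε (face j.succ ω x)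
  degen_degen : ∀ {n : ℕ} (i j : Fin (n + 1)) (x : cell n), i ≤ j →
    degen j.succ (degen i x) = degen i.castSucc (degen j x)
  face_degen_self : ∀ {n : ℕ} (i : Fin (n + 1)) (ε : Bool) (x : cell n),
    face i ε (degen i x) = x
  face_degen_above : ∀ {n : ℕ} (i j : Fin (n + 1)) (ε : Bool) (x : cell (n + 1)), i ≤ j →
    face j.succ ε (degen i.castSucc x) = degen i (face j ε x)
  face_degen_below : ∀ {n : ℕ} (i j : Fin (n + 1)) (ε : Bool) (x : cell (n + 1)), j ≤ i →
    face j.castSucc ε (degen i.succ x) = degen i (face j ε x)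

namespace CubicalSet

/-- Morphisms of cubical sets. -/
structure Hom (X Y : CubicalSet.{u}) where
  app : ∀ {n : ℕ}, X.cell n → Y.cell n
  app_face : ∀ {n : ℕ} (i : Fin (n + 1)) (ε : Bool) (x : X.cell (n + 1)),
    app (X.face i ε x) = Y.face i ε (app x)
  app_degen : ∀ {n : ℕ} (i : Fin (n + 1)) (x : X.cell n),
    app (X.degen i x) = Y.degen i (app x)

/-- `FrontFace X x y`: the cell `y` is `d_{1,ε₁} ⋯ d_{1,ε_k} x` for some `k ≥ 0` and some
`ε ∈ {0,1}^k`. -/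
inductive FrontFace (X : CubicalSet.{u}) {n : ℕ} (x : X.cell n) : ∀ {m : ℕ}, X.cell m → Prop
  | refl : FrontFace X x x
  | step {m : ℕ} {y : X.cell (m + 1)} (ε : Bool) :
      FrontFace X x y → FrontFace X x (X.face 0 ε y)

/-- `x` lies in all the equalizers of `d_{1,ε₁} ⋯ d_{1,ε_k}` and `d_{1,ε'₁} ⋯ d_{1,ε'_k}`: for each
`k ≤ n`, the iterated first faces of `x` of codimension `k` all agree. -/
def IsL (X : CubicalSet.{u}) {n : ℕ} (x : X.cell n) : Prop :=
  ∀ (m : ℕ) (y y' : X.cell m), X.FrontFace x y → X.FrontFace x y' → y = y'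

/-- The cells of `LX`: one point in dimension `0`, and `LX_n ⊆ X_n` for `n ≥ 1`. -/
def LCell (X : CubicalSet.{u}) : ℕ → Type u
  | 0 => PUnit
  | n + 1 => {x : X.cell (n + 1) // X.IsL x}

theorem frontFace_face {X : CubicalSet.{u}} {n m : ℕ} (i : Fin (n + 1)) (ε : Bool)
    (x : X.cell (n + 1)) (y : X.cell m) (h : X.FrontFace (X.face i ε x) y) :
    (∃ (z : X.cell (m + 1)) (j : Fin (m + 1)), X.FrontFace x z ∧ y = X.face j ε z ∧
      j.val + n = i.val + m) ∨ (X.FrontFace x y ∧ i.val + m < n) := by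
  induction h with
  | refl => exact Or.inl ⟨x, i, .refl, rfl, rfl⟩
  | @step m y ω _ ih =>
    rcases ih with ⟨z, j, hz, rfl, hj⟩ | ⟨hy, hlt⟩
    · rcases Fin.eq_zero_or_eq_succ j with rfl | ⟨j', rfl⟩
      · exact Or.inr ⟨(hz.step ε).step ω, by simp at hj; omega⟩
      · refine Or.inl ⟨X.face 0 ω z, j', hz.step ω, ?_, by simp at hj; omega⟩
        exact (X.face_face 0 j' ω ε z (Fin.zero_le _)).symm
    · exact Or.inr ⟨hy.step ω, by omega⟩

theorem IsL.face {X : CubicalSet.{u}} {n : ℕ} {x : X.cell (n + 1)} (hx : X.IsL x)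
    (i : Fin (n + 1)) (ε : Bool) : X.IsL (X.face i ε x) := by
  intro m y y' h h'
  rcases frontFace_face i ε x y h with ⟨z, j, hz, rfl, hj⟩ | ⟨hy, hlt⟩ <;>
  rcases frontFace_face i ε x y' h' with ⟨z', j', hz', rfl, hj'⟩ | ⟨hy', hlt'⟩
  · obtain rfl : j = j' := Fin.ext (by omega)
    rw [hx _ z z' hz hz']
  · omega
  · omega
  · exact hx _ _ _ hy hy'

/-- The faces of `LX`. -/
def lface (X : CubicalSet.{u}) : ∀ {n : ℕ}, Fin (n + 1) → Bool → X.LCell (n + 1) → X.LCell n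
  | 0, _, _, _ => PUnit.unit
  | _ + 1, i, ε, x => ⟨X.face i ε x.1, x.2.face i ε⟩

theorem lface_lface (X : CubicalSet.{u}) {n : ℕ} (i j : Fin (n + 1)) (ε ω : Bool)
    (x : X.LCell (n + 2)) (h : i ≤ j) :
    X.lface j ω (X.lface i.castSucc ε x) = X.lface i ε (X.lface j.succ ω x) := by
  cases n with
  | zero => rfl
  | succ n => exact Subtype.ext (X.face_face i j ε ω x.1 h)

/-- The degenerate cells of `X` lying in `LX`. -/
def IsDegen (X : CubicalSet.{u}) : ∀ {n : ℕ}, X.LCell n → Prop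
  | 0, _ => False
  | n + 1, x => ∃ (i : Fin (n + 1)) (y : X.cell n), x.1 = X.degen i y

theorem lface_degen (X : CubicalSet.{u}) {n : ℕ} (x : X.LCell (n + 1)) (hx : X.IsDegen x)
    (j : Fin (n + 1)) :
    X.lface j true x = X.lface j false x ∨ ∀ ε, X.IsDegen (X.lface j ε x) := by
  cases n with
  | zero => exact Or.inl rfl
  | succ n =>
    obtain ⟨i, y, hy⟩ := hx
    rcases lt_trichotomy j i with hlt | rfl | hlt
    · refine Or.inr fun ε => ?_
      obtain ⟨i', rfl⟩ := Fin.exists_succ_eq.2 (Fin.ne_zero_of_lt hlt)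
      obtain ⟨j', rfl⟩ := Fin.exists_castSucc_eq.2 (Fin.ne_last_of_lt hlt)
      have hle : j' ≤ i' := by
        simp only [Fin.lt_def, Fin.val_castSucc, Fin.val_succ] at hlt
        exact Fin.le_def.2 (by omega)
      refine ⟨i', X.face j' ε y, ?_⟩
      change X.face _ ε x.1 = _
      rw [hy, X.face_degen_below i' j' ε y hle]
    · refine Or.inl (Subtype.ext ?_)
      change X.face _ true x.1 = X.face _ false x.1
      rw [hy, X.face_degen_self, X.face_degen_self]
    · refine Or.inr fun ε => ?_
      obtain ⟨j', rfl⟩ := Fin.exists_succ_eq.2 (Fin.ne_zero_of_lt hlt)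
      obtain ⟨i', rfl⟩ := Fin.exists_castSucc_eq.2 (Fin.ne_last_of_lt hlt)
      have hle : i' ≤ j' := by
        simp only [Fin.lt_def, Fin.val_castSucc, Fin.val_succ] at hlt
        exact Fin.le_def.2 (by omega)
      refine ⟨i', X.face j' ε y, ?_⟩
      change X.face _ ε x.1 = _
      rw [hy, X.face_degen_above i' j' ε y hle]

theorem Hom.frontFace {X Y : CubicalSet.{u}} (f : Hom X Y) {n m : ℕ} {x : X.cell n}
    {y : Y.cell m} (h : Y.FrontFace (f.app x) y) : ∃ z, X.FrontFace x z ∧ y = f.app z := by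
  induction h with
  | refl => exact ⟨x, .refl, rfl⟩
  | step ε _ ih =>
    obtain ⟨z, hz, rfl⟩ := ih
    exact ⟨_, hz.step ε, (f.app_face 0 ε z).symm⟩

theorem Hom.isL {X Y : CubicalSet.{u}} (f : Hom X Y) {n : ℕ} {x : X.cell n} (hx : X.IsL x) :
    Y.IsL (f.app x) := by
  intro m y y' h h'
  obtain ⟨z, hz, rfl⟩ := f.frontFace h
  obtain ⟨z', hz', rfl⟩ := f.frontFace h'
  rw [hx _ z z' hz hz']

/-- The map `LX_n → LY_n` induced by a morphism of cubical sets. -/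
def Hom.lapp {X Y : CubicalSet.{u}} (f : Hom X Y) : ∀ {n : ℕ}, X.LCell n → Y.LCell n
  | 0, _ => PUnit.unit
  | _ + 1, x => ⟨f.app x.1, f.isL x.2⟩

theorem Hom.lapp_degen {X Y : CubicalSet.{u}} (f : Hom X Y) {n : ℕ} {x : X.LCell n}
    (hx : X.IsDegen x) : Y.IsDegen (f.lapp x) := by
  cases n with
  | zero => exact hx
  | succ n =>
    obtain ⟨i, y, hy⟩ := hx
    exact ⟨i, f.app y, (congrArg f.app hy).trans (f.app_degen i y)⟩

/-! ### The L-chain complex -/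

section Chain

variable (k : Type v) [CommRing k] (X : CubicalSet.{u})

/-- `QL_n(X)`, the free module on `LX_n`. -/
abbrev QL (n : ℕ) : Type (max u v) := X.LCell n →₀ k

/-- `DL_n(X) = D_n(X) ∩ QL_n(X)`, where `D_n(X)` is spanned by the degenerate cells of `X`; both
modules being spanned by cells, so is their intersection. -/
noncomputable def DL (n : ℕ) : Submodule k (QL k X n) :=
  Submodule.span k {v | ∃ x : X.LCell n, X.IsDegen x ∧ v = Finsupp.single x 1}

/-- The differential `d = ∑_{i=1}^{n} (-1)^{i+1} (d_{i,1} - d_{i,0})` of `QL`. -/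
noncomputable def dQL (n : ℕ) : QL k X (n + 1) →ₗ[k] QL k X n :=
  Finsupp.linearCombination k fun x : X.LCell (n + 1) =>
    ∑ i : Fin (n + 1), ((-1 : k) ^ (i : ℕ)) •
      (Finsupp.single (X.lface i true x) (1 : k) - Finsupp.single (X.lface i false x) 1)

theorem dQL_single (n : ℕ) (x : X.LCell (n + 1)) :
    dQL k X n (Finsupp.single x 1) = ∑ i : Fin (n + 1), ((-1 : k) ^ (i : ℕ)) •
      (Finsupp.single (X.lface i true x) (1 : k) - Finsupp.single (X.lface i false x) 1) := by
  simp [dQL]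

theorem dQL_mem_DL (n : ℕ) : DL k X (n + 1) ≤ (DL k X n).comap (dQL k X n) := by
  refine Submodule.span_le.2 ?_
  rintro _ ⟨x, hx, rfl⟩
  rw [SetLike.mem_coe, Submodule.mem_comap, dQL_single]
  refine Submodule.sum_mem _ fun j _ => Submodule.smul_mem _ _ ?_
  rcases X.lface_degen x hx j with h | h
  · rw [h, sub_self]; exact Submodule.zero_mem _
  · exact Submodule.sub_mem _ (Submodule.subset_span ⟨_, h true, rfl⟩)
      (Submodule.subset_span ⟨_, h false, rfl⟩)

/-- `CL_n(X) = QL_n(X) / DL_n(X)`. -/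
def CL (n : ℕ) : Type (max u v) := QL k X n ⧸ DL k X n

noncomputable instance (n : ℕ) : AddCommGroup (CL k X n) :=
  inferInstanceAs (AddCommGroup (QL k X n ⧸ DL k X n))

noncomputable instance (n : ℕ) : Module k (CL k X n) :=
  inferInstanceAs (Module k (QL k X n ⧸ DL k X n))

/-- The projection `QL_n(X) → CL_n(X)`. -/
noncomputable def mkCL (n : ℕ) : QL k X n →ₗ[k] CL k X n := (DL k X n).mkQ

/-- The differential `CL_{n+1}(X) → CL_n(X)`. -/
noncomputable def dCL (n : ℕ) : CL k X (n + 1) →ₗ[k] CL k X n :=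
  (DL k X (n + 1)).mapQ (DL k X n) (dQL k X n) (dQL_mem_DL k X n)

theorem sum_pairs_eq_zero {M : Type*} [AddCommGroup M] {n : ℕ}
    (F : Fin (n + 2) → Fin (n + 1) → M)
    (hF : ∀ i j : Fin (n + 1), i ≤ j → F i.castSucc j + F j.succ i = 0) :
    ∑ i, ∑ j, F i j = 0 := by
  rw [← Finset.sum_product']
  refine Finset.sum_involution
    (fun a _ => if h : a.1.val ≤ a.2.val then (a.2.succ, ⟨a.1.val, by omega⟩)
      else (a.2.castSucc, ⟨a.1.val - 1, by omega⟩)) ?_ ?_ (fun _ _ => by simp) ?_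
  · rintro ⟨i, j⟩ _
    by_cases h : i.val ≤ j.val
    · simp only [h, dif_pos]
      exact hF ⟨i.val, by omega⟩ j (by simpa [Fin.le_def] using h)
    · simp only [h, dif_neg, not_false_eq_true]
      have := hF j ⟨i.val - 1, by omega⟩ (by simp only [Fin.le_def]; omega)
      rw [add_comm]
      convert this using 3
      ext; simp; omega
  · rintro ⟨i, j⟩ _ _ heq
    by_cases h : i.val ≤ j.val <;> simp only [h, dif_pos, dif_neg, not_false_eq_true,
      Prod.mk.injEq, Fin.ext_iff, Fin.val_succ, Fin.val_castSucc] at heq <;> omega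
  · rintro ⟨i, j⟩ _
    by_cases h : i.val ≤ j.val
    · have h' : ¬ (j.val + 1 ≤ i.val) := by omega
      simp [h, h']
    · have h' : j.val ≤ i.val - 1 := by omega
      simp only [h, dif_neg, not_false_eq_true, Fin.val_castSucc, h', dif_pos, Prod.mk.injEq,
        Fin.ext_iff, Fin.val_succ, and_true]
      omega

theorem dQL_dQL (n : ℕ) (v : QL k X (n + 2)) : dQL k X n (dQL k X (n + 1) v) = 0 := by
  suffices h : dQL k X n ∘ₗ dQL k X (n + 1) = 0 from LinearMap.congr_fun h v
  refine Finsupp.lhom_ext' fun x => LinearMap.ext_ring ?_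
  change dQL k X n (dQL k X (n + 1) (Finsupp.single x 1)) = 0
  rw [dQL_single]
  simp only [map_sum, map_smul, map_sub, dQL_single]
  simp only [← Finset.sum_sub_distrib, Finset.smul_sum, ← smul_sub]
  refine sum_pairs_eq_zero _ fun i j hij => ?_
  simp only [X.lface_lface i j _ _ x hij, Fin.val_castSucc, Fin.val_succ, pow_succ]
  module

theorem dCL_dCL (n : ℕ) (v : CL k X (n + 2)) : dCL k X n (dCL k X (n + 1) v) = 0 := by
  obtain ⟨v, rfl⟩ := (DL k X (n + 2)).mkQ_surjective v
  change (DL k X n).mkQ (dQL k X n (dQL k X (n + 1) v)) = 0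
  rw [dQL_dQL, map_zero]

/-- The total module `CL_•(X) = ⨁ₙ CL_n(X)`. -/
abbrev CLTot : Type (max u v) := ⨁ n, CL k X n

/-- The generator of `CL_•(X)` given by a cell of `LX`. -/
noncomputable def gen (x : Σ n, X.LCell n) : CLTot k X :=
  DirectSum.lof k ℕ (CL k X) x.1 (mkCL k X x.1 (Finsupp.single x.2 1))

/-- The differential of `CL_•(X)` on the total module. -/
noncomputable def dTot : CLTot k X →ₗ[k] CLTot k X :=
  DirectSum.toModule k ℕ _ fun
    | 0 => 0
    | n + 1 => DirectSum.lof k ℕ (CL k X) n ∘ₗ dCL k X n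

/-- The map `x ↦ (-1)^{|x|} x`. -/
noncomputable def parity : CLTot k X →ₗ[k] CLTot k X :=
  DirectSum.lmap fun n => ((-1 : k) ^ n) • LinearMap.id

end Chain

end CubicalSet

/-- The degree `n` part of a tensor product of graded modules. -/
noncomputable def tensorDeg {k : Type*} [CommRing k] {V W : Type*} [AddCommGroup V] [Module k V]
    [AddCommGroup W] [Module k W] (P : ℕ → Submodule k V) (Q : ℕ → Submodule k W) (n : ℕ) :
    Submodule k (V ⊗[k] W) :=
  ⨆ p ∈ Finset.HasAntidiagonal.antidiagonal n, Submodule.map₂ (TensorProduct.mk k V W) (P p.1) (Q p.2)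

/-- The degree `n` part of a direct sum. -/
noncomputable def sumDeg (k : Type*) [CommRing k] (A : ℕ → Type*) [∀ n, AddCommGroup (A n)]
    [∀ n, Module k (A n)] (n : ℕ) : Submodule k (⨁ n, A n) :=
  LinearMap.range (DirectSum.lof k ℕ A n)

namespace CubicalSet

section Tensor

variable (k : Type v) [CommRing k] (X : CubicalSet.{u})

/-- `CL_•(X) ⊗ CL_•(X)`. -/
abbrev CL2 : Type (max u v) := CLTot k X ⊗[k] CLTot k X

/-- `CL_•(X) ⊗ CL_•(X) ⊗ CL_•(X)`. -/
abbrev CL3 : Type (max u v) := CLTot k X ⊗[k] (CLTot k X ⊗[k] CLTot k X)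

/-- `d (x ⊗ y) = d x ⊗ y + (-1)^{|x|} x ⊗ d y`. -/
noncomputable def d2 : CL2 k X →ₗ[k] CL2 k X :=
  TensorProduct.map (dTot k X) LinearMap.id + TensorProduct.map (parity k X) (dTot k X)

/-- `d (x ⊗ w) = d x ⊗ w + (-1)^{|x|} x ⊗ d w`, with `w ∈ CL_•(X) ⊗ CL_•(X)`. -/
noncomputable def d3 : CL3 k X →ₗ[k] CL3 k X :=
  TensorProduct.map (dTot k X) LinearMap.id + TensorProduct.map (parity k X) (d2 k X)

/-- The grading of `CL_•(X)`. -/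
noncomputable def deg1 : ℕ → Submodule k (CLTot k X) := sumDeg k (CL k X)

/-- The grading of `CL_•(X) ⊗ CL_•(X)`. -/
noncomputable def deg2 : ℕ → Submodule k (CL2 k X) := tensorDeg (deg1 k X) (deg1 k X)

/-- The grading of `CL_•(X) ⊗ CL_•(X) ⊗ CL_•(X)`. -/
noncomputable def deg3 : ℕ → Submodule k (CL3 k X) := tensorDeg (deg1 k X) (deg2 k X)

/-- The graded twist `τ (x ⊗ y) = (-1)^{|x||y|} y ⊗ x`. -/
noncomputable def twist : CL2 k X →ₗ[k] CL2 k X :=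
  (TensorProduct.gradedComm k (CL k X) (CL k X)).toLinearMap

variable {X} {Y : CubicalSet.{u}}

/-- The map `CL_n(X) → CL_n(Y)` induced by a morphism of cubical sets. -/
noncomputable def mapCL (f : Hom X Y) (n : ℕ) : CL k X n →ₗ[k] CL k Y n :=
  (DL k X n).mapQ (DL k Y n) (Finsupp.lmapDomain k k f.lapp) <| by
    refine Submodule.span_le.2 ?_
    rintro _ ⟨x, hx, rfl⟩
    exact Submodule.subset_span ⟨_, f.lapp_degen hx, by simp⟩

/-- The map `CL_•(X) → CL_•(Y)` induced by a morphism of cubical sets. -/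
noncomputable def map1 (f : Hom X Y) : CLTot k X →ₗ[k] CLTot k Y :=
  DirectSum.lmap (mapCL k f)

/-- The map induced on the tensor squares. -/
noncomputable def map2 (f : Hom X Y) : CL2 k X →ₗ[k] CL2 k Y :=
  TensorProduct.map (map1 k f) (map1 k f)

/-- The map induced on the tensor cubes. -/
noncomputable def map3 (f : Hom X Y) : CL3 k X →ₗ[k] CL3 k Y :=
  TensorProduct.map (map1 k f) (map2 k f)

end Tensor

/-! ### Shuffle formulas -/

/-- The face `d_{i,ε}` (with `i` counted from `0`) on cells of `LX` of arbitrary dimension; it is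
only used for `i` smaller than the dimension. -/
def faceAt (X : CubicalSet.{u}) (ε : Bool) (i : ℕ) : (Σ n, X.LCell n) → Σ n, X.LCell n
  | ⟨0, x⟩ => ⟨0, x⟩
  | ⟨n + 1, x⟩ => if h : i < n + 1 then ⟨n, X.lface ⟨i, h⟩ ε x⟩ else ⟨n + 1, x⟩

/-- `faces X ε [i₁, …, i_q] x = d_{i₁,ε} ⋯ d_{i_q,ε} x`. -/
def faces (X : CubicalSet.{u}) (ε : Bool) (l : List ℕ) (x : Σ n, X.LCell n) : Σ n, X.LCell n :=
  l.foldr (X.faceAt ε) x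

/-- The `(p,q)`-shuffles: `σ(1) < ⋯ < σ(p)` and `σ(p+1) < ⋯ < σ(p+q)`. -/
def IsShuffle (p q : ℕ) (σ : Equiv.Perm (Fin (p + q))) : Prop :=
  (∀ i j : Fin p, i < j → σ (Fin.castAdd q i) < σ (Fin.castAdd q j)) ∧
  (∀ i j : Fin q, i < j → σ (Fin.natAdd p i) < σ (Fin.natAdd p j))

/-- The `(p,q)`-shuffles with `σ(1) = 1`. -/
def IsShuffleLeft (p q : ℕ) (σ : Equiv.Perm (Fin (p + q))) : Prop :=
  IsShuffle p q σ ∧ ∀ j : Fin (p + q), (j : ℕ) = 0 → (σ j : ℕ) = 0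

/-- The `(p,q)`-shuffles with `σ(p+1) = 1`. -/
def IsShuffleRight (p q : ℕ) (σ : Equiv.Perm (Fin (p + q))) : Prop :=
  IsShuffle p q σ ∧ ∀ j : Fin (p + q), (j : ℕ) = p → (σ j : ℕ) = 0

section Formula

variable (k : Type v) [CommRing k] (X : CubicalSet.{u})

/-- `ε(σ) d_{σ(p+1),0} ⋯ d_{σ(p+q),0} x ⊗ d_{σ(1),1} ⋯ d_{σ(p),1} x`. -/
noncomputable def shuffleTerm (x : Σ n, X.LCell n) (p q : ℕ) (σ : Equiv.Perm (Fin (p + q))) :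
    CL2 k X :=
  ((Equiv.Perm.sign σ : ℤ) : k) •
    (gen k X (X.faces false (List.ofFn fun j : Fin q => (σ (Fin.natAdd p j) : ℕ)) x) ⊗ₜ[k]
      gen k X (X.faces true (List.ofFn fun i : Fin p => (σ (Fin.castAdd q i) : ℕ)) x))

open Classical in
/-- The sum of the shuffle terms over all `p, q ≥ 1` with `p + q = |x|` and all `(p,q)`-shuffles
with `σ(1) = 1`. -/
noncomputable def precFormula (x : Σ n, X.LCell n) : CL2 k X :=
  ∑ p ∈ (Finset.HasAntidiagonal.antidiagonal x.1).filter (fun p => 1 ≤ p.1 ∧ 1 ≤ p.2),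
    ∑ σ : Equiv.Perm (Fin (p.1 + p.2)) with IsShuffleLeft p.1 p.2 σ, shuffleTerm k X x p.1 p.2 σ

open Classical in
/-- The sum of the shuffle terms over all `p, q ≥ 1` with `p + q = |x|` and all `(p,q)`-shuffles
with `σ(p+1) = 1`. -/
noncomputable def succFormula (x : Σ n, X.LCell n) : CL2 k X :=
  ∑ p ∈ (Finset.HasAntidiagonal.antidiagonal x.1).filter (fun p => 1 ≤ p.1 ∧ 1 ≤ p.2),
    ∑ σ : Equiv.Perm (Fin (p.1 + p.2)) with IsShuffleRight p.1 p.2 σ, shuffleTerm k X x p.1 p.2 σ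

end Formula

/-! ### Natural coproducts and natural homotopies -/

/-- A natural chain map `CL_• → CL_• ⊗ CL_•` of degree `0`, on all cubical sets. -/
structure NatCoproduct (k : Type v) [CommRing k] where
  app : ∀ X : CubicalSet.{u}, CLTot k X →ₗ[k] CL2 k X
  app_mem : ∀ (X : CubicalSet.{u}) (n : ℕ), ∀ v ∈ deg1 k X n, app X v ∈ deg2 k X n
  comm : ∀ X : CubicalSet.{u}, d2 k X ∘ₗ app X = app X ∘ₗ dTot k X
  natural : ∀ (X Y : CubicalSet.{u}) (f : Hom X Y), app Y ∘ₗ map1 k f = map2 k f ∘ₗ app X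

section Relations

variable {k : Type v} [CommRing k]

/-- In degrees `≤ 2`: zero in degrees `0` and `1`, and `x ↦ d_{2,0} x ⊗ d_{1,1} x` in degree `2`. -/
def NatCoproduct.ExtendsPrec (P : NatCoproduct.{u} k) : Prop :=
  ∀ X : CubicalSet.{u}, (∀ x : X.LCell 0, P.app X (gen k X ⟨0, x⟩) = 0) ∧
    (∀ x : X.LCell 1, P.app X (gen k X ⟨1, x⟩) = 0) ∧
    ∀ x : X.LCell 2, P.app X (gen k X ⟨2, x⟩) =
      gen k X ⟨1, X.lface 1 false x⟩ ⊗ₜ[k] gen k X ⟨1, X.lface 0 true x⟩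

/-- In degrees `≤ 2`: zero in degrees `0` and `1`, and `x ↦ -d_{1,0} x ⊗ d_{2,1} x` in degree `2`. -/
def NatCoproduct.ExtendsSucc (S : NatCoproduct.{u} k) : Prop :=
  ∀ X : CubicalSet.{u}, (∀ x : X.LCell 0, S.app X (gen k X ⟨0, x⟩) = 0) ∧
    (∀ x : X.LCell 1, S.app X (gen k X ⟨1, x⟩) = 0) ∧
    ∀ x : X.LCell 2, S.app X (gen k X ⟨2, x⟩) =
      -(gen k X ⟨1, X.lface 0 false x⟩ ⊗ₜ[k] gen k X ⟨1, X.lface 1 true x⟩)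

/-- Natural chain homotopy between natural maps `CL_• → CL_• ⊗ CL_•`. -/
def NatHomotopic2 (F G : ∀ X : CubicalSet.{u}, CLTot k X →ₗ[k] CL2 k X) : Prop :=
  ∃ h : ∀ X : CubicalSet.{u}, CLTot k X →ₗ[k] CL2 k X,
    (∀ (X : CubicalSet.{u}) (n : ℕ), ∀ v ∈ deg1 k X n, h X v ∈ deg2 k X (n + 1)) ∧
    (∀ X : CubicalSet.{u}, d2 k X ∘ₗ h X + h X ∘ₗ dTot k X = G X - F X) ∧
    ∀ (X Y : CubicalSet.{u}) (f : Hom X Y), h Y ∘ₗ map1 k f = map2 k f ∘ₗ h X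

/-- Natural chain homotopy between natural maps `CL_• → CL_• ⊗ CL_• ⊗ CL_•`. -/
def NatHomotopic3 (F G : ∀ X : CubicalSet.{u}, CLTot k X →ₗ[k] CL3 k X) : Prop :=
  ∃ h : ∀ X : CubicalSet.{u}, CLTot k X →ₗ[k] CL3 k X,
    (∀ (X : CubicalSet.{u}) (n : ℕ), ∀ v ∈ deg1 k X n, h X v ∈ deg3 k X (n + 1)) ∧
    (∀ X : CubicalSet.{u}, d3 k X ∘ₗ h X + h X ∘ₗ dTot k X = G X - F X) ∧
    ∀ (X Y : CubicalSet.{u}) (f : Hom X Y), h Y ∘ₗ map1 k f = map3 k f ∘ₗ h X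

end Relations

end CubicalSet

section Iterates

variable {k : Type*} [CommRing k] {V : Type*} [AddCommGroup V] [Module k V]

/-- `(Δ ⊗ id) ∘ Δ'`. -/
noncomputable def leftIter (Δ Δ' : V →ₗ[k] V ⊗[k] V) : V →ₗ[k] V ⊗[k] (V ⊗[k] V) :=
  (TensorProduct.assoc k V V V).toLinearMap ∘ₗ TensorProduct.map Δ LinearMap.id ∘ₗ Δ'

/-- `(id ⊗ Δ) ∘ Δ'`. -/
noncomputable def rightIter (Δ Δ' : V →ₗ[k] V ⊗[k] V) : V →ₗ[k] V ⊗[k] (V ⊗[k] V) :=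
  TensorProduct.map LinearMap.id Δ ∘ₗ Δ'

end Iterates

namespace CubicalSet

section Relations

variable {k : Type v} [CommRing k]

/-- `(CL_•, Δ≺, Δ≻)` satisfies the codendriform relations up to (natural) chain homotopy. -/
structure IsHomotopyCodendriform (P S : NatCoproduct.{u} k) : Prop where
  left : NatHomotopic3 (fun X => leftIter (P.app X) (P.app X))
    (fun X => rightIter (P.app X + S.app X) (P.app X))
  middle : NatHomotopic3 (fun X => leftIter (S.app X) (P.app X))
    (fun X => rightIter (P.app X) (S.app X))
  right : NatHomotopic3 (fun X => rightIter (S.app X) (S.app X))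
    (fun X => leftIter (P.app X + S.app X) (S.app X))

/-- `(CL_•, Δ≺, Δ≻)` is a homotopy coZinbiel coalgebra: a homotopy codendriform coalgebra with
`Δ≻ ≃ τ ∘ Δ≺`; in particular `Δ≺` satisfies the coZinbiel relation up to homotopy. -/
structure IsHomotopyCoZinbiel (P S : NatCoproduct.{u} k) : Prop where
  codendriform : IsHomotopyCodendriform P S
  symm : NatHomotopic2 S.app (fun X => twist k X ∘ₗ P.app X)
  coZinbiel : NatHomotopic3 (fun X => leftIter (P.app X) (P.app X))
    (fun X => rightIter (P.app X + twist k X ∘ₗ P.app X) (P.app X))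

end Relations

/-! ### L-homology -/

section Homology

variable (k : Type v) [CommRing k] (X : CubicalSet.{u})

/-- The cycles of degree `n`. -/
noncomputable def cycles : ∀ n : ℕ, Submodule k (CL k X n)
  | 0 => ⊤
  | n + 1 => LinearMap.ker (dCL k X n)

/-- `HL_n(X, k)`: cycles modulo boundaries. -/
def HL (n : ℕ) : Type (max u v) :=
  cycles k X n ⧸ (LinearMap.range (dCL k X n)).submoduleOf (cycles k X n)

noncomputable instance (n : ℕ) : AddCommGroup (HL k X n) :=
  inferInstanceAs (AddCommGroup
    (cycles k X n ⧸ (LinearMap.range (dCL k X n)).submoduleOf (cycles k X n)))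

noncomputable instance (n : ℕ) : Module k (HL k X n) :=
  inferInstanceAs (Module k
    (cycles k X n ⧸ (LinearMap.range (dCL k X n)).submoduleOf (cycles k X n)))

/-- The homology class of a cycle. -/
noncomputable def mkHL (n : ℕ) : cycles k X n →ₗ[k] HL k X n :=
  ((LinearMap.range (dCL k X n)).submoduleOf (cycles k X n)).mkQ

/-- `HL_•(X, k) = ⨁ₙ HL_n(X, k)`. -/
abbrev HLTot : Type (max u v) := ⨁ n, HL k X n

/-- The graded module of cycles. -/
abbrev cyclesTot : Type (max u v) := ⨁ n, cycles k X n

/-- The inclusion of the cycles in `CL_•(X)`. -/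
noncomputable def cyclesIncl : cyclesTot k X →ₗ[k] CLTot k X :=
  DirectSum.lmap fun n => (cycles k X n).subtype

/-- The projection of the cycles on `HL_•(X, k)`. -/
noncomputable def cyclesProj : cyclesTot k X →ₗ[k] HLTot k X :=
  DirectSum.lmap (mkHL k X)

/-- The class in `HL_0(X, k)` of the unique `0`-cell of `LX`. -/
noncomputable def pointClass : HL k X 0 :=
  mkHL k X 0 ⟨mkCL k X 0 (Finsupp.single PUnit.unit 1), Submodule.mem_top⟩

variable {k X}

/-- `δ` is the coproduct on homology induced by `Δ`: if `z` is a cycle then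
`δ [z] = ∑ [a_i] ⊗ [b_i]` for cycles `a_i`, `b_i` such that `Δ z` is homologous to `∑ a_i ⊗ b_i`. -/
def Induces (Δ : CLTot k X →ₗ[k] CL2 k X)
    (δ : HLTot k X →ₗ[k] HLTot k X ⊗[k] HLTot k X) : Prop :=
  ∀ z : cyclesTot k X, ∃ t : cyclesTot k X ⊗[k] cyclesTot k X,
    δ (cyclesProj k X z) = TensorProduct.map (cyclesProj k X) (cyclesProj k X) t ∧
    Δ (cyclesIncl k X z) - TensorProduct.map (cyclesIncl k X) (cyclesIncl k X) t ∈
      LinearMap.range (d2 k X)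

end Homology

end CubicalSet

/-! ### Connected coZinbiel coalgebras -/

section CoZinbiel

variable {k : Type*} [CommRing k] {A : ℕ → Type*} [∀ n, AddCommGroup (A n)]
  [∀ n, Module k (A n)]

/-- The filtration `F_1 ⊆ F_2 ⊆ ⋯` (indexed from `0`) of the augmentation ideal `ker c` defined by
the reduced coproduct `δ`: `F_1 = ker δ` and `F_{r+1} = {x | δ x ∈ F_r ⊗ F_r}`. -/
def primitiveFiltration {V : Type*} [AddCommGroup V] [Module k V] (c : V →ₗ[k] k)
    (δ : V →ₗ[k] V ⊗[k] V) : ℕ → Submodule k V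
  | 0 => LinearMap.ker c ⊓ LinearMap.ker δ
  | r + 1 => LinearMap.ker c ⊓ (Submodule.map₂ (TensorProduct.mk k V V)
      (primitiveFiltration c δ r) (primitiveFiltration c δ r)).comap δ

/-- The graded module `A = k·1 ⊕ ker c`, with reduced coproduct `δ` (extended by `δ 1 = 0`), is a
connected (counital, graded) coZinbiel coalgebra. Its coproduct on `ker c` is
`Δ≺ x = δ x + x ⊗ 1`; it has no prescribed value on `1`. -/
structure IsConnectedCoZinbiel (one : A 0) (c : (⨁ n, A n) →ₗ[k] k)
    (δ : (⨁ n, A n) →ₗ[k] (⨁ n, A n) ⊗[k] (⨁ n, A n)) : Prop where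
  counit_one : c (DirectSum.lof k ℕ A 0 one) = 1
  counit_pos : ∀ (n : ℕ) (a : A (n + 1)), c (DirectSum.lof k ℕ A (n + 1) a) = 0
  degree_zero : ∀ a : A 0, a ∈ Submodule.span k {one}
  delta_one : δ (DirectSum.lof k ℕ A 0 one) = 0
  graded : ∀ n : ℕ, ∀ x ∈ sumDeg k A n, δ x ∈ tensorDeg (sumDeg k A) (sumDeg k A) n
  counit_left : ∀ x, c x = 0 → TensorProduct.lid k (⨁ n, A n)
    (TensorProduct.map c LinearMap.id (δ x + x ⊗ₜ[k] DirectSum.lof k ℕ A 0 one)) = 0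
  counit_right : ∀ x, c x = 0 → TensorProduct.rid k (⨁ n, A n)
    (TensorProduct.map LinearMap.id c (δ x + x ⊗ₜ[k] DirectSum.lof k ℕ A 0 one)) = x
  coZinbiel : leftIter δ δ =
    rightIter (δ + (TensorProduct.gradedComm k A A).toLinearMap ∘ₗ δ) δ
  conilpotent : ⨆ r, primitiveFiltration c δ r = LinearMap.ker c

end CoZinbiel

/-!
The proof is an acyclic models argument, together with one explicit construction.

*Acyclicity.* For `n ≥ 1` the functor `X ↦ LX_n` is represented by a cubical set `model n`,
presented by one cell whose iterated first faces agree in each dimension. Its faces are written as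
words in `0`, `1`, `*` (`act`), where the fixed coordinates at the beginning may be dropped
(`act_eq_reducedFace`). These words form a basis of the chains in positive degree: they span by
`model_cells`, and they are independent because `modelRetract` recovers a word from the lists of
coordinate functions in `letterCubes`. Contracting the cube one coordinate at a time, all but the
first, gives a contraction of these chains in degrees `> 1` (`model_isContraction`), hence of their
tensor square in degrees `> 2` and of their tensor cube in degrees `> 3`. The quotient by the
degenerate cells splits naturally, by the commuting operators `1 - s_i d_{i,0}` (`splitCL`). So a
null homotopy can be prescribed on the generators of the models (`exists_nullHomotopy`): natural
chain maps from `CL_•` to its tensor square that agree in degrees `≤ 2`, or to its tensor cube that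
agree in degrees `≤ 3`, are naturally homotopic.

*Existence.* The diagonal of the `n`-cube is the product of `n` copies of `* ⊗ 1 + 0 ⊗ *`, and each
further coordinate contributes only its two faces to the boundary (`dWW_serreStep`). If the first
coordinate is restricted to one of the two terms, its contribution to the boundary vanishes on cells
of `LX`, because there `d_{1,0} = d_{1,1}`. Thus each half of the diagonal is a chain map
(`IsSerreStart.diag_comm`), and it remains one without the term `x ⊗ ⋆`, respectively `⋆ ⊗ x`.
Expanding the product gives a sum over the subsets of the coordinates, which is the sum over the
shuffles (`serrePrec_gen`, `serreSucc_gen`).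

*Relations.* By uniqueness up to homotopy it is enough to treat these two maps. Both sides of the
codendriform relations vanish in degrees `≤ 2` and agree on `3`-cells by the cubical identities
(`serre_left`, `serre_middle`, `serre_right`). In degree `2` the maps `Δ≻` and `τ Δ≺` differ by the
boundary of `d_{1,0} x ⊗ x` (`natHomotopic_twist`).

*Homology over a field.* Maps `g` with `d g d = d` give a retraction `r` of the chains on the
homology that kills boundaries, and `1 - d g - g d` is homotopic to the identity
(`exists_splitting`). Hence `δ = (r ⊗ r) Δ≺` on cycles is well defined, induced by `Δ≺`, and the
only map with this property; it inherits the coZinbiel relation. As the shuffle formula has only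
terms with `p, q ≥ 1`, `δ` maps the part of degree `n` to tensors of two factors of positive degree
`< n` (`IsHomologyCoproduct.delta_mem`), which gives the counit equations and, by induction on the
degree, the exhaustion of `ker c` by the primitive filtration.
-/


namespace CubicalSet

/-! ### Faces of cells of arbitrary dimension, and generators of the chain complex -/

section Cells

variable {X : CubicalSet.{u}}

theorem faceAt_mk {n i : ℕ} (ε : Bool) (h : i < n + 1) (x : X.LCell (n + 1)) :
    X.faceAt ε i ⟨n + 1, x⟩ = ⟨n, X.lface ⟨i, h⟩ ε x⟩ := dif_pos h

theorem faceAt_fst (ε : Bool) {i : ℕ} (x : Σ n, X.LCell n) (h : i < x.1) :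
    (X.faceAt ε i x).1 = x.1 - 1 := by
  obtain ⟨n, x⟩ := x
  cases n with
  | zero => exact absurd h (Nat.not_lt_zero _)
  | succ n => rw [faceAt_mk ε h]; rfl

theorem faceAt_faceAt (ε ω : Bool) {i j : ℕ} (hij : i ≤ j) (x : Σ n, X.LCell n)
    (h : j + 1 < x.1) :
    X.faceAt ω j (X.faceAt ε i x) = X.faceAt ε i (X.faceAt ω (j + 1) x) := by
  obtain ⟨n, x⟩ := x
  obtain ⟨n, rfl⟩ : ∃ m, n = m + 2 := ⟨n - 2, by simp at h; omega⟩
  have hj : j < n + 1 := by simp at h; omega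
  rw [faceAt_mk ε (by omega), faceAt_mk ω hj, faceAt_mk ω (by omega), faceAt_mk ε (by omega)]
  have := X.lface_lface ⟨i, by omega⟩ ⟨j, hj⟩ ε ω x hij
  simpa using this

/-- The two first faces of a cell of `LX` agree. -/
theorem faceAt_zero_eq (ε ω : Bool) (x : Σ n, X.LCell n) :
    X.faceAt ε 0 x = X.faceAt ω 0 x := by
  obtain ⟨n, x⟩ := x
  cases n with
  | zero => rfl
  | succ n =>
    rw [faceAt_mk ε (by omega), faceAt_mk ω (by omega)]
    cases n with
    | zero => rfl
    | succ n =>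
      congr 1
      exact Subtype.ext (x.2 _ _ _ (.step ε .refl) (.step ω .refl))

/-- The action of a morphism of cubical sets on cells of `LX` of arbitrary dimension. -/
def Hom.sapp {Y : CubicalSet.{u}} (f : Hom X Y) (x : Σ n, X.LCell n) : Σ n, Y.LCell n :=
  ⟨x.1, f.lapp x.2⟩

theorem Hom.sapp_faceAt {Y : CubicalSet.{u}} (f : Hom X Y) (ε : Bool) (i : ℕ)
    (x : Σ n, X.LCell n) : f.sapp (X.faceAt ε i x) = Y.faceAt ε i (f.sapp x) := by
  obtain ⟨n, x⟩ := x
  cases n with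
  | zero => rfl
  | succ n =>
    by_cases h : i < n + 1
    · rw [faceAt_mk ε h]
      change _ = Y.faceAt ε i ⟨n + 1, f.lapp x⟩
      rw [faceAt_mk ε h]
      cases n with
      | zero => rfl
      | succ n => exact congrArg (Sigma.mk (n + 1)) (Subtype.ext (f.app_face _ _ _))
    · have h1 : X.faceAt ε i ⟨n + 1, x⟩ = ⟨n + 1, x⟩ := dif_neg h
      have h2 : Y.faceAt ε i (f.sapp ⟨n + 1, x⟩) = f.sapp ⟨n + 1, x⟩ := dif_neg h
      rw [h1, h2]

end Cells

section Generators

variable (k : Type v) [CommRing k] (X : CubicalSet.{u})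

theorem gen_mk {n : ℕ} (x : X.LCell n) :
    gen k X ⟨n, x⟩ = DirectSum.lof k ℕ (CL k X) n (mkCL k X n (Finsupp.single x 1)) := rfl

theorem gen_degen {x : Σ n, X.LCell n} (hx : X.IsDegen x.2) : gen k X x = 0 := by
  have : mkCL k X x.1 (Finsupp.single x.2 1) = 0 :=
    (Submodule.Quotient.mk_eq_zero _).2 (Submodule.subset_span ⟨x.2, hx, rfl⟩)
  rw [gen, this, map_zero]

theorem deg1_eq_span (n : ℕ) :
    deg1 k X n = Submodule.span k (Set.range fun x : X.LCell n => gen k X ⟨n, x⟩) := by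
  apply le_antisymm
  · rintro _ ⟨v, rfl⟩
    obtain ⟨v, rfl⟩ := (DL k X n).mkQ_surjective v
    change DirectSum.lof k ℕ (CL k X) n (mkCL k X n v) ∈ _
    induction v using Finsupp.induction_linear with
    | zero => simp
    | add a b ha hb => rw [map_add, map_add]; exact Submodule.add_mem _ ha hb
    | single x a =>
      have : Finsupp.single x a = a • Finsupp.single x (1 : k) := by simp
      rw [this, map_smul, map_smul]
      exact Submodule.smul_mem _ _ (Submodule.subset_span ⟨x, rfl⟩)
  · rw [Submodule.span_le]
    rintro _ ⟨x, rfl⟩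
    exact ⟨_, rfl⟩

theorem gen_mem_deg1 (x : Σ n, X.LCell n) : gen k X x ∈ deg1 k X x.1 := ⟨_, rfl⟩

theorem iSup_deg1 : ⨆ n, deg1 k X n = ⊤ := by
  rw [eq_top_iff]
  intro v _
  induction v using DirectSum.induction_on with
  | zero => exact Submodule.zero_mem _
  | of i x => exact (le_iSup (deg1 k X) i) ⟨x, rfl⟩
  | add a b ha hb => exact Submodule.add_mem _ (ha trivial) (hb trivial)

theorem span_gen : Submodule.span k (Set.range (gen k X)) = ⊤ := by
  rw [eq_top_iff, ← iSup_deg1, iSup_le_iff]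
  intro n
  rw [deg1_eq_span]
  exact Submodule.span_mono (by rintro _ ⟨x, rfl⟩; exact ⟨_, rfl⟩)

variable {k X}

theorem hom_ext_gen {M : Type*} [AddCommGroup M] [Module k M] {f g : CLTot k X →ₗ[k] M}
    (h : ∀ x, f (gen k X x) = g (gen k X x)) : f = g :=
  LinearMap.ext_on_range (span_gen k X) h

variable (k)

theorem dTot_gen (x : Σ n, X.LCell n) :
    dTot k X (gen k X x) = ∑ i ∈ Finset.range x.1,
      (-1 : k) ^ i • (gen k X (X.faceAt true i x) - gen k X (X.faceAt false i x)) := by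
  obtain ⟨n, x⟩ := x
  cases n with
  | zero => rw [gen_mk, dTot, DirectSum.toModule_lof]; simp
  | succ n =>
    rw [gen_mk, dTot, DirectSum.toModule_lof, Finset.sum_range]
    change DirectSum.lof k ℕ (CL k X) n (mkCL k X n (dQL k X n (Finsupp.single x 1))) = _
    rw [dQL_single, map_sum, map_sum]
    refine Finset.sum_congr rfl fun i _ => ?_
    rw [faceAt_mk true i.2, faceAt_mk false i.2, gen_mk, gen_mk]
    simp

theorem parity_gen (x : Σ n, X.LCell n) :
    parity k X (gen k X x) = (-1 : k) ^ x.1 • gen k X x := by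
  rw [gen, parity, DirectSum.lmap_lof]
  simp

theorem map1_gen {Y : CubicalSet.{u}} (f : Hom X Y) (x : Σ n, X.LCell n) :
    map1 k f (gen k X x) = gen k Y (f.sapp x) := by
  rw [gen, map1, DirectSum.lmap_lof]
  change DirectSum.lof k ℕ (CL k Y) x.1 (mkCL k Y x.1 (Finsupp.lmapDomain k k f.lapp _)) = _
  rw [Finsupp.lmapDomain_apply, Finsupp.mapDomain_single]
  rfl

theorem dTot_dTot (v : CLTot k X) : dTot k X (dTot k X v) = 0 := by
  suffices h : dTot k X ∘ₗ dTot k X = 0 from LinearMap.congr_fun h v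
  refine DirectSum.linearMap_ext _ fun n => LinearMap.ext fun v => ?_
  simp only [LinearMap.comp_apply, LinearMap.zero_apply]
  match n, v with
  | 0, v => rw [dTot, DirectSum.toModule_lof]; simp
  | 1, v =>
    rw [dTot, DirectSum.toModule_lof, LinearMap.comp_apply, DirectSum.toModule_lof]; simp
  | n + 2, v =>
    rw [dTot, DirectSum.toModule_lof, LinearMap.comp_apply, DirectSum.toModule_lof,
      LinearMap.comp_apply, dCL_dCL, map_zero]

theorem dTot_lof_zero (v : CL k X 0) : dTot k X (DirectSum.lof k ℕ (CL k X) 0 v) = 0 := by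
  rw [dTot, DirectSum.toModule_lof]; simp

theorem dTot_lof_succ (n : ℕ) (v : CL k X (n + 1)) :
    dTot k X (DirectSum.lof k ℕ (CL k X) (n + 1) v) =
      DirectSum.lof k ℕ (CL k X) n (dCL k X n v) := by
  rw [dTot, DirectSum.toModule_lof]; simp

theorem dTot_mem_deg1 {n : ℕ} {v : CLTot k X} (hv : v ∈ deg1 k X (n + 1)) :
    dTot k X v ∈ deg1 k X n := by
  obtain ⟨v, rfl⟩ := hv
  exact ⟨_, (dTot_lof_succ k n v).symm⟩

theorem dTot_of_mem_deg1_zero {v : CLTot k X} (hv : v ∈ deg1 k X 0) : dTot k X v = 0 := by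
  obtain ⟨v, rfl⟩ := hv
  exact dTot_lof_zero k v

theorem parity_of_mem_deg1 {n : ℕ} {v : CLTot k X} (hv : v ∈ deg1 k X n) :
    parity k X v = (-1 : k) ^ n • v := by
  obtain ⟨v, rfl⟩ := hv
  rw [parity, DirectSum.lmap_lof]
  simp

/-- Linear maps out of a graded module agree if they agree on homogeneous elements. -/
theorem hom_ext_deg1 {M : Type*} [AddCommGroup M] [Module k M] {f g : CLTot k X →ₗ[k] M}
    (h : ∀ n, ∀ v ∈ deg1 k X n, f v = g v) : f = g :=
  hom_ext_gen fun x => h _ _ (gen_mem_deg1 k X x)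

theorem parity_comp_parity : parity k X ∘ₗ parity k X = LinearMap.id :=
  hom_ext_gen fun x => by
    simp [parity_gen, smul_smul, ← pow_add, ← two_mul]

theorem dTot_comp_parity : dTot k X ∘ₗ parity k X = -(parity k X ∘ₗ dTot k X) := by
  refine hom_ext_deg1 k fun n v hv => ?_
  cases n with
  | zero => simp [parity_of_mem_deg1 k hv, dTot_of_mem_deg1_zero k hv]
  | succ n =>
    simp [parity_of_mem_deg1 k hv, parity_of_mem_deg1 k (dTot_mem_deg1 k hv), pow_succ]

theorem map1_comp_dTot {Y : CubicalSet.{u}} (f : Hom X Y) :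
    map1 k f ∘ₗ dTot k X = dTot k Y ∘ₗ map1 k f :=
  hom_ext_gen fun x => by
    simp only [LinearMap.comp_apply, dTot_gen, map1_gen, map_sum, map_smul, map_sub,
      Hom.sapp_faceAt]
    rfl

theorem map1_mem_deg1 {Y : CubicalSet.{u}} (f : Hom X Y) {n : ℕ} {v : CLTot k X}
    (hv : v ∈ deg1 k X n) : map1 k f v ∈ deg1 k Y n := by
  obtain ⟨v, rfl⟩ := hv
  exact ⟨mapCL k f n v, by rw [map1, DirectSum.lmap_lof]⟩

theorem map1_comp_parity {Y : CubicalSet.{u}} (f : Hom X Y) :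
    map1 k f ∘ₗ parity k X = parity k Y ∘ₗ map1 k f :=
  hom_ext_deg1 k fun n v hv => by
    simp [parity_of_mem_deg1 k hv, parity_of_mem_deg1 k (map1_mem_deg1 k f hv)]

end Generators

/-! ### Words in `0`, `1`, `*` -/

/-- A face of a cube, written as a word in the letters `some false`, `some true` (the coordinate is
fixed to be `0` or `1`) and `none` (the coordinate is free). The head of the list is the last
coordinate. -/
abbrev Word : Type := List (Option Bool)

/-- The number of free coordinates. -/
def Word.stars (u : Word) : ℕ := u.count none

@[simp] theorem Word.stars_nil : Word.stars [] = 0 := rfl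

@[simp] theorem Word.stars_none (u : Word) : Word.stars (none :: u) = u.stars + 1 := by
  simp [Word.stars]

@[simp] theorem Word.stars_some (ε : Bool) (u : Word) : Word.stars (some ε :: u) = u.stars := by
  simp [Word.stars]

section Act

variable {X : CubicalSet.{u}}

/-- The face of `x` described by a word `u`, whose letters are the coordinates of `x` with the
numbers `b, …, b + |u| - 1`; the remaining coordinates are free. -/
def act (b : ℕ) : Word → (Σ n, X.LCell n) → Σ n, X.LCell n
  | [], x => x
  | none :: u, x => act b u x
  | some ε :: u, x => act b u (X.faceAt ε (u.length + b) x)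

@[simp] theorem act_nil (b : ℕ) (x : Σ n, X.LCell n) : act b [] x = x := rfl

@[simp] theorem act_none (b : ℕ) (u : Word) (x : Σ n, X.LCell n) :
    act b (none :: u) x = act b u x := rfl

@[simp] theorem act_some (b : ℕ) (ε : Bool) (u : Word) (x : Σ n, X.LCell n) :
    act b (some ε :: u) x = act b u (X.faceAt ε (u.length + b) x) := rfl

theorem act_fst (b : ℕ) (u : Word) (x : Σ n, X.LCell n) (h : u.length + b ≤ x.1) :
    (act b u x).1 + u.length = x.1 + u.stars := by
  induction u generalizing x with
  | nil => rfl
  | cons a u ih =>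
    rw [List.length_cons] at h
    rcases a with _ | ε
    · have := ih x (by omega)
      simp only [act_none, List.length_cons, Word.stars_none]; omega
    · have h1 := faceAt_fst ε (i := u.length + b) x (by omega)
      have := ih (X.faceAt ε (u.length + b) x) (by omega)
      simp only [act_some, List.length_cons, Word.stars_some]; omega

theorem faceAt_act (b t : ℕ) (ω : Bool) (u : Word) (x : Σ n, X.LCell n)
    (h : u.length + b + t < x.1) :
    X.faceAt ω (u.stars + b + t) (act b u x) = act b u (X.faceAt ω (u.length + b + t) x) := by
  induction u generalizing x t with
  | nil => rfl
  | cons a u ih =>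
    rw [List.length_cons] at h
    rcases a with _ | ε
    · have := ih (t + 1) x (by omega)
      simp only [act_none, List.length_cons, Word.stars_none]
      convert this using 2 <;> ring_nf
    · have h1 := faceAt_fst ε (i := u.length + b) x (by omega)
      simp only [act_some, List.length_cons, Word.stars_some]
      rw [ih t _ (by omega), faceAt_faceAt ε ω (by omega) x (by omega)]
      congr 3; omega

/-- The letters at the end of a word act after all the others. -/
theorem act_append (b : ℕ) (u w : Word) (x : Σ n, X.LCell n) :
    act b (u ++ w) x = act b w (act (b + w.length) u x) := by
  induction u generalizing x with
  | nil => rfl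
  | cons a u ih =>
    rcases a with _ | ε
    · exact ih x
    · simp only [List.cons_append, act_some, ih, List.length_append]
      rw [show u.length + w.length + b = u.length + (b + w.length) by ring]

/-- Fixing one more coordinate, and removing it first. -/
theorem act_insert (b : ℕ) (ε : Bool) (c u : Word) (x : Σ n, X.LCell n)
    (h : c.length + u.length + 1 + b ≤ x.1) :
    act b (c ++ some ε :: u) x = act b (c ++ u) (X.faceAt ε (u.length + b) x) := by
  induction c generalizing x with
  | nil => rfl
  | cons a c ih =>
    rw [List.length_cons] at h
    rcases a with _ | ω
    · exact ih x (by omega)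
    · have h1 := faceAt_fst ω (i := (c ++ some ε :: u).length + b) x (by simp; omega)
      simp only [List.cons_append, act_some]
      rw [ih _ (by omega)]
      congr 1
      rw [faceAt_faceAt ε ω (by simp) x (by simp; omega)]
      congr 2
      simp; omega

theorem sapp_act {Y : CubicalSet.{u}} (f : Hom X Y) (b : ℕ) (u : Word) (x : Σ n, X.LCell n) :
    f.sapp (act b u x) = act b u (f.sapp x) := by
  induction u generalizing x with
  | nil => rfl
  | cons a u ih =>
    rcases a with _ | ε
    · exact ih x
    · rw [act_some, act_some, ih, f.sapp_faceAt]

end Act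

section WordModule

variable (k : Type v) [CommRing k]

/-- The free module on the words. -/
abbrev WMod : Type v := Word →₀ k

/-- Adding a letter at the head. -/
noncomputable def consW (a : Option Bool) : WMod k →ₗ[k] WMod k :=
  Finsupp.lmapDomain k k (List.cons a)

/-- The sign `(-1)^{|u|}`, where `|u|` is `b` plus the number of free coordinates. -/
noncomputable def parW (b : ℕ) : WMod k →ₗ[k] WMod k :=
  Finsupp.linearCombination k fun u => (-1 : k) ^ (Word.stars u + b) • Finsupp.single u 1

/-- The differential of a word, preceded by `b` free coordinates that are not differentiated. -/
noncomputable def dWord (b : ℕ) : Word → WMod k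
  | [] => 0
  | some ε :: u => consW k (some ε) (dWord b u)
  | none :: u => consW k none (dWord b u) + (-1 : k) ^ (Word.stars u + b) •
      (Finsupp.single (some true :: u) 1 - Finsupp.single (some false :: u) 1)

/-- The differential of the module of words. -/
noncomputable def dW (b : ℕ) : WMod k →ₗ[k] WMod k := Finsupp.linearCombination k (dWord k b)

/-- The contraction of the cube to the vertex `(0, …, 0)`, coordinate by coordinate. -/
noncomputable def sWord (b : ℕ) : Word → WMod k
  | [] => 0
  | some true :: u => (-1 : k) ^ (Word.stars u + b) • Finsupp.single (none :: u) 1 +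
      consW k (some false) (sWord b u)
  | some false :: u => consW k (some false) (sWord b u)
  | none :: _ => 0

/-- The linear extension of `sWord`. -/
noncomputable def sW (b : ℕ) : WMod k →ₗ[k] WMod k := Finsupp.linearCombination k (sWord k b)

/-- The projection of the cube to the vertex `(0, …, 0)`. -/
noncomputable def piWord (u : Word) : WMod k :=
  if u.stars = 0 then Finsupp.single (List.replicate u.length (some false)) 1 else 0

/-- The linear extension of `piWord`. -/
noncomputable def piW : WMod k →ₗ[k] WMod k := Finsupp.linearCombination k (piWord k)

variable {k}

@[simp] theorem consW_single (a : Option Bool) (u : Word) (r : k) :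
    consW k a (Finsupp.single u r) = Finsupp.single (a :: u) r := by
  simp [consW]

@[simp] theorem dW_single (b : ℕ) (u : Word) : dW k b (Finsupp.single u 1) = dWord k b u := by
  simp [dW]

@[simp] theorem sW_single (b : ℕ) (u : Word) : sW k b (Finsupp.single u 1) = sWord k b u := by
  simp [sW]

@[simp] theorem piW_single (u : Word) : piW k (Finsupp.single u 1) = piWord k u := by
  simp [piW]

@[simp] theorem parW_single (b : ℕ) (u : Word) : parW k b (Finsupp.single u 1) =
    (-1 : k) ^ (Word.stars u + b) • Finsupp.single u 1 := by
  simp [parW]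

theorem hom_ext_word {M : Type*} [AddCommGroup M] [Module k M] {f g : WMod k →ₗ[k] M}
    (h : ∀ u, f (Finsupp.single u 1) = g (Finsupp.single u 1)) : f = g :=
  Finsupp.lhom_ext' fun u => LinearMap.ext_ring (h u)

theorem dW_consW_some (b : ℕ) (ε : Bool) (v : WMod k) :
    dW k b (consW k (some ε) v) = consW k (some ε) (dW k b v) := by
  suffices h : dW k b ∘ₗ consW k (some ε) = consW k (some ε) ∘ₗ dW k b from
    LinearMap.congr_fun h v
  exact hom_ext_word fun u => by simp [dWord]

theorem dW_consW_none (b : ℕ) (v : WMod k) :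
    dW k b (consW k none v) = consW k none (dW k b v) +
      (consW k (some true) (parW k b v) - consW k (some false) (parW k b v)) := by
  suffices h : dW k b ∘ₗ consW k none = consW k none ∘ₗ dW k b +
      (consW k (some true) ∘ₗ parW k b - consW k (some false) ∘ₗ parW k b) from
    LinearMap.congr_fun h v
  exact hom_ext_word fun u => by simp [dWord, smul_sub]

theorem parW_consW_some (b : ℕ) (ε : Bool) (v : WMod k) :
    parW k b (consW k (some ε) v) = consW k (some ε) (parW k b v) := by
  suffices h : parW k b ∘ₗ consW k (some ε) = consW k (some ε) ∘ₗ parW k b from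
    LinearMap.congr_fun h v
  exact hom_ext_word fun u => by simp

theorem parW_consW_none (b : ℕ) (v : WMod k) :
    parW k b (consW k none v) = -consW k none (parW k b v) := by
  suffices h : parW k b ∘ₗ consW k none = -(consW k none ∘ₗ parW k b) from
    LinearMap.congr_fun h v
  exact hom_ext_word fun u => by simp [-Finsupp.smul_single, pow_succ, add_right_comm _ 1 b]

theorem parW_parW (b : ℕ) (v : WMod k) : parW k b (parW k b v) = v := by
  suffices h : parW k b ∘ₗ parW k b = LinearMap.id from LinearMap.congr_fun h v
  exact hom_ext_word fun u => by
    simp [-Finsupp.smul_single, smul_smul, ← pow_add, ← two_mul]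

theorem parW_dW (b : ℕ) (v : WMod k) : parW k b (dW k b v) = -dW k b (parW k b v) := by
  suffices h : parW k b ∘ₗ dW k b = -(dW k b ∘ₗ parW k b) from LinearMap.congr_fun h v
  refine hom_ext_word fun u => ?_
  simp only [LinearMap.comp_apply, LinearMap.neg_apply]
  induction u with
  | nil => simp [-Finsupp.smul_single, dWord]
  | cons a u ih =>
    rcases a with _ | ε
    · rw [← consW_single, parW_consW_none, map_neg, dW_consW_none, dW_consW_none, map_add,
        map_sub, parW_consW_none, ih, parW_consW_some, parW_consW_some, map_neg]
      abel
    · rw [← consW_single, parW_consW_some, dW_consW_some, dW_consW_some, parW_consW_some, ih,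
        map_neg]

theorem sW_consW_none (b : ℕ) (v : WMod k) : sW k b (consW k none v) = 0 := by
  suffices h : sW k b ∘ₗ consW k none = 0 from LinearMap.congr_fun h v
  exact hom_ext_word fun u => by simp [sWord]

theorem sW_consW_false (b : ℕ) (v : WMod k) :
    sW k b (consW k (some false) v) = consW k (some false) (sW k b v) := by
  suffices h : sW k b ∘ₗ consW k (some false) = consW k (some false) ∘ₗ sW k b from
    LinearMap.congr_fun h v
  exact hom_ext_word fun u => by simp [sWord]

theorem sW_consW_true (b : ℕ) (v : WMod k) :
    sW k b (consW k (some true) v) =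
      consW k none (parW k b v) + consW k (some false) (sW k b v) := by
  suffices h : sW k b ∘ₗ consW k (some true) =
      consW k none ∘ₗ parW k b + consW k (some false) ∘ₗ sW k b from LinearMap.congr_fun h v
  exact hom_ext_word fun u => by simp [sWord]

/-- The contraction is a homotopy from the projection to the identity. -/
theorem dW_sW_add (b : ℕ) (u : Word) :
    dW k b (sWord k b u) + sW k b (dWord k b u) = Finsupp.single u 1 - piWord k u := by
  induction u with
  | nil => simp [sWord, dWord, piWord]
  | cons a u ih =>
    rw [← sW_single, ← dW_single] at ih ⊢
    have key : ∀ ε, consW k (some false) (dW k b (sW k b (Finsupp.single u 1)) +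
        sW k b (dW k b (Finsupp.single u 1))) =
          Finsupp.single (some false :: u) 1 - piWord k (some ε :: u) := by
      intro ε
      rw [ih, map_sub, consW_single]
      congr 1
      by_cases h : Word.stars u = 0 <;> simp [piWord, h, List.replicate_succ]
    rcases a with _ | (_ | _)
    · have h0 : piWord k (none :: u) = 0 := by simp [piWord]
      rw [h0, ← consW_single none, sW_consW_none, dW_consW_none, map_add, sW_consW_none, map_sub,
        sW_consW_true, sW_consW_false, parW_parW, map_zero]
      abel
    · rw [← key false, ← consW_single (some false), sW_consW_false, dW_consW_some, dW_consW_some,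
        sW_consW_false, map_add]
    · have h1 := key true
      rw [map_add] at h1
      rw [← consW_single (some true), sW_consW_true, dW_consW_some, map_add, dW_consW_none,
        dW_consW_some, sW_consW_true, parW_dW, parW_parW, map_neg, consW_single, consW_single,
        eq_sub_of_add_eq' h1]
      abel

end WordModule

section Evaluation

variable (k : Type v) [CommRing k] {X : CubicalSet.{u}}

/-- The chains of `X` obtained by letting words act on the cell `x`. -/
noncomputable def evW (b : ℕ) (x : Σ n, X.LCell n) : WMod k →ₗ[k] CLTot k X :=
  Finsupp.linearCombination k fun u => gen k X (act b u x)

@[simp] theorem evW_single (b : ℕ) (x : Σ n, X.LCell n) (u : Word) :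
    evW k b x (Finsupp.single u 1) = gen k X (act b u x) := by
  simp [evW]

theorem evW_consW_none (b : ℕ) (x : Σ n, X.LCell n) (v : WMod k) :
    evW k b x (consW k none v) = evW k b x v := by
  suffices h : evW k b x ∘ₗ consW k none = evW k b x from LinearMap.congr_fun h v
  exact hom_ext_word fun u => by simp

theorem dWord_mem_supported (b : ℕ) (u : Word) :
    dWord k b u ∈ Finsupp.supported k k {w : Word | w.length = u.length} := by
  induction u with
  | nil => exact Submodule.zero_mem _
  | cons a u ih =>
    have hc : ∀ a, consW k a (dWord k b u) ∈
        Finsupp.supported k k {w : Word | w.length = (a :: u).length} := by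
      intro a
      have : Finsupp.supported k k {w : Word | w.length = u.length} ≤
          (Finsupp.supported k k {w : Word | w.length = (a :: u).length}).comap (consW k a) := by
        rw [Finsupp.supported_eq_span_single, Submodule.span_le]
        rintro _ ⟨w, hw, rfl⟩
        rw [SetLike.mem_coe, Submodule.mem_comap, consW_single]
        exact Finsupp.single_mem_supported k _ (congrArg (· + 1) hw)
      exact this ih
    rcases a with _ | ε
    · refine Submodule.add_mem _ (hc none) (Submodule.smul_mem _ _ (Submodule.sub_mem _ ?_ ?_)) <;>
      exact Finsupp.single_mem_supported k _ rfl
    · exact hc (some ε)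

theorem evW_consW_some {n : ℕ} (b : ℕ) (ε : Bool) (x : Σ n, X.LCell n) (v : WMod k)
    (hv : v ∈ Finsupp.supported k k {w : Word | w.length = n}) :
    evW k b x (consW k (some ε) v) = evW k b (X.faceAt ε (n + b) x) v := by
  rw [Finsupp.supported_eq_span_single] at hv
  induction hv using Submodule.span_induction with
  | mem _ h => obtain ⟨w, rfl, rfl⟩ := h; simp
  | zero => simp
  | add _ _ _ _ h1 h2 => rw [map_add, map_add, map_add, h1, h2]
  | smul a _ _ h1 => rw [map_smul, map_smul, map_smul, h1]

/-- The part of the differential of a face that concerns the free coordinates of the word is the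
differential of the word. -/
theorem sum_faceAt_act (b : ℕ) (u : Word) (x : Σ n, X.LCell n) (h : u.length + b ≤ x.1) :
    ∑ i ∈ Finset.range u.stars, (-1 : k) ^ (i + b) •
      (gen k X (X.faceAt true (i + b) (act b u x)) -
        gen k X (X.faceAt false (i + b) (act b u x))) = evW k b x (dWord k b u) := by
  induction u generalizing x with
  | nil => simp [dWord]
  | cons a u ih =>
    rw [List.length_cons] at h
    rcases a with _ | ε
    · have ht := fun ε => faceAt_act b 0 ε u x (by omega)
      simp only [add_zero] at ht
      rw [Word.stars_none, Finset.sum_range_succ, act_none, ih x (by omega), dWord, map_add,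
        evW_consW_none, map_smul, map_sub, evW_single, evW_single, act_some, act_some, ht, ht]
    · have h1 := faceAt_fst ε (i := u.length + b) x (by omega)
      rw [Word.stars_some, act_some, ih _ (by omega), dWord,
        evW_consW_some k b ε x _ (dWord_mem_supported k b u)]

end Evaluation

/-! ### The universal cell of `LX_n` -/

section Model

/-- Formal iterated faces and degeneracies of one `n`-cell. -/
inductive ModelTerm (n : ℕ) : ℕ → Type u
  | cell : ModelTerm n n
  | face {m : ℕ} (i : Fin (m + 1)) (ε : Bool) (t : ModelTerm n (m + 1)) : ModelTerm n m
  | degen {m : ℕ} (i : Fin (m + 1)) (t : ModelTerm n m) : ModelTerm n (m + 1)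

/-- The iterated first faces of the formal cell. -/
inductive ModelTerm.IsFront (n : ℕ) : ∀ {m : ℕ}, ModelTerm.{u} n m → Prop
  | refl : IsFront n .cell
  | step {m : ℕ} {t : ModelTerm n (m + 1)} (ε : Bool) : IsFront n t → IsFront n (.face 0 ε t)

/-- The cubical identities, and the equality of all iterated first faces of the same dimension. -/
inductive ModelRel (n : ℕ) : ∀ m : ℕ, ModelTerm.{u} n m → ModelTerm.{u} n m → Prop
  | front {m : ℕ} {t t' : ModelTerm n m} : t.IsFront → t'.IsFront → ModelRel n m t t'
  | face {m : ℕ} (i : Fin (m + 1)) (ε : Bool) {t t' : ModelTerm n (m + 1)} :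
      ModelRel n (m + 1) t t' → ModelRel n m (.face i ε t) (.face i ε t')
  | degen {m : ℕ} (i : Fin (m + 1)) {t t' : ModelTerm n m} :
      ModelRel n m t t' → ModelRel n (m + 1) (.degen i t) (.degen i t')
  | face_face {m : ℕ} (i j : Fin (m + 1)) (ε ω : Bool) (x : ModelTerm n (m + 2)) (h : i ≤ j) :
      ModelRel n m (.face j ω (.face i.castSucc ε x)) (.face i ε (.face j.succ ω x))
  | degen_degen {m : ℕ} (i j : Fin (m + 1)) (x : ModelTerm n m) (h : i ≤ j) :
      ModelRel n (m + 2) (.degen j.succ (.degen i x)) (.degen i.castSucc (.degen j x))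
  | face_degen_self {m : ℕ} (i : Fin (m + 1)) (ε : Bool) (x : ModelTerm n m) :
      ModelRel n m (.face i ε (.degen i x)) x
  | face_degen_above {m : ℕ} (i j : Fin (m + 1)) (ε : Bool) (x : ModelTerm n (m + 1))
      (h : i ≤ j) :
      ModelRel n (m + 1) (.face j.succ ε (.degen i.castSucc x)) (.degen i (.face j ε x))
  | face_degen_below {m : ℕ} (i j : Fin (m + 1)) (ε : Bool) (x : ModelTerm n (m + 1))
      (h : j ≤ i) :
      ModelRel n (m + 1) (.face j.castSucc ε (.degen i.succ x)) (.degen i (.face j ε x))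

/-- The cubical set freely generated by an `n`-cell whose iterated first faces of each dimension
agree: it represents `X ↦ LX_n` for `n ≥ 1`. -/
def model (n : ℕ) : CubicalSet.{u} where
  cell m := Quot (ModelRel.{u} n m)
  face i ε := Quot.map (.face i ε) fun _ _ h => .face i ε h
  degen i := Quot.map (.degen i) fun _ _ h => .degen i h
  face_face i j ε ω x h := by
    induction x using Quot.ind; exact Quot.sound (.face_face i j ε ω _ h)
  degen_degen i j x h := by
    induction x using Quot.ind; exact Quot.sound (.degen_degen i j _ h)
  face_degen_self i ε x := by
    induction x using Quot.ind; exact Quot.sound (.face_degen_self i ε _)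
  face_degen_above i j ε x h := by
    induction x using Quot.ind; exact Quot.sound (.face_degen_above i j ε _ h)
  face_degen_below i j ε x h := by
    induction x using Quot.ind; exact Quot.sound (.face_degen_below i j ε _ h)

/-- The generating cell of the model. -/
def modelGen (n : ℕ) : (model.{u} n).cell n := Quot.mk _ .cell

theorem modelGen_isL (n : ℕ) : (model.{u} n).IsL (modelGen n) := by
  have key : ∀ {m : ℕ} (y : (model.{u} n).cell m), (model n).FrontFace (modelGen n) y →
      ∃ t : ModelTerm n m, t.IsFront ∧ y = Quot.mk _ t := by
    intro m y h
    induction h with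
    | refl => exact ⟨_, .refl, rfl⟩
    | step ε _ ih =>
      obtain ⟨t, ht, rfl⟩ := ih
      exact ⟨_, ht.step ε, rfl⟩
  intro m y y' h h'
  obtain ⟨t, ht, rfl⟩ := key y h
  obtain ⟨t', ht', rfl⟩ := key y' h'
  exact Quot.sound (.front ht ht')

/-- The generating cell, as a cell of `LX`. -/
def modelCell : ∀ n : ℕ, (model.{u} n).LCell n
  | 0 => PUnit.unit
  | n + 1 => ⟨modelGen (n + 1), modelGen_isL _⟩

variable {X : CubicalSet.{u}}

/-- The interpretation of a formal cell when the generator is replaced by `x`. -/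
def ModelTerm.eval {n : ℕ} (x : X.cell n) : ∀ {m : ℕ}, ModelTerm.{u} n m → X.cell m
  | _, .cell => x
  | _, .face i ε t => X.face i ε (t.eval x)
  | _, .degen i t => X.degen i (t.eval x)

theorem ModelTerm.IsFront.eval {n m : ℕ} (x : X.cell n) {t : ModelTerm.{u} n m}
    (ht : t.IsFront) : X.FrontFace x (t.eval x) := by
  induction ht with
  | refl => exact .refl
  | step ε _ ih => exact ih.step ε

theorem ModelRel.eval {n m : ℕ} {x : X.cell n} (hx : X.IsL x) {t t' : ModelTerm.{u} n m}
    (h : ModelRel n m t t') : t.eval x = t'.eval x := by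
  induction h with
  | front h h' => exact hx _ _ _ (h.eval x) (h'.eval x)
  | face i ε _ ih => exact congrArg (X.face i ε) ih
  | degen i _ ih => exact congrArg (X.degen i) ih
  | face_face i j ε ω t h => exact X.face_face i j ε ω _ h
  | degen_degen i j t h => exact X.degen_degen i j _ h
  | face_degen_self i ε t => exact X.face_degen_self i ε _
  | face_degen_above i j ε t h => exact X.face_degen_above i j ε _ h
  | face_degen_below i j ε t h => exact X.face_degen_below i j ε _ h

/-- The morphism from the model that takes the generator to a given cell. -/
def modelHom {n : ℕ} (x : X.LCell (n + 1)) : Hom (model.{u} (n + 1)) X where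
  app := Quot.lift (ModelTerm.eval x.1) fun _ _ h => h.eval x.2
  app_face i ε y := by induction y using Quot.ind; rfl
  app_degen i y := by induction y using Quot.ind; rfl

theorem modelHom_sapp {n : ℕ} (x : X.LCell (n + 1)) :
    (modelHom x).sapp ⟨n + 1, modelCell (n + 1)⟩ = ⟨n + 1, x⟩ := rfl

/-- The composition of morphisms of cubical sets. -/
def Hom.comp {Y Z : CubicalSet.{u}} (g : Hom Y Z) (f : Hom X Y) : Hom X Z where
  app x := g.app (f.app x)
  app_face i ε x := by rw [f.app_face, g.app_face]
  app_degen i x := by rw [f.app_degen, g.app_degen]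

theorem Hom.comp_sapp {Y Z : CubicalSet.{u}} (g : Hom Y Z) (f : Hom X Y)
    (x : Σ n, X.LCell n) : (g.comp f).sapp x = g.sapp (f.sapp x) := by
  obtain ⟨_ | n, x⟩ := x <;> rfl

theorem Hom.ext_app {Y : CubicalSet.{u}} {f g : Hom X Y}
    (h : ∀ (n : ℕ) (x : X.cell n), f.app x = g.app x) : f = g := by
  obtain ⟨f, _, _⟩ := f
  obtain ⟨g, _, _⟩ := g
  have : @f = @g := by funext n x; exact h n x
  subst this
  rfl

theorem modelHom_lapp {Y : CubicalSet.{u}} (f : Hom X Y) {n : ℕ} (x : X.LCell (n + 1)) :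
    modelHom (f.lapp x) = f.comp (modelHom x) := by
  refine Hom.ext_app fun m y => ?_
  induction y using Quot.ind with | mk t =>
  change t.eval (f.app x.1) = f.app (t.eval x.1)
  induction t with
  | cell => rfl
  | face i ε t ih => exact (congrArg (Y.face i ε) ih).trans (f.app_face i ε _).symm
  | degen i t ih => exact (congrArg (Y.degen i) ih).trans (f.app_degen i _).symm

end Model

/-! ### The cells of the model -/

section ModelCells

variable {X : CubicalSet.{u}}

/-- A face of a face is the face given by another word. -/
theorem exists_faceAt_act (ε : Bool) {i : ℕ} (u : Word) (hi : i < u.stars) :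
    ∃ w : Word, w.length = u.length ∧ ∀ x : Σ n, X.LCell n, u.length ≤ x.1 →
      X.faceAt ε i (act 0 u x) = act 0 w x := by
  induction u with
  | nil => exact absurd hi (Nat.not_lt_zero _)
  | cons a u ih =>
    rcases a with _ | ω
    · rw [Word.stars_none] at hi
      rcases Nat.lt_succ_iff_lt_or_eq.1 hi with h | rfl
      · obtain ⟨w, hw, h⟩ := ih h
        exact ⟨none :: w, by simp [hw], fun x hx => h x (by simp at hx; omega)⟩
      · exact ⟨some ε :: u, rfl, fun x hx => faceAt_act 0 0 ε u x hx⟩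
    · rw [Word.stars_some] at hi
      obtain ⟨w, hw, h⟩ := ih hi
      refine ⟨some ω :: w, by simp [hw], fun x hx => ?_⟩
      rw [List.length_cons] at hx
      have h1 := faceAt_fst ω (i := u.length + 0) x (by omega)
      rw [act_some, act_some, h _ (by omega), hw]

/-- The `0`-cell of `LX`. -/
def pt (X : CubicalSet.{u}) : Σ n, X.LCell n := ⟨0, PUnit.unit⟩

/-- The iterated first faces of a cell of `LX`. -/
def front (r : ℕ) (x : Σ n, X.LCell n) : Σ n, X.LCell n := (X.faceAt false 0)^[r] x

theorem front_fst (r : ℕ) (x : Σ n, X.LCell n) (h : r ≤ x.1) : (front r x).1 = x.1 - r := by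
  induction r generalizing x with
  | zero => rfl
  | succ r ih =>
    have h1 := faceAt_fst false (i := 0) x (by omega)
    have := ih (X.faceAt false 0 x) (by omega)
    change (front r (X.faceAt false 0 x)).1 = _
    omega

theorem eq_pt (x : Σ n, X.LCell n) (h : x.1 = 0) : x = pt X := by
  obtain ⟨n, x⟩ := x
  obtain rfl : n = 0 := h
  rfl

/-- The face of `x` given by the word with the letters `0, …, 0, *` in front of those of `u`. -/
def reducedFace (u : Word) (x : Σ n, X.LCell n) : Σ n, X.LCell n :=
  act 1 u (front (x.1 - 1 - u.length) x)

theorem reducedFace_fst (u : Word) (x : Σ n, X.LCell n) (h : u.length < x.1) :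
    (reducedFace u x).1 = u.stars + 1 := by
  have h1 := front_fst (x.1 - 1 - u.length) x (by omega)
  have := act_fst 1 u (front (x.1 - 1 - u.length) x) (by omega)
  rw [reducedFace]
  omega

/-- Letters at the end of a word which are not free may be dropped, for cells of `LX`. -/
theorem act_eq_reducedFace (w : Word) (x : Σ n, X.LCell n) (h : w.length = x.1) :
    act 0 w x = pt X ∨ ∃ u : Word, u.length < x.1 ∧ act 0 w x = reducedFace u x := by
  induction w using List.reverseRecOn generalizing x with
  | nil => exact Or.inl (eq_pt _ h.symm)
  | append_singleton w a ih =>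
    rw [List.length_append, List.length_singleton] at h
    rcases a with _ | ε
    · refine Or.inr ⟨w, by omega, ?_⟩
      rw [act_append, reducedFace, ← h]
      simp [front]
    · have h1 := faceAt_fst false (i := 0) x (by omega)
      have h2 := act_insert 0 ε w [] x (by simp; omega)
      rw [h2, List.append_nil, List.length_nil, faceAt_zero_eq ε false]
      rcases ih (X.faceAt false 0 x) (by omega) with h3 | ⟨u, hu, h3⟩
      · exact Or.inl h3
      · refine Or.inr ⟨u, by omega, h3.trans ?_⟩
        rw [reducedFace, reducedFace, h1,
          show x.1 - 1 - u.length = (x.1 - 1 - 1 - u.length) + 1 by omega]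
        rfl

/-- The cells that are degeneracies of faces of the generator, and all `0`-cells. -/
inductive ModelNormal (n : ℕ) : ∀ m : ℕ, (model.{u} n).cell m → Prop
  | zero (y : (model.{u} n).cell 0) : ModelNormal n 0 y
  | word {m : ℕ} (w : Word) (hw : w.length = n) (z : (model.{u} n).LCell (m + 1))
      (h : act 0 w ⟨n, modelCell n⟩ = ⟨m + 1, z⟩) : ModelNormal n (m + 1) z.1
  | degen {m : ℕ} (i : Fin (m + 1)) {y : (model.{u} n).cell m} (h : ModelNormal n m y) :
      ModelNormal n (m + 1) ((model n).degen i y)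

/-- A face of a degeneracy is a degeneracy of a face or the cell itself, and a face of a face of the
generator is given by another word. -/
theorem ModelNormal.face {n m : ℕ} {y : (model.{u} n).cell m} (hy : ModelNormal n m y) :
    ∀ (l : ℕ) (e : m = l + 1) (i : Fin (l + 1)) (ε : Bool),
      ModelNormal n l ((model n).face i ε (e ▸ y)) := by
  induction hy with
  | zero y => intro l e; omega
  | @word m w hw z h =>
    intro l e i ε
    obtain rfl : m = l := by omega
    cases m with
    | zero => exact .zero _
    | succ m =>
      have hst : w.stars = m + 2 := by
        have := act_fst 0 w ⟨n, modelCell n⟩ (by simp [hw])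
        rw [h] at this
        simp at this
        omega
      obtain ⟨w', hw', h'⟩ := exists_faceAt_act (X := model.{u} n) ε (i := i) w
        (by have := i.2; omega)
      have h2 := h' ⟨n, modelCell n⟩ (by simp [hw])
      rw [h, faceAt_mk ε i.2] at h2
      exact .word w' (hw'.trans hw) ((model n).lface i ε z) h2.symm
  | @degen m i y hy ih =>
    intro l e j ε
    obtain rfl : m = l := by omega
    change ModelNormal n m ((model n).face j ε ((model n).degen i y))
    rcases lt_trichotomy j i with hlt | rfl | hlt
    · obtain ⟨m, rfl⟩ : ∃ m', m = m' + 1 := ⟨m - 1, by have := i.2; have := j.2; omega⟩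
      obtain ⟨i', rfl⟩ := Fin.exists_succ_eq.2 (Fin.ne_zero_of_lt hlt)
      obtain ⟨j', rfl⟩ := Fin.exists_castSucc_eq.2 (Fin.ne_last_of_lt hlt)
      have hle : j' ≤ i' := by
        simp only [Fin.lt_def, Fin.val_castSucc, Fin.val_succ] at hlt
        exact Fin.le_def.2 (by omega)
      rw [(model n).face_degen_below i' j' ε y hle]
      exact .degen _ (ih m rfl j' ε)
    · rw [(model n).face_degen_self]; exact hy
    · obtain ⟨m, rfl⟩ : ∃ m', m = m' + 1 := ⟨m - 1, by have := i.2; have := j.2; omega⟩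
      obtain ⟨j', rfl⟩ := Fin.exists_succ_eq.2 (Fin.ne_zero_of_lt hlt)
      obtain ⟨i', rfl⟩ := Fin.exists_castSucc_eq.2 (Fin.ne_last_of_lt hlt)
      have hle : i' ≤ j' := by
        simp only [Fin.lt_def, Fin.val_castSucc, Fin.val_succ] at hlt
        exact Fin.le_def.2 (by omega)
      rw [(model n).face_degen_above i' j' ε y hle]
      exact .degen _ (ih m rfl j' ε)

theorem act_replicate_none (b r : ℕ) (x : Σ n, X.LCell n) :
    act b (List.replicate r none) x = x := by
  induction r with
  | zero => rfl
  | succ r ih => exact ih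

/-- Every cell of the model is an iterated degeneracy of a face of the generator or of a `0`-cell.
-/
theorem modelNormal (n m : ℕ) (y : (model.{u} (n + 1)).cell m) : ModelNormal (n + 1) m y := by
  induction y using Quot.ind with | mk t =>
  induction t with
  | cell =>
    exact .word (List.replicate (n + 1) none) (by simp) (modelCell (n + 1))
      (act_replicate_none 0 _ _)
  | face i ε t ih => exact ih.face _ rfl i ε
  | degen i t ih => exact .degen i ih

/-- Modulo degenerate cells, the cells of `LX` for the model are the point and the faces given by
reduced words. -/
theorem model_cells (n : ℕ) (x : Σ m, (model.{u} (n + 1)).LCell m) :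
    (model (n + 1)).IsDegen x.2 ∨ x = pt _ ∨
      ∃ u : Word, u.length < n + 1 ∧ x = reducedFace u ⟨n + 1, modelCell (n + 1)⟩ := by
  obtain ⟨m, z⟩ := x
  cases m with
  | zero => exact Or.inr (Or.inl rfl)
  | succ m =>
    have key : ∀ (l : ℕ) (y : (model.{u} (n + 1)).cell l), ModelNormal (n + 1) l y →
        ∀ (e : l = m + 1), z.1 = e ▸ y → (model (n + 1)).IsDegen z ∨
          (⟨m + 1, z⟩ : Σ m, (model.{u} (n + 1)).LCell m) = pt _ ∨ ∃ u : Word,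
            u.length < n + 1 ∧ ⟨m + 1, z⟩ = reducedFace u ⟨n + 1, modelCell.{u} (n + 1)⟩ := by
      intro l y hy e hz
      cases hy with
      | zero => omega
      | @word m' w hw z' h =>
        obtain rfl : m' = m := by omega
        obtain rfl : z = z' := Subtype.ext hz
        rw [← h]
        exact Or.inr (act_eq_reducedFace w _ hw)
      | @degen m' i y h =>
        obtain rfl : m' = m := by omega
        exact Or.inl ⟨i, y, hz⟩
    exact key _ z.1 (modelNormal n _ z.1) rfl rfl

end ModelCells

/-! ### Independence of the faces of the universal cell -/

section Letters

/-- A coordinate function on a cube: a constant or a variable. -/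
abbrev Letter : Type := Bool ⊕ ℕ

/-- Substitution of `ε` for the variable `j`. -/
def Letter.face (j : ℕ) (ε : Bool) : Letter → Letter
  | .inl b => .inl b
  | .inr v => if v < j then .inr v else if v = j then .inl ε else .inr (v - 1)

/-- Renumbering of the variables so as to avoid the variable `i`. -/
def Letter.degen (i : ℕ) : Letter → Letter
  | .inl b => .inl b
  | .inr v => if v < i then .inr v else .inr (v + 1)

/-- Removal of the constants at the end of a list, that is, of the constant first coordinates. -/
def strip (l : List Letter) : List Letter := l.rdropWhile Sum.isLeft

theorem strip_strip (l : List Letter) : strip (strip l) = strip l := List.rdropWhile_idempotent _ _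

theorem strip_map_strip (φ : Letter → Letter) (hφ : ∀ a, a.isLeft → (φ a).isLeft)
    (l : List Letter) : strip ((strip l).map φ) = strip (l.map φ) := by
  induction l using List.reverseRecOn with
  | nil => rfl
  | append_singleton l a ih =>
    rw [strip] at ih
    by_cases h : a.isLeft
    · rw [strip, strip, strip, List.rdropWhile_concat_pos _ _ _ h, List.map_append,
        List.map_singleton, List.rdropWhile_concat_pos _ _ _ (hφ a h)]
      exact ih
    · rw [strip, strip, List.rdropWhile_concat_neg _ _ _ h]; rfl

theorem strip_map (φ : Letter → Letter) (hφ : ∀ a, (φ a).isLeft = a.isLeft) (l : List Letter) :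
    strip (l.map φ) = (strip l).map φ := by
  induction l using List.reverseRecOn with
  | nil => rfl
  | append_singleton l a ih =>
    rw [strip] at ih
    by_cases h : a.isLeft
    · rw [strip, strip, List.rdropWhile_concat_pos _ _ _ h, List.map_append, List.map_singleton,
        List.rdropWhile_concat_pos _ _ _ ((hφ a).trans h)]
      exact ih
    · rw [strip, strip, List.rdropWhile_concat_neg _ _ _ h, List.map_append, List.map_singleton,
        List.rdropWhile_concat_neg _ _ _ (by rwa [hφ a])]

theorem strip_concat_inr (l : List Letter) (v : ℕ) : strip (l ++ [.inr v]) = l ++ [.inr v] :=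
  List.rdropWhile_concat_neg _ _ _ (by simp)

theorem Letter.isLeft_face (j : ℕ) (ε : Bool) (a : Letter) (h : a.isLeft) :
    (Letter.face j ε a).isLeft := by
  rcases a with b | v
  · rfl
  · simp at h

theorem Letter.isLeft_degen (i : ℕ) (a : Letter) : (Letter.degen i a).isLeft = a.isLeft := by
  rcases a with b | v
  · rfl
  · simp only [Letter.degen]; split_ifs <;> rfl

theorem Letter.face_face {i j : ℕ} (h : i ≤ j) (ε ω : Bool) :
    Letter.face j ω ∘ Letter.face i ε = Letter.face i ε ∘ Letter.face (j + 1) ω := by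
  funext a
  rcases a with b | v <;> grind [Letter.face, Letter.degen]

theorem Letter.degen_degen {i j : ℕ} (h : i ≤ j) :
    Letter.degen (j + 1) ∘ Letter.degen i = Letter.degen i ∘ Letter.degen j := by
  funext a
  rcases a with b | v <;> grind [Letter.face, Letter.degen]

theorem Letter.face_degen_self (i : ℕ) (ε : Bool) : Letter.face i ε ∘ Letter.degen i = id := by
  funext a
  rcases a with b | v <;> grind [Letter.face, Letter.degen]

theorem Letter.face_degen_above {i j : ℕ} (h : i ≤ j) (ε : Bool) :
    Letter.face (j + 1) ε ∘ Letter.degen i = Letter.degen i ∘ Letter.face j ε := by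
  funext a
  rcases a with b | v <;> grind [Letter.face, Letter.degen]

theorem Letter.face_degen_below {i j : ℕ} (h : j ≤ i) (ε : Bool) :
    Letter.face j ε ∘ Letter.degen (i + 1) = Letter.degen i ∘ Letter.face j ε := by
  funext a
  rcases a with b | v <;> grind [Letter.face, Letter.degen]

/-- The cubical set of lists of coordinate functions (the head being the last coordinate), where
constant first coordinates are dropped. Variables may be repeated and come in any order; the cells
of the model are found among these lists. -/
def letterCubes : CubicalSet.{u} where
  cell _ := ULift.{u} {l : List Letter // strip l = l}
  face i ε x := ⟨strip (x.down.1.map (Letter.face i ε)), strip_strip _⟩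
  degen i x := ⟨x.down.1.map (Letter.degen i), by
    rw [strip_map _ (Letter.isLeft_degen i), x.down.2]⟩
  face_face i j ε ω x h := by
    refine ULift.ext _ _ (Subtype.ext ?_)
    simp only [strip_map_strip _ (Letter.isLeft_face _ _), List.map_map]
    exact congrArg (fun φ => strip (List.map φ x.down.1)) (Letter.face_face (i := i) (j := j) h ε ω)
  degen_degen i j x h := by
    refine ULift.ext _ _ (Subtype.ext ?_)
    simp only [List.map_map]
    exact congrArg (fun φ => (List.map φ x.down.1)) (Letter.degen_degen (i := i) (j := j) h)
  face_degen_self i ε x := by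
    refine ULift.ext _ _ (Subtype.ext ?_)
    simp only [List.map_map, Letter.face_degen_self, List.map_id, x.down.2]
  face_degen_above i j ε x h := by
    refine ULift.ext _ _ (Subtype.ext ?_)
    simp only [← strip_map _ (Letter.isLeft_degen _), List.map_map]
    exact congrArg (fun φ => strip (List.map φ x.down.1))
      (Letter.face_degen_above (i := i) (j := j) h ε)
  face_degen_below i j ε x h := by
    refine ULift.ext _ _ (Subtype.ext ?_)
    simp only [← strip_map _ (Letter.isLeft_degen _), List.map_map]
    exact congrArg (fun φ => strip (List.map φ x.down.1))
      (Letter.face_degen_below (i := i) (j := j) h ε)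

/-- The list of all variables. -/
def stdList (n : ℕ) : List Letter := (List.range n).reverse.map .inr

theorem stdList_succ (n : ℕ) : stdList (n + 1) = .inr n :: stdList n := by
  simp [stdList, List.range_succ]

theorem exists_stdList (n : ℕ) : ∃ l, stdList (n + 1) = l ++ [.inr 0] := by
  induction n with
  | zero => exact ⟨[], rfl⟩
  | succ n ih =>
    obtain ⟨l, h⟩ := ih
    exact ⟨.inr (n + 1) :: l, by rw [stdList_succ, h]; rfl⟩

theorem strip_append_stdList (q : List Letter) (n : ℕ) :
    strip (q ++ stdList (n + 1)) = q ++ stdList (n + 1) := by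
  obtain ⟨l, h⟩ := exists_stdList n
  rw [h, ← List.append_assoc, strip_concat_inr]

theorem strip_stdList (n : ℕ) : strip (stdList n) = stdList n := by
  cases n with
  | zero => rfl
  | succ n => exact strip_append_stdList [] n

theorem face_zero_stdList (n : ℕ) (ε : Bool) :
    strip ((stdList (n + 1)).map (Letter.face 0 ε)) = stdList n := by
  have : (stdList (n + 1)).map (Letter.face 0 ε) = stdList n ++ [.inl ε] := by
    induction n with
    | zero => rfl
    | succ n ih => rw [stdList_succ, List.map_cons, ih, stdList_succ]; rfl
  rw [this, strip, List.rdropWhile_concat_pos _ _ _ rfl]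
  exact strip_stdList n

/-- The cell with all variables. -/
def letterCell (n : ℕ) : letterCubes.{u}.cell n := ⟨stdList n, strip_stdList n⟩

theorem letterCell_isL (n : ℕ) : letterCubes.{u}.IsL (letterCell n) := by
  have key : ∀ {m : ℕ} (y : letterCubes.{u}.cell m), letterCubes.FrontFace (letterCell n) y →
      y.down.1 = stdList m := by
    intro m y h
    induction h with
    | refl => rfl
    | @step m y ε _ ih =>
      change strip (y.down.1.map (Letter.face 0 ε)) = _
      rw [ih, face_zero_stdList]
  intro m y y' h h'
  exact ULift.ext _ _ (Subtype.ext ((key y h).trans (key y' h').symm))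

/-- The cell with all variables, as a cell of `LX`. -/
def letterLCell (n : ℕ) : letterCubes.{u}.LCell (n + 1) := ⟨letterCell (n + 1), letterCell_isL _⟩

/-- The list of coordinate functions of a cell. -/
def letters : (Σ n, letterCubes.{u}.LCell n) → List Letter
  | ⟨0, _⟩ => []
  | ⟨_ + 1, x⟩ => x.1.down.1

theorem letters_faceAt (ε : Bool) {i : ℕ} (x : Σ n, letterCubes.{u}.LCell n) (h : i < x.1)
    (h2 : 2 ≤ x.1) :
    letters (letterCubes.faceAt ε i x) = strip ((letters x).map (Letter.face i ε)) := by
  obtain ⟨n, x⟩ := x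
  obtain ⟨n, rfl⟩ : ∃ m, n = m + 2 := ⟨n - 2, by simp at h2; omega⟩
  rw [faceAt_mk ε h]
  rfl

/-- The letters of a face of the cell with all variables: the free coordinates are numbered. -/
def wordLetters : Word → List Letter
  | [] => [.inr 0]
  | some ε :: u => .inl ε :: wordLetters u
  | none :: u => .inr (Word.stars u + 1) :: wordLetters u

/-- Renumbering of the variables by a shift. -/
def Letter.shift (t : ℕ) : Letter → Letter
  | .inl b => .inl b
  | .inr v => .inr (v + t)

theorem Letter.shift_shift (s t : ℕ) (l : List Letter) :
    (l.map (Letter.shift s)).map (Letter.shift t) = l.map (Letter.shift (s + t)) := by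
  rw [List.map_map]
  congr 1
  funext a
  rcases a with b | v <;> simp [Letter.shift, add_assoc]

theorem map_face_stdList {n j : ℕ} (h : n ≤ j) (ε : Bool) :
    (stdList n).map (Letter.face j ε) = stdList n := by
  induction n with
  | zero => rfl
  | succ n ih =>
    rw [stdList_succ, List.map_cons, ih (by omega)]
    simp [Letter.face, show n < j by omega]

/-- The word `u` replaces the variables that follow the prefix `q` by the letters of `u`, in which
the free coordinates are renumbered. -/
theorem letters_act (u : Word) (q : List Letter) (x : Σ n, letterCubes.{u}.LCell n)
    (hx : u.length + 1 ≤ x.1)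
    (h : letters x = q.map (Letter.shift (u.length + 1)) ++ stdList (u.length + 1)) :
    letters (act 1 u x) = q.map (Letter.shift (u.stars + 1)) ++ wordLetters u := by
  induction u generalizing x q with
  | nil => exact h
  | cons a u ih =>
    rw [List.length_cons] at h hx
    rcases a with _ | ε
    · have h' : letters x = (q.map (Letter.shift 1) ++ [Sum.inr 0]).map
          (Letter.shift (u.length + 1)) ++ stdList (u.length + 1) := by
        rw [h, stdList_succ (u.length + 1), List.map_append, Letter.shift_shift,
          add_comm 1 (u.length + 1)]
        simp [Letter.shift]
      rw [act_none, ih _ x (by omega) h', List.map_append, Letter.shift_shift, wordLetters,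
        Word.stars_none, add_comm 1 (Word.stars u + 1)]
      simp [Letter.shift]
    · have h1 := faceAt_fst ε (i := u.length + 1) x (by omega)
      have h' : letters (letterCubes.faceAt ε (u.length + 1) x) = (q ++ [Sum.inl ε]).map
          (Letter.shift (u.length + 1)) ++ stdList (u.length + 1) := by
        rw [letters_faceAt ε x (by omega) (by omega), h, stdList_succ (u.length + 1),
          List.map_append, List.map_cons, map_face_stdList le_rfl, List.map_map]
        have e1 : Letter.face (u.length + 1) ε ∘ Letter.shift (u.length + 1 + 1) =
            Letter.shift (u.length + 1) := by
          funext a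
          rcases a with b | v
          · rfl
          · simp only [Function.comp_apply, Letter.shift, Letter.face]
            rw [if_neg (by omega), if_neg (by omega)]
            congr 1
        have e2 : Letter.face (u.length + 1) ε (.inr (u.length + 1)) = .inl ε := by
          simp [Letter.face]
        rw [e1, e2, List.append_cons, strip_append_stdList, List.map_append]
        rfl
      rw [act_some, ih _ _ (by omega) h', wordLetters, Word.stars_some]
      simp [Letter.shift]

theorem letters_front (n r : ℕ) (h : r ≤ n) :
    letters (front r (⟨n + 1, letterLCell n⟩ : Σ n, letterCubes.{u}.LCell n)) =
      stdList (n + 1 - r) := by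
  induction r with
  | zero => rfl
  | succ r ih =>
    have h1 := front_fst r (⟨n + 1, letterLCell n⟩ : Σ n, letterCubes.{u}.LCell n)
      (by simp; omega)
    simp only at h1
    rw [front, Function.iterate_succ_apply']
    change letters (letterCubes.faceAt false 0 (front r _)) = _
    rw [letters_faceAt _ _ (by omega) (by omega), ih (by omega),
      show n + 1 - r = (n + 1 - (r + 1)) + 1 by omega, face_zero_stdList]

theorem letters_reducedFace (n : ℕ) (u : Word) (h : u.length < n + 1) :
    letters (reducedFace u (⟨n + 1, letterLCell n⟩ : Σ n, letterCubes.{u}.LCell n)) =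
      wordLetters u := by
  have h1 := front_fst (n + 1 - 1 - u.length)
    (⟨n + 1, letterLCell n⟩ : Σ n, letterCubes.{u}.LCell n) (by simp; omega)
  rw [reducedFace]
  refine letters_act u [] _ (by rw [h1]; simp only; omega) ?_
  rw [letters_front n _ (by simp only; omega)]
  simp only [List.map_nil, List.nil_append]
  congr 1
  omega

/-- The word of a list of coordinate functions, the first coordinate being left out. -/
def decode (l : List Letter) : Word := (l.map fun a => a.elim some fun _ => none).dropLast

theorem decode_wordLetters (u : Word) : decode (wordLetters u) = u := by
  have : (wordLetters u).map (fun a => a.elim some fun _ => none) = u ++ [none] := by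
    induction u with
    | nil => rfl
    | cons a u ih => rcases a with _ | ε <;> simp [wordLetters, ih]
  rw [decode, this, List.dropLast_concat]

theorem mem_wordLetters (u : Word) (i : ℕ) (hi : i < u.stars + 1) : .inr i ∈ wordLetters u := by
  induction u with
  | nil =>
    obtain rfl : i = 0 := by simpa using hi
    simp [wordLetters]
  | cons a u ih =>
    rcases a with _ | ε
    · rw [Word.stars_none] at hi
      rcases Nat.lt_succ_iff_lt_or_eq.1 hi with h | rfl
      · exact List.mem_cons_of_mem _ (ih h)
      · exact List.mem_cons_self ..
    · exact List.mem_cons_of_mem _ (ih (by simpa using hi))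

theorem not_mem_map_degen (i : ℕ) (l : List Letter) : .inr i ∉ l.map (Letter.degen i) := by
  rw [List.mem_map]
  rintro ⟨b | v, _, h⟩
  · simp [Letter.degen] at h
  · simp only [Letter.degen] at h
    split_ifs at h with h' <;> simp only [Sum.inr.injEq] at h <;> omega

end Letters

section Lift

variable (k : Type v) [CommRing k] {X : CubicalSet.{u}} {M : Type w} [AddCommGroup M] [Module k M]

/-- The linear map on `CL_n(X)` given by its values on cells, which have to vanish on the degenerate
ones. -/
noncomputable def liftCLDeg {n : ℕ} (r : X.LCell n → M) (hr : ∀ x, X.IsDegen x → r x = 0) :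
    CL k X n →ₗ[k] M :=
  (DL k X n).liftQ (Finsupp.linearCombination k r) <| by
    rw [DL, Submodule.span_le]
    rintro _ ⟨x, hx, rfl⟩
    simp [hr x hx]

theorem liftCLDeg_mkCL {n : ℕ} (r : X.LCell n → M) (hr : ∀ x, X.IsDegen x → r x = 0)
    (v : QL k X n) : liftCLDeg k r hr (mkCL k X n v) = Finsupp.linearCombination k r v := rfl

/-- The linear map on `CL_•(X)` given by its values on cells, which have to vanish on the
degenerate ones. -/
noncomputable def liftCL (r : (Σ n, X.LCell n) → M)
    (hr : ∀ (n : ℕ) (x : X.LCell n), X.IsDegen x → r ⟨n, x⟩ = 0) : CLTot k X →ₗ[k] M :=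
  DirectSum.toModule k ℕ M fun n => liftCLDeg k (fun x => r ⟨n, x⟩) (hr n)

theorem liftCL_gen (r : (Σ n, X.LCell n) → M)
    (hr : ∀ (n : ℕ) (x : X.LCell n), X.IsDegen x → r ⟨n, x⟩ = 0) (x : Σ n, X.LCell n) :
    liftCL k r hr (gen k X x) = r x := by
  rw [gen, liftCL, DirectSum.toModule_lof, liftCLDeg_mkCL]
  simp

end Lift

section Retraction

variable (k : Type v) [CommRing k]

open Classical in
/-- The value on a cell of the retraction of the chains of `letterCubes` to the chains given by
the point and by words. -/
noncomputable def letterRetractAux : (Σ n, letterCubes.{u}.LCell n) → k × WMod k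
  | ⟨0, _⟩ => (1, 0)
  | ⟨n + 1, x⟩ => if ∀ i < n + 1, .inr i ∈ x.1.down.1 then
      (0, Finsupp.single (decode x.1.down.1) 1) else 0

/-- The retraction of the chains of `letterCubes` to the chains given by the point and by words. -/
noncomputable def letterRetract : CLTot k letterCubes.{u} →ₗ[k] k × WMod k :=
  liftCL k (letterRetractAux k) <| by
    rintro (_ | n) x hx
    · exact hx.elim
    · obtain ⟨i, y, hy⟩ := hx
      refine if_neg fun h => ?_
      have := h i i.2
      rw [hy] at this
      exact not_mem_map_degen _ _ this

theorem letterRetract_pt : letterRetract.{u} k (gen k _ (pt _)) = (1, 0) := by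
  rw [letterRetract, liftCL_gen]; rfl

theorem letterRetract_reducedFace (n : ℕ) (u : Word) (h : u.length < n + 1) :
    letterRetract.{u} k (gen k _ (reducedFace u ⟨n + 1, letterLCell n⟩)) =
      (0, Finsupp.single u 1) := by
  rw [letterRetract, liftCL_gen]
  have h1 := letters_reducedFace.{u} n u h
  have h2 := reducedFace_fst u (⟨n + 1, letterLCell n⟩ : Σ n, letterCubes.{u}.LCell n) h
  generalize reducedFace u (⟨n + 1, letterLCell n⟩ : Σ n, letterCubes.{u}.LCell n) = x at h1 h2
  obtain ⟨m, x⟩ := x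
  obtain rfl : m = u.stars + 1 := h2
  change x.1.down.1 = _ at h1
  simp only [letterRetractAux]
  rw [h1, if_pos (mem_wordLetters u), decode_wordLetters]

theorem sapp_reducedFace {X Y : CubicalSet.{u}} (f : Hom X Y) (u : Word) (x : Σ n, X.LCell n) :
    f.sapp (reducedFace u x) = reducedFace u (f.sapp x) := by
  have : ∀ r, f.sapp (front r x) = front r (f.sapp x) := by
    intro r
    induction r with
    | zero => rfl
    | succ r ih =>
      rw [front, front, Function.iterate_succ_apply', Function.iterate_succ_apply', f.sapp_faceAt]
      exact congrArg _ ih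
  rw [reducedFace, sapp_act, this]
  rfl

/-- The coordinates on the chains of the model. -/
noncomputable def modelRetract (n : ℕ) : CLTot k (model.{u} (n + 1)) →ₗ[k] k × WMod k :=
  letterRetract k ∘ₗ map1 k (modelHom (letterLCell n))

theorem modelRetract_pt (n : ℕ) : modelRetract.{u} k n (gen k _ (pt _)) = (1, 0) := by
  rw [modelRetract, LinearMap.comp_apply, map1_gen]
  exact letterRetract_pt k

theorem modelRetract_reducedFace (n : ℕ) (u : Word) (h : u.length < n + 1) :
    modelRetract.{u} k n (gen k _ (reducedFace u ⟨n + 1, modelCell (n + 1)⟩)) =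
      (0, Finsupp.single u 1) := by
  rw [modelRetract, LinearMap.comp_apply, map1_gen, sapp_reducedFace, modelHom_sapp]
  exact letterRetract_reducedFace k n u h

end Retraction

end CubicalSet

/-! ### Contractions of complexes and of their tensor products -/

section Contraction

variable {k : Type*} [CommRing k] {V W : Type*} [AddCommGroup V] [Module k V]
  [AddCommGroup W] [Module k W]

theorem tmul_mem_tensorDeg {P : ℕ → Submodule k V} {Q : ℕ → Submodule k W} {p q n : ℕ} {v : V}
    {w : W} (hv : v ∈ P p) (hw : w ∈ Q q) (h : p + q = n) : v ⊗ₜ[k] w ∈ tensorDeg P Q n :=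
  Submodule.mem_iSup_of_mem (p, q) <| Submodule.mem_iSup_of_mem
    (Finset.HasAntidiagonal.mem_antidiagonal.2 h) (Submodule.apply_mem_map₂ _ hv hw)

theorem tensorDeg_le {P : ℕ → Submodule k V} {Q : ℕ → Submodule k W} {n : ℕ}
    {T : Submodule k (V ⊗[k] W)}
    (h : ∀ p q, p + q = n → ∀ v ∈ P p, ∀ w ∈ Q q, v ⊗ₜ[k] w ∈ T) : tensorDeg P Q n ≤ T :=
  iSup₂_le fun p hp => Submodule.map₂_le.2 fun v hv w hw =>
    h p.1 p.2 (Finset.HasAntidiagonal.mem_antidiagonal.1 hp) v hv w hw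

/-- `s` is a homotopy, of degree `1`, from `π` to the identity, where `π` is homogeneous of degree
`0`. -/
structure IsHomotopyToId (deg : ℕ → Submodule k V) (d s π : V →ₗ[k] V) : Prop where
  homotopy : ∀ v, d (s v) + s (d v) = v - π v
  s_mem : ∀ n, ∀ v ∈ deg n, s v ∈ deg (n + 1)
  π_mem : ∀ n, ∀ v ∈ deg n, π v ∈ deg n

/-- `s` is a homotopy, of degree `1`, from `π` to the identity, where `π` is homogeneous of degree
`0` and vanishes in the degrees greater than `N`. -/
structure IsContraction (deg : ℕ → Submodule k V) (d s π : V →ₗ[k] V) (N : ℕ) : Prop extends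
    IsHomotopyToId deg d s π where
  π_eq_zero : ∀ n, N < n → ∀ v ∈ deg n, π v = 0

theorem IsContraction.exists_eq {deg : ℕ → Submodule k V} {d s π : V →ₗ[k] V} {N : ℕ}
    (h : IsContraction deg d s π N) {n : ℕ} (hn : N < n) {v : V} (hv : v ∈ deg n)
    (hd : d v = 0) : ∃ w ∈ deg (n + 1), d w = v := by
  refine ⟨s v, h.s_mem n v hv, ?_⟩
  have := h.homotopy v
  rwa [hd, map_zero, add_zero, h.π_eq_zero n hn v hv, sub_zero] at this

/-- The tensor product of two homotopies to the identity. The linear map `p` is the sign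
`v ↦ (-1)^{|v|} v`. -/
theorem IsHomotopyToId.tensor {degV : ℕ → Submodule k V} {dV sV πV p : V →ₗ[k] V}
    {degW : ℕ → Submodule k W} {dW sW πW : W →ₗ[k] W}
    (hV : IsHomotopyToId degV dV sV πV) (hW : IsHomotopyToId degW dW sW πW)
    (htop : ⨆ n, degV n = ⊤) (hp : ∀ n, ∀ v ∈ degV n, p v = (-1 : k) ^ n • v)
    (hdp : ∀ v, dV (p v) = -p (dV v)) (hdd : ∀ v, dV (dV v) = 0) :
    IsHomotopyToId (tensorDeg degV degW)
      (TensorProduct.map dV LinearMap.id + TensorProduct.map p dW)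
      (TensorProduct.map sV LinearMap.id + TensorProduct.map (πV ∘ₗ p) sW)
      (TensorProduct.map πV πW) := by
  have hext : ∀ f g : V →ₗ[k] V, (∀ n, ∀ v ∈ degV n, f v = g v) → ∀ v, f v = g v := by
    intro f g h v
    have : ⨆ n, degV n ≤ LinearMap.eqLocus f g := iSup_le fun n v hv => h n v hv
    exact this (htop ▸ trivial)
  have hpp : ∀ v, p (p v) = v := hext (p ∘ₗ p) LinearMap.id fun n v hv => by
    simp [hp n v hv, smul_smul, ← pow_add, ← two_mul]
  have hps : ∀ v, p (sV v) = -sV (p v) := hext (p ∘ₗ sV) (-(sV ∘ₗ p)) fun n v hv => by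
    simp [hp n v hv, hp _ _ (hV.s_mem n v hv), pow_succ]
  have hpπ : ∀ v, p (πV v) = πV (p v) := hext (p ∘ₗ πV) (πV ∘ₗ p) fun n v hv => by
    simp [hp n v hv, hp _ _ (hV.π_mem n v hv)]
  have hdπ : ∀ v, dV (πV v) = πV (dV v) := by
    intro v
    have h1 := congrArg dV (hV.homotopy v)
    have h2 := hV.homotopy (dV v)
    rw [map_add, hdd, zero_add, map_sub] at h1
    rw [hdd, map_zero, add_zero, h1] at h2
    exact sub_right_injective h2
  refine ⟨fun x => ?_, fun n => ?_, fun n => ?_⟩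
  · induction x with
    | zero => simp
    | add x y hx hy =>
      simp only [map_add] at hx hy ⊢
      rw [add_sub_add_comm, ← hx, ← hy]
      abel
    | tmul v w =>
      simp only [LinearMap.add_apply, TensorProduct.map_tmul, LinearMap.id_apply, map_add,
        LinearMap.comp_apply, hps, hpπ, hpp, hdπ, hdp, map_neg, TensorProduct.neg_tmul]
      have h1 : (dV (sV v)) ⊗ₜ[k] w + sV (dV v) ⊗ₜ[k] w = v ⊗ₜ[k] w - πV v ⊗ₜ[k] w := by
        rw [← TensorProduct.add_tmul, hV.homotopy, TensorProduct.sub_tmul]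
      have h2 : πV v ⊗ₜ[k] (dW (sW w)) + πV v ⊗ₜ[k] sW (dW w) =
          πV v ⊗ₜ[k] w - πV v ⊗ₜ[k] πW w := by
        rw [← TensorProduct.tmul_add, hW.homotopy, TensorProduct.tmul_sub]
      rw [← sub_add_sub_cancel (v ⊗ₜ[k] w) (πV v ⊗ₜ[k] w), ← h1, ← h2]
      abel
  · refine tensorDeg_le (T := (tensorDeg degV degW (n + 1)).comap _) fun a b hab v hv w hw => ?_
    rw [Submodule.mem_comap, LinearMap.add_apply]
    refine Submodule.add_mem _ ?_ ?_
    · exact tmul_mem_tensorDeg (hV.s_mem _ _ hv) hw (by omega)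
    · refine tmul_mem_tensorDeg (p := a) (hV.π_mem _ _ ?_) (hW.s_mem _ _ hw) (by omega)
      rw [hp a v hv]
      exact Submodule.smul_mem _ _ hv
  · refine tensorDeg_le (T := (tensorDeg degV degW n).comap _) fun a b hab v hv w hw => ?_
    exact tmul_mem_tensorDeg (hV.π_mem _ _ hv) (hW.π_mem _ _ hw) hab

/-- The tensor product of contractions. -/
theorem IsContraction.tensor {degV : ℕ → Submodule k V} {dV sV πV p : V →ₗ[k] V} {N : ℕ}
    {degW : ℕ → Submodule k W} {dW sW πW : W →ₗ[k] W} {N' : ℕ}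
    (hV : IsContraction degV dV sV πV N) (hW : IsContraction degW dW sW πW N')
    (htop : ⨆ n, degV n = ⊤) (hp : ∀ n, ∀ v ∈ degV n, p v = (-1 : k) ^ n • v)
    (hdp : ∀ v, dV (p v) = -p (dV v)) (hdd : ∀ v, dV (dV v) = 0) :
    IsContraction (tensorDeg degV degW)
      (TensorProduct.map dV LinearMap.id + TensorProduct.map p dW)
      (TensorProduct.map sV LinearMap.id + TensorProduct.map (πV ∘ₗ p) sW)
      (TensorProduct.map πV πW) (N + N') := by
  refine ⟨hV.toIsHomotopyToId.tensor hW.toIsHomotopyToId htop hp hdp hdd, fun n hn => ?_⟩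
  refine tensorDeg_le (T := LinearMap.ker _) fun a b hab v hv w hw => ?_
  rw [LinearMap.mem_ker, TensorProduct.map_tmul]
  rcases Nat.lt_or_ge N a with h | h
  · rw [hV.π_eq_zero a h v hv, TensorProduct.zero_tmul]
  · rw [hW.π_eq_zero b (by omega) w hw, TensorProduct.tmul_zero]

end Contraction

namespace CubicalSet

/-! ### The chains of the universal cell are contractible in degrees greater than one -/

section ModelContraction

variable {k : Type v} [CommRing k]

/-- Words of the same length with `i` more stars. -/
def sameLength (u : Word) (i : ℕ) : Set Word :=
  {w | w.length = u.length ∧ Word.stars w = Word.stars u + i}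

theorem consW_mem_supported {s t : Set Word} (a : Option Bool) (h : ∀ w ∈ s, a :: w ∈ t)
    {v : WMod k} (hv : v ∈ Finsupp.supported k k s) :
    consW k a v ∈ Finsupp.supported k k t := by
  have : Finsupp.supported k k s ≤ (Finsupp.supported k k t).comap (consW k a) := by
    rw [Finsupp.supported_eq_span_single, Submodule.span_le]
    rintro _ ⟨w, hw, rfl⟩
    rw [SetLike.mem_coe, Submodule.mem_comap, consW_single]
    exact Finsupp.single_mem_supported k _ (h w hw)
  exact this hv

theorem sWord_mem_supported (b : ℕ) (u : Word) :
    sWord k b u ∈ Finsupp.supported k k (sameLength u 1) := by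
  induction u with
  | nil => exact Submodule.zero_mem _
  | cons a u ih =>
    have hc : ∀ ε, consW k (some false) (sWord k b u) ∈
        Finsupp.supported k k (sameLength (some ε :: u) 1) := fun ε =>
      consW_mem_supported (s := sameLength u 1) (t := sameLength (some ε :: u) 1) _
        (fun w hw => ⟨by simp [hw.1], by simp [hw.2]⟩) ih
    rcases a with _ | (_ | _)
    · exact Submodule.zero_mem _
    · exact hc false
    · refine Submodule.add_mem _ (Submodule.smul_mem _ _ ?_) (hc true)
      exact Finsupp.single_mem_supported k _ ⟨rfl, by simp⟩

theorem piWord_mem_supported (u : Word) :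
    piWord k u ∈ Finsupp.supported k k (sameLength u 0) := by
  rw [piWord]
  split_ifs with h
  · refine Finsupp.single_mem_supported k _ ⟨by simp, ?_⟩
    rw [h, Word.stars, List.count_replicate]
    rfl
  · exact Submodule.zero_mem _

variable (k) {X : CubicalSet.{u}}

/-- The chain given by the reduced faces of `x`. -/
noncomputable def evRed (x : Σ n, X.LCell n) : WMod k →ₗ[k] CLTot k X :=
  Finsupp.linearCombination k fun u => gen k X (reducedFace u x)

@[simp] theorem evRed_single (x : Σ n, X.LCell n) (u : Word) :
    evRed k x (Finsupp.single u 1) = gen k X (reducedFace u x) := by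
  simp [evRed]

/-- Two linear maps that agree on the words in `s`, agree on the combinations of these words. -/
theorem eq_of_mem_supported {M : Type*} [AddCommGroup M] [Module k M] {f g : WMod k →ₗ[k] M}
    {s : Set Word} (h : ∀ w ∈ s, f (Finsupp.single w 1) = g (Finsupp.single w 1))
    {v : WMod k} (hv : v ∈ Finsupp.supported k k s) : f v = g v := by
  have : Finsupp.supported k k s ≤ LinearMap.eqLocus f g := by
    rw [Finsupp.supported_eq_span_single, Submodule.span_le]
    rintro _ ⟨w, hw, rfl⟩
    exact h w hw
  exact this hv

theorem map_mem_of_mem_supported {M : Type*} [AddCommGroup M] [Module k M] {f : WMod k →ₗ[k] M}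
    {T : Submodule k M} {s : Set Word} (h : ∀ w ∈ s, f (Finsupp.single w 1) ∈ T)
    {v : WMod k} (hv : v ∈ Finsupp.supported k k s) : f v ∈ T := by
  have : Finsupp.supported k k s ≤ T.comap f := by
    rw [Finsupp.supported_eq_span_single, Submodule.span_le]
    rintro _ ⟨w, hw, rfl⟩
    exact h w hw
  exact this hv

theorem evRed_eq_evW (u : Word) (x : Σ n, X.LCell n) {v : WMod k}
    (hv : v ∈ Finsupp.supported k k {w : Word | w.length = u.length}) :
    evRed k x v = evW k 1 (front (x.1 - 1 - u.length) x) v :=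
  eq_of_mem_supported k (fun w hw => by
    rw [evRed_single, evW_single, reducedFace, show w.length = u.length from hw]) hv

theorem dTot_reducedFace (u : Word) (x : Σ n, X.LCell n) (h : u.length < x.1) :
    dTot k X (gen k X (reducedFace u x)) = evRed k x (dWord k 1 u) := by
  have h1 := front_fst (x.1 - 1 - u.length) x (by omega)
  rw [evRed_eq_evW k u x (dWord_mem_supported k 1 u), ← sum_faceAt_act k 1 u _ (by omega),
    dTot_gen, reducedFace_fst u x h, Finset.sum_range_succ', faceAt_zero_eq true false, sub_self,
    smul_zero, add_zero]
  rfl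

/-- The generating cell of the model, together with its dimension. -/
def modelTop (n : ℕ) : Σ m, (model.{u} (n + 1)).LCell m := ⟨n + 1, modelCell (n + 1)⟩

/-- The contraction of the chains of the model. -/
noncomputable def modelS (n : ℕ) : CLTot k (model.{u} (n + 1)) →ₗ[k] CLTot k (model (n + 1)) :=
  evRed k (modelTop n) ∘ₗ sW k 1 ∘ₗ LinearMap.snd k k (WMod k) ∘ₗ modelRetract k n

/-- The projection of the chains of the model on the chains of degree at most one. -/
noncomputable def modelπ (n : ℕ) : CLTot k (model.{u} (n + 1)) →ₗ[k] CLTot k (model (n + 1)) :=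
  (LinearMap.fst k k (WMod k) ∘ₗ modelRetract k n).smulRight (gen k _ (pt _)) +
    evRed k (modelTop n) ∘ₗ piW k ∘ₗ LinearMap.snd k k (WMod k) ∘ₗ modelRetract k n

theorem modelRetract_evRed (n : ℕ) (u : Word) (h : u.length < n + 1) {v : WMod k}
    (hv : v ∈ Finsupp.supported k k {w : Word | w.length = u.length}) :
    modelRetract.{u} k n (evRed k (modelTop n) v) = (0, v) := by
  change _ = LinearMap.inr k k (WMod k) v
  refine eq_of_mem_supported k (f := modelRetract k n ∘ₗ evRed k (modelTop n)) (fun w hw => ?_) hv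
  rw [LinearMap.comp_apply, evRed_single]
  exact modelRetract_reducedFace k n w (by rw [show w.length = u.length from hw]; exact h)

theorem modelS_pt (n : ℕ) : modelS.{u} k n (gen k _ (pt _)) = 0 := by
  simp [modelS, modelRetract_pt]

theorem modelπ_pt (n : ℕ) : modelπ.{u} k n (gen k _ (pt _)) = gen k _ (pt _) := by
  simp [modelπ, modelRetract_pt]

theorem modelS_evRed (n : ℕ) (u : Word) (h : u.length < n + 1) {v : WMod k}
    (hv : v ∈ Finsupp.supported k k {w : Word | w.length = u.length}) :
    modelS.{u} k n (evRed k (modelTop n) v) = evRed k (modelTop n) (sW k 1 v) := by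
  simp [modelS, modelRetract_evRed k n u h hv]

theorem modelS_reducedFace (n : ℕ) (u : Word) (h : u.length < n + 1) :
    modelS.{u} k n (gen k _ (reducedFace u (modelTop n))) =
      evRed k (modelTop n) (sWord k 1 u) := by
  rw [← evRed_single, modelS_evRed k n u h (Finsupp.single_mem_supported k _ rfl), sW_single]

theorem modelπ_reducedFace (n : ℕ) (u : Word) (h : u.length < n + 1) :
    modelπ.{u} k n (gen k _ (reducedFace u (modelTop n))) =
      evRed k (modelTop n) (piWord k u) := by
  rw [← evRed_single]
  simp only [modelπ, LinearMap.add_apply, LinearMap.smulRight_apply, LinearMap.comp_apply,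
    modelRetract_evRed k n u h (Finsupp.single_mem_supported k _ rfl)]
  simp

/-- Induction on the chains of the model. -/
theorem model_induction (n : ℕ) {T : ℕ → Submodule k (CLTot k (model.{u} (n + 1)))}
    (hpt : gen k _ (pt _) ∈ T 0)
    (hred : ∀ u : Word, u.length < n + 1 →
      gen k _ (reducedFace u (modelTop n)) ∈ T (u.stars + 1)) :
    ∀ m, ∀ v ∈ deg1 k (model.{u} (n + 1)) m, v ∈ T m := by
  intro m v hv
  rw [deg1_eq_span] at hv
  refine Submodule.span_le.2 ?_ hv
  rintro _ ⟨x, rfl⟩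
  rcases model_cells n ⟨m, x⟩ with h | h | ⟨u, hu, h⟩
  · rw [SetLike.mem_coe]
    dsimp only
    rw [gen_degen k _ h]
    exact Submodule.zero_mem _
  · obtain rfl : m = 0 := congrArg Sigma.fst h
    dsimp only
    rw [h]
    exact hpt
  · have h1 := (congrArg Sigma.fst h).trans
      (reducedFace_fst u (⟨n + 1, modelCell.{u} (n + 1)⟩ : Σ m, (model.{u} (n + 1)).LCell m) hu)
    simp only at h1
    dsimp only
    rw [h, h1]
    exact hred u hu

theorem evRed_mem (n : ℕ) (u : Word) (hu : u.length < n + 1) (i : ℕ) {v : WMod k}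
    (hv : v ∈ Finsupp.supported k k (sameLength u i)) :
    evRed k (modelTop.{u} n) v ∈ deg1 k _ (u.stars + i + 1) := by
  refine map_mem_of_mem_supported k (fun w hw => ?_) hv
  rw [evRed_single]
  have := reducedFace_fst w (modelTop.{u} n) (by rw [hw.1]; exact hu)
  rw [hw.2] at this
  exact this ▸ gen_mem_deg1 k _ _

/-- The chains of the model are contracted by `sW`, read in the basis of words: it contracts all
coordinates but the first, so that only degrees `0` and `1` survive. -/
theorem model_isContraction (n : ℕ) :
    IsContraction (deg1 k (model.{u} (n + 1))) (dTot k _) (modelS k n) (modelπ k n) 1 := by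
  have hsub : ∀ (u : Word) (i : ℕ), Finsupp.supported k k (sameLength u i) ≤
      Finsupp.supported k k {w : Word | w.length = u.length} := fun u i =>
    Finsupp.supported_mono fun w hw => hw.1
  refine ⟨⟨fun v => ?_, ?_, ?_⟩, ?_⟩
  · suffices h : dTot k _ ∘ₗ modelS.{u} k n + modelS k n ∘ₗ dTot k _ = LinearMap.id - modelπ k n
      from LinearMap.congr_fun h v
    refine hom_ext_deg1 k (model_induction k n (T := fun _ => LinearMap.eqLocus _ _) ?_ ?_)
    · rw [LinearMap.mem_eqLocus]
      simp only [LinearMap.add_apply, LinearMap.sub_apply, LinearMap.comp_apply,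
        LinearMap.id_apply, modelS_pt, modelπ_pt, dTot_of_mem_deg1_zero k (gen_mem_deg1 k _ (pt _)),
        map_zero, add_zero, sub_self]
    · intro u hu
      have h1 : dTot k _ (evRed k (modelTop.{u} n) (sWord k 1 u)) =
          evRed k (modelTop n) (dW k 1 (sWord k 1 u)) :=
        eq_of_mem_supported k (f := dTot k _ ∘ₗ evRed k (modelTop n))
          (g := evRed k (modelTop n) ∘ₗ dW k 1) (fun w hw => by
            simp only [LinearMap.comp_apply, evRed_single, dW_single]
            exact dTot_reducedFace k w _ (by rw [hw.1]; exact hu)) (sWord_mem_supported 1 u)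
      rw [LinearMap.mem_eqLocus]
      simp only [LinearMap.add_apply, LinearMap.sub_apply, LinearMap.comp_apply,
        LinearMap.id_apply]
      rw [modelS_reducedFace k n u hu, modelπ_reducedFace k n u hu, dTot_reducedFace k u _ hu, h1,
        modelS_evRed k n u hu (dWord_mem_supported k 1 u), ← map_add, dW_sW_add, map_sub,
        evRed_single]
  · refine model_induction k n (T := fun m => (deg1 k _ (m + 1)).comap (modelS k n)) ?_ ?_
    · rw [Submodule.mem_comap, modelS_pt]; exact Submodule.zero_mem _
    · intro u hu
      rw [Submodule.mem_comap, modelS_reducedFace k n u hu]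
      exact evRed_mem k n u hu 1 (sWord_mem_supported 1 u)
  · refine model_induction k n (T := fun m => (deg1 k _ m).comap (modelπ k n)) ?_ ?_
    · rw [Submodule.mem_comap, modelπ_pt]; exact gen_mem_deg1 k _ (pt _)
    · intro u hu
      rw [Submodule.mem_comap, modelπ_reducedFace k n u hu]
      exact evRed_mem k n u hu 0 (piWord_mem_supported u)
  · intro m hm v hv
    have := model_induction k n
      (T := fun m => if 1 < m then LinearMap.ker (modelπ.{u} k n) else ⊤) (by simp) ?_ m v hv
    · simpa [hm] using this
    · intro u hu
      split_ifs with h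
      · rw [LinearMap.mem_ker, modelπ_reducedFace k n u hu, piWord, if_neg (by omega), map_zero]
      · trivial

theorem model_isContraction2 (n : ℕ) :
    ∃ s π, IsContraction (deg2 k (model.{u} (n + 1))) (d2 k _) s π 2 :=
  ⟨_, _, (model_isContraction k n).tensor (model_isContraction k n) (iSup_deg1 k _)
    (fun _ _ => parity_of_mem_deg1 k) (LinearMap.congr_fun (dTot_comp_parity k)) (dTot_dTot k)⟩

theorem model_isContraction3 (n : ℕ) :
    ∃ s π, IsContraction (deg3 k (model.{u} (n + 1))) (d3 k _) s π 3 := by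
  obtain ⟨s, π, h⟩ := model_isContraction2.{u} k n
  exact ⟨_, _, (model_isContraction k n).tensor h (iSup_deg1 k _)
    (fun _ _ => parity_of_mem_deg1 k) (LinearMap.congr_fun (dTot_comp_parity k)) (dTot_dTot k)⟩

end ModelContraction

/-! ### The natural splitting of the quotient by degenerate cells -/

section Normalization

variable {X : CubicalSet.{u}}

/-- An iterated first face of `s_i d_{i,0} x` is either `s_j d_{j,0} z` for an iterated first face
`z` of `x`, or, after more than `i` steps, an iterated first face of `x` itself. The dimension
determines which of the two occurs, and the number `j`. -/
theorem frontFace_degen_face {n m : ℕ} (i : Fin (n + 1)) (x : X.cell (n + 1)) (y : X.cell m)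
    (h : X.FrontFace (X.degen i (X.face i false x)) y) :
    (∃ (l : ℕ) (e : m = l + 1) (z : X.cell (l + 1)) (j : Fin (l + 1)), X.FrontFace x z ∧
      e ▸ y = X.degen j (X.face j false z) ∧ j.val + n = i.val + l) ∨
    (X.FrontFace x y ∧ i.val + m ≤ n) := by
  induction h with
  | refl => exact Or.inl ⟨n, rfl, x, i, .refl, rfl, rfl⟩
  | @step m y ω _ ih =>
    rcases ih with ⟨l, e, z, j, hz, hy, hj⟩ | ⟨hy, hlt⟩
    · obtain rfl : m = l := by omega
      change y = _ at hy
      subst hy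
      rcases Fin.eq_zero_or_eq_succ j with rfl | ⟨j', rfl⟩
      · refine Or.inr ⟨?_, by simp at hj; omega⟩
        rw [X.face_degen_self]
        exact hz.step false
      · cases m with
        | zero => exact j'.elim0
        | succ m =>
          refine Or.inl ⟨m, rfl, X.face 0 ω z, j', hz.step ω, ?_, by simp at hj; omega⟩
          change X.face (Fin.castSucc 0) ω _ = _
          rw [X.face_degen_below j' 0 ω _ (Fin.zero_le _)]
          congr 1
          exact (X.face_face 0 j' ω false z (Fin.zero_le _)).symm
    · exact Or.inr ⟨hy.step ω, by omega⟩

theorem IsL.degen_face {n : ℕ} {x : X.cell (n + 1)} (hx : X.IsL x) (i : Fin (n + 1)) :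
    X.IsL (X.degen i (X.face i false x)) := by
  intro m y y' h h'
  rcases frontFace_degen_face i x y h with ⟨l, e, z, j, hz, hy, hj⟩ | ⟨hy, hlt⟩ <;>
  rcases frontFace_degen_face i x y' h' with ⟨l', e', z', j', hz', hy', hj'⟩ | ⟨hy', hlt'⟩
  · subst e
    obtain rfl : l = l' := by omega
    obtain rfl : j = j' := Fin.ext (by omega)
    change y = _ at hy
    change y' = _ at hy'
    rw [hy, hy', hx _ z z' hz hz']
  · omega
  · omega
  · exact hx _ _ _ hy hy'

/-- The degenerate cell `s_i d_{i,0} x` of `LX`. -/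
def collapse {n : ℕ} (i : Fin (n + 1)) (x : X.LCell (n + 1)) : X.LCell (n + 1) :=
  ⟨X.degen i (X.face i false x.1), x.2.degen_face i⟩

theorem collapse_comm_of_lt {n : ℕ} {i j : Fin (n + 1)} (h : i < j) (x : X.LCell (n + 1)) :
    collapse i (collapse j x) = collapse j (collapse i x) := by
  obtain ⟨j, rfl⟩ := Fin.exists_succ_eq.2 (Fin.ne_zero_of_lt h)
  obtain ⟨i, rfl⟩ := Fin.exists_castSucc_eq.2 (Fin.ne_last_of_lt h)
  have hle : i ≤ j := by
    simp only [Fin.lt_def, Fin.val_castSucc, Fin.val_succ] at h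
    exact Fin.le_def.2 (by omega)
  cases n with
  | zero => exact i.elim0
  | succ n =>
    refine Subtype.ext ?_
    change X.degen i.castSucc (X.face i.castSucc false (X.degen j.succ (X.face j.succ false x.1))) =
      X.degen j.succ (X.face j.succ false (X.degen i.castSucc (X.face i.castSucc false x.1)))
    rw [X.face_degen_below j i false _ hle, X.face_degen_above i j false _ hle,
      X.degen_degen i j _ hle, X.face_face i j _ _ _ hle]

theorem collapse_comm {n : ℕ} (i j : Fin (n + 1)) (x : X.LCell (n + 1)) :
    collapse i (collapse j x) = collapse j (collapse i x) := by
  rcases lt_trichotomy i j with h | rfl | h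
  · exact collapse_comm_of_lt h x
  · rfl
  · exact (collapse_comm_of_lt h x).symm

end Normalization

section Splitting

variable (k : Type v) [CommRing k] (X : CubicalSet.{u})

/-- The operator `1 - s_i d_{i,0}`. -/
noncomputable def normFactor {n : ℕ} (i : Fin (n + 1)) : Module.End k (QL k X (n + 1)) :=
  1 - Finsupp.lmapDomain k k (collapse i)

/-- The product of the operators `1 - s_i d_{i,0}` with `i` in a list. -/
noncomputable def normProd {n : ℕ} (l : List (Fin (n + 1))) : Module.End k (QL k X (n + 1)) :=
  (l.map (normFactor k X)).prod

theorem normFactor_commute {n : ℕ} (i j : Fin (n + 1)) :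
    Commute (normFactor k X i) (normFactor k X j) := by
  refine Finsupp.lhom_ext' fun x => LinearMap.ext_ring ?_
  simp only [normFactor, LinearMap.comp_apply, Module.End.mul_apply, LinearMap.sub_apply,
    Module.End.one_apply, Finsupp.lsingle_apply, Finsupp.lmapDomain_apply, map_sub,
    Finsupp.mapDomain_single, collapse_comm i j]
  abel

/-- A degenerate cell `x = s_i y` is killed by the factor `1 - s_i d_{i,0}`, and the factors
commute. -/
theorem normProd_single_degen {n : ℕ} {l : List (Fin (n + 1))} {i : Fin (n + 1)} (hi : i ∈ l)
    (x : X.LCell (n + 1)) (y : X.cell n) (hx : x.1 = X.degen i y) :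
    normProd k X l (Finsupp.single x 1) = 0 := by
  induction l with
  | nil => simp at hi
  | cons a l ih =>
    by_cases h : i ∈ l
    · rw [normProd, List.map_cons, List.prod_cons, Module.End.mul_apply]
      exact (congrArg _ (ih h)).trans (map_zero _)
    · obtain rfl : i = a := by simpa [h] using hi
      have hc : Commute (normFactor k X i) (l.map (normFactor k X)).prod :=
        Commute.list_prod_right _ _ fun b hb => by
          obtain ⟨j, _, rfl⟩ := List.mem_map.1 hb
          exact normFactor_commute k X i j
      have hx' : collapse i x = x := Subtype.ext <| by
        change X.degen i (X.face i false x.1) = x.1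
        rw [hx, X.face_degen_self]
      rw [normProd, List.map_cons, List.prod_cons, hc.eq, Module.End.mul_apply]
      simp [normFactor, hx']

theorem lmapDomain_collapse_mem {n : ℕ} (i : Fin (n + 1)) (v : QL k X (n + 1)) :
    Finsupp.lmapDomain k k (collapse i) v ∈ DL k X (n + 1) := by
  induction v using Finsupp.induction_linear with
  | zero => simp
  | add a b ha hb => rw [map_add]; exact Submodule.add_mem _ ha hb
  | single x a =>
    have : Finsupp.single x a = a • Finsupp.single x (1 : k) := by simp
    rw [this, map_smul]
    refine Submodule.smul_mem _ _ (Submodule.subset_span ⟨collapse i x, ⟨i, _, rfl⟩, ?_⟩)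
    simp

theorem normProd_sub_mem {n : ℕ} (l : List (Fin (n + 1))) (v : QL k X (n + 1)) :
    normProd k X l v - v ∈ DL k X (n + 1) := by
  induction l with
  | nil => simp [normProd]
  | cons a l ih =>
    have : normProd k X (a :: l) v = normFactor k X a (normProd k X l v) := by
      simp [normProd, List.prod_cons]
    rw [this, normFactor, LinearMap.sub_apply, Module.End.one_apply, sub_right_comm]
    exact Submodule.sub_mem _ ih (lmapDomain_collapse_mem k X a _)

variable {X} in
theorem lmapDomain_normProd {Y : CubicalSet.{u}} (f : Hom X Y) {n : ℕ} (l : List (Fin (n + 1)))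
    (v : QL k X (n + 1)) : Finsupp.lmapDomain k k f.lapp (normProd k X l v) =
      normProd k Y l (Finsupp.lmapDomain k k f.lapp v) := by
  induction l with
  | nil => rfl
  | cons a l ih =>
    have hc : ∀ w : QL k X (n + 1), Finsupp.lmapDomain k k f.lapp (normFactor k X a w) =
        normFactor k Y a (Finsupp.lmapDomain k k f.lapp w) := by
      intro w
      suffices h : Finsupp.lmapDomain k k f.lapp ∘ₗ normFactor k X a =
          normFactor k Y a ∘ₗ Finsupp.lmapDomain k k f.lapp from LinearMap.congr_fun h w
      refine Finsupp.lhom_ext' fun x => LinearMap.ext_ring ?_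
      have : f.lapp (collapse a x) = collapse a (f.lapp x) := Subtype.ext <| by
        change f.app (X.degen a (X.face a false x.1)) = Y.degen a (Y.face a false (f.app x.1))
        rw [f.app_degen, f.app_face]
      simp only [normFactor, LinearMap.comp_apply, LinearMap.sub_apply, Module.End.one_apply,
        Finsupp.lsingle_apply, map_sub]
      simp [this]
    have h1 : normProd k X (a :: l) v = normFactor k X a (normProd k X l v) := by
      simp [normProd, List.prod_cons]
    have h2 : ∀ w, normProd k Y (a :: l) w = normFactor k Y a (normProd k Y l w) := by
      simp [normProd, List.prod_cons]
    rw [h1, h2, hc, ih]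

/-- The natural section `x ↦ ∏ (1 - s_i d_{i,0}) x` of the projection `QL_n(X) → CL_n(X)`. -/
noncomputable def splitCL (n : ℕ) : CL k X (n + 1) →ₗ[k] QL k X (n + 1) :=
  (DL k X (n + 1)).liftQ (normProd k X (List.finRange (n + 1))) <| by
    rw [DL, Submodule.span_le]
    rintro _ ⟨x, ⟨i, y, hx⟩, rfl⟩
    exact normProd_single_degen k X (List.mem_finRange i) x y hx

theorem splitCL_mkCL (n : ℕ) (v : QL k X (n + 1)) :
    splitCL k X n (mkCL k X (n + 1) v) = normProd k X (List.finRange (n + 1)) v := rfl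

theorem mkCL_surjective (n : ℕ) : Function.Surjective (mkCL k X n) := (DL k X n).mkQ_surjective

theorem mkCL_splitCL (n : ℕ) (v : CL k X (n + 1)) : mkCL k X (n + 1) (splitCL k X n v) = v := by
  obtain ⟨v, rfl⟩ := mkCL_surjective k X _ v
  rw [splitCL_mkCL, ← sub_eq_zero, ← map_sub]
  exact (Submodule.Quotient.mk_eq_zero _).2 (normProd_sub_mem k X _ v)

variable {X}

theorem mapCL_mkCL {Y : CubicalSet.{u}} (f : Hom X Y) (n : ℕ) (v : QL k X n) :
    mapCL k f n (mkCL k X n v) = mkCL k Y n (Finsupp.lmapDomain k k f.lapp v) := rfl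

theorem splitCL_mapCL {Y : CubicalSet.{u}} (f : Hom X Y) (n : ℕ) (v : CL k X (n + 1)) :
    splitCL k Y n (mapCL k f (n + 1) v) = Finsupp.lmapDomain k k f.lapp (splitCL k X n v) := by
  obtain ⟨v, rfl⟩ := mkCL_surjective k X _ v
  rw [mapCL_mkCL, splitCL_mkCL, splitCL_mkCL, lmapDomain_normProd]

theorem dCL_mapCL {Y : CubicalSet.{u}} (f : Hom X Y) (n : ℕ) (v : CL k X (n + 1)) :
    dCL k Y n (mapCL k f (n + 1) v) = mapCL k f n (dCL k X n v) := by
  have h := LinearMap.congr_fun (map1_comp_dTot k f) (DirectSum.lof k ℕ (CL k X) (n + 1) v)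
  simp only [LinearMap.comp_apply, dTot_lof_succ, map1, DirectSum.lmap_lof] at h
  exact (DirectSum.of_injective (β := CL k Y) n h).symm

end Splitting

/-! ### Natural chain maps that vanish in low degrees are null homotopic -/

section Extension

variable {k : Type v} [CommRing k] {T : CubicalSet.{u} → Type w} [∀ X, AddCommGroup (T X)]
  [∀ X, Module k (T X)]

/-- Acyclic models: a natural chain map of degree `0` from `CL_•` that vanishes in the degrees
`≤ N` is naturally null homotopic if its target is acyclic on the models in the degrees `> N`. A
null homotopy is determined by its values on the generators of the models, and the section
`splitCL` makes it vanish on degenerate cells. -/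
theorem exists_nullHomotopy (N : ℕ) (d : ∀ X, T X →ₗ[k] T X) (deg : ∀ X, ℕ → Submodule k (T X))
    (map : ∀ {X Y : CubicalSet.{u}}, Hom X Y → (T X →ₗ[k] T Y))
    (map_comp : ∀ {X Y Z : CubicalSet.{u}} (g : Hom Y Z) (f : Hom X Y),
      map (g.comp f) = map g ∘ₗ map f)
    (map_d : ∀ {X Y : CubicalSet.{u}} (f : Hom X Y) (t : T X), map f (d X t) = d Y (map f t))
    (map_deg : ∀ {X Y : CubicalSet.{u}} (f : Hom X Y) (n : ℕ), ∀ t ∈ deg X n, map f t ∈ deg Y n)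
    (acyclic : ∀ n m, N < m → ∀ t ∈ deg (model (n + 1)) m, d _ t = 0 →
      ∃ t' ∈ deg (model (n + 1)) (m + 1), d _ t' = t)
    (φ : ∀ X : CubicalSet.{u}, CLTot k X →ₗ[k] T X)
    (φ_mem : ∀ X n, ∀ v ∈ deg1 k X n, φ X v ∈ deg X n)
    (φ_comm : ∀ X v, d X (φ X v) = φ X (dTot k X v))
    (φ_natural : ∀ (X Y : CubicalSet.{u}) (f : Hom X Y) (v : CLTot k X),
      φ Y (map1 k f v) = map f (φ X v))
    (φ_zero : ∀ X n, n ≤ N → ∀ v ∈ deg1 k X n, φ X v = 0) :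
    ∃ h : ∀ X : CubicalSet.{u}, CLTot k X →ₗ[k] T X,
      (∀ X n, ∀ v ∈ deg1 k X n, h X v ∈ deg X (n + 1)) ∧
      (∀ X v, d X (h X v) + h X (dTot k X v) = φ X v) ∧
      ∀ (X Y : CubicalSet.{u}) (f : Hom X Y) (v : CLTot k X), h Y (map1 k f v) = map f (h X v) := by
  have mem_lof : ∀ X n (v : CL k X n), DirectSum.lof k ℕ (CL k X) n v ∈ deg1 k X n :=
    fun X n v => ⟨v, rfl⟩
  -- The components of the null homotopy in degree `n`, with what is needed to go on.
  let Q : ∀ n, (∀ X : CubicalSet.{u}, CL k X n →ₗ[k] T X) → Prop := fun n h =>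
    (∀ X v, h X v ∈ deg X (n + 1)) ∧
    (∀ X (v : CL k X (n + 1)), d X (h X (dCL k X n v)) =
      φ X (DirectSum.lof k ℕ (CL k X) n (dCL k X n v))) ∧
    (∀ (X Y : CubicalSet.{u}) (f : Hom X Y) v, h Y (mapCL k f n v) = map f (h X v)) ∧
    (n ≤ N → h = 0)
  have step : ∀ n (h : {h // Q n h}), ∃ h' : {h' // Q (n + 1) h'}, ∀ X v,
      d X (h'.1 X v) + h.1 X (dCL k X n v) = φ X (DirectSum.lof k ℕ (CL k X) (n + 1) v) := by
    rintro n ⟨h, hdeg, hd, hnat, hzero⟩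
    rcases Nat.lt_or_ge N (n + 1) with hN | hN
    -- In a degree `> N`, choose a value `e` on the generator of the model, transport it to every
    -- cell along `modelHom`, and compose with `splitCL` to descend to the quotient.
    · let ι := mkCL k (model.{u} (n + 1)) (n + 1) (Finsupp.single (modelCell (n + 1)) 1)
      obtain ⟨e, he, hde⟩ := acyclic n (n + 1) hN
        (φ _ (DirectSum.lof k ℕ (CL k _) (n + 1) ι) - h _ (dCL k _ n ι))
        (Submodule.sub_mem _ (φ_mem _ _ _ (mem_lof _ _ _)) (hdeg _ _))
        (by rw [map_sub, φ_comm, dTot_lof_succ, hd, sub_self])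
      let h0 : ∀ X : CubicalSet.{u}, QL k X (n + 1) →ₗ[k] T X := fun X =>
        Finsupp.linearCombination k fun x => map (modelHom x) e
      have h0_deg : ∀ X v, h0 X v ∈ deg X (n + 1 + 1) := by
        intro X v
        refine Submodule.sum_mem _ fun x _ => Submodule.smul_mem _ _ ?_
        exact map_deg _ _ _ he
      have h0_nat : ∀ (X Y : CubicalSet.{u}) (f : Hom X Y) v,
          h0 Y (Finsupp.lmapDomain k k f.lapp v) = map f (h0 X v) := by
        intro X Y f v
        suffices hh : h0 Y ∘ₗ Finsupp.lmapDomain k k f.lapp = map f ∘ₗ h0 X from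
          LinearMap.congr_fun hh v
        refine Finsupp.lhom_ext' fun x => LinearMap.ext_ring ?_
        simp [h0, modelHom_lapp, map_comp]
      have h0_d : ∀ X v, d X (h0 X v) + h X (dCL k X n (mkCL k X (n + 1) v)) =
          φ X (DirectSum.lof k ℕ (CL k X) (n + 1) (mkCL k X (n + 1) v)) := by
        intro X v
        suffices hh : d X ∘ₗ h0 X + h X ∘ₗ dCL k X n ∘ₗ mkCL k X (n + 1) =
            φ X ∘ₗ DirectSum.lof k ℕ (CL k X) (n + 1) ∘ₗ mkCL k X (n + 1) from
          LinearMap.congr_fun hh v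
        refine Finsupp.lhom_ext' fun x => LinearMap.ext_ring ?_
        have e1 : mapCL k (modelHom x) (n + 1) ι = mkCL k X (n + 1) (Finsupp.single x 1) := by
          rw [mapCL_mkCL, Finsupp.lmapDomain_apply, Finsupp.mapDomain_single]
          rfl
        have e2 : φ X (DirectSum.lof k ℕ (CL k X) (n + 1)
            (mkCL k X (n + 1) (Finsupp.single x 1))) = map (modelHom x)
              (φ _ (DirectSum.lof k ℕ (CL k _) (n + 1) ι)) := by
          rw [← φ_natural, map1, DirectSum.lmap_lof, e1]
        have e3 : h X (dCL k X n (mkCL k X (n + 1) (Finsupp.single x 1))) =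
            map (modelHom x) (h _ (dCL k _ n ι)) := by
          rw [← hnat, ← dCL_mapCL, e1]
        simp only [LinearMap.comp_apply, LinearMap.add_apply, Finsupp.lsingle_apply, e2, e3]
        simp only [h0, Finsupp.linearCombination_single, one_smul]
        rw [← map_d, hde, map_sub, sub_add_cancel]
      have key : ∀ X v, d X (h0 X (splitCL k X n v)) + h X (dCL k X n v) =
          φ X (DirectSum.lof k ℕ (CL k X) (n + 1) v) := by
        intro X v
        have := h0_d X (splitCL k X n v)
        rwa [mkCL_splitCL] at this
      refine ⟨⟨fun X => h0 X ∘ₗ splitCL k X n, fun X v => h0_deg X _, fun X v => ?_,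
        fun X Y f v => ?_, fun hn => absurd hn (by omega)⟩, key⟩
      · have := key X (dCL k X (n + 1) v)
        rwa [dCL_dCL, map_zero, add_zero] at this
      · rw [LinearMap.comp_apply, splitCL_mapCL, h0_nat]
        rfl
    · refine ⟨⟨0, fun X v => Submodule.zero_mem _, fun X v => ?_, fun X Y f v => ?_,
        fun _ => rfl⟩, fun X v => ?_⟩
      · rw [φ_zero X (n + 1) hN _ (mem_lof _ _ _)]; exact map_zero _
      · exact (map_zero _).symm
      · rw [φ_zero X (n + 1) hN _ (mem_lof _ _ _)]
        obtain rfl := hzero (by omega)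
        change d X 0 + 0 = 0
        rw [map_zero, add_zero]
  have h_zero : Q 0 0 := by
    refine ⟨fun X v => Submodule.zero_mem _, fun X v => ?_, fun X Y f v => ?_, fun _ => rfl⟩
    · rw [φ_zero X 0 (Nat.zero_le _) _ (mem_lof _ _ _)]; exact map_zero _
    · exact (map_zero _).symm
  choose F hF using step
  let H : ∀ n, {h // Q n h} := fun n => Nat.rec ⟨0, h_zero⟩ F n
  refine ⟨fun X => DirectSum.toModule k ℕ (T X) fun n => (H n).1 X, ?_, ?_, ?_⟩
  · rintro X n _ ⟨v, rfl⟩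
    rw [DirectSum.toModule_lof]
    exact (H n).2.1 X v
  · intro X v
    suffices hh : d X ∘ₗ (DirectSum.toModule k ℕ (T X) fun n => (H n).1 X) +
        (DirectSum.toModule k ℕ (T X) fun n => (H n).1 X) ∘ₗ dTot k X = φ X from
      LinearMap.congr_fun hh v
    refine DirectSum.linearMap_ext _ fun n => LinearMap.ext fun v => ?_
    simp only [LinearMap.comp_apply, LinearMap.add_apply, DirectSum.toModule_lof]
    cases n with
    | zero =>
      rw [dTot_lof_zero, map_zero, φ_zero X 0 (Nat.zero_le _) _ (mem_lof _ _ _), add_zero]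
      exact map_zero _
    | succ n =>
      rw [dTot_lof_succ, DirectSum.toModule_lof]
      exact hF n (H n) X v
  · intro X Y f v
    suffices hh : (DirectSum.toModule k ℕ (T Y) fun n => (H n).1 Y) ∘ₗ map1 k f =
        map f ∘ₗ (DirectSum.toModule k ℕ (T X) fun n => (H n).1 X) from LinearMap.congr_fun hh v
    refine DirectSum.linearMap_ext _ fun n => LinearMap.ext fun v => ?_
    simp only [LinearMap.comp_apply, map1, DirectSum.lmap_lof, DirectSum.toModule_lof]
    exact (H n).2.2.2.1 X Y f v

end Extension

/-! ### The diagonal of the cube -/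

section SerreDiagonal

variable (k : Type v) [CommRing k]

/-- The differential of the tensor square of the module of words. -/
noncomputable def dWW : WMod k ⊗[k] WMod k →ₗ[k] WMod k ⊗[k] WMod k :=
  TensorProduct.map (dW k 0) LinearMap.id + TensorProduct.map (parW k 0) (dW k 0)

/-- Multiplication by the diagonal `* ⊗ 1 + 0 ⊗ *` of one more coordinate. -/
noncomputable def serreStep : WMod k ⊗[k] WMod k →ₗ[k] WMod k ⊗[k] WMod k :=
  TensorProduct.map (consW k none) (consW k (some true) ∘ₗ parW k 0) +
    TensorProduct.map (consW k (some false)) (consW k none)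

/-- One more coordinate, fixed to the same value on both sides. -/
noncomputable def consBoth (ε : Bool) : WMod k ⊗[k] WMod k →ₗ[k] WMod k ⊗[k] WMod k :=
  TensorProduct.map (consW k (some ε)) (consW k (some ε))

/-- The sign of the tensor square. -/
noncomputable def parWW : WMod k ⊗[k] WMod k →ₗ[k] WMod k ⊗[k] WMod k :=
  TensorProduct.map (parW k 0) (parW k 0)

/-- The boundary of `* ⊗ 1 + 0 ⊗ *` is `1 ⊗ 1 - 0 ⊗ 0`, as the terms `0 ⊗ 1` cancel. -/
theorem dWW_serreStep (t : WMod k ⊗[k] WMod k) :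
    dWW k (serreStep k t) = serreStep k (dWW k t) +
      (consBoth k true (parWW k t) - consBoth k false (parWW k t)) := by
  induction t with
  | zero => simp
  | add a b ha hb => simp only [map_add, ha, hb]; abel
  | tmul u v =>
    simp only [dWW, serreStep, consBoth, parWW, LinearMap.add_apply, TensorProduct.map_tmul,
      map_add, LinearMap.comp_apply, LinearMap.id_apply, dW_consW_none, dW_consW_some,
      parW_consW_none, parW_consW_some, parW_dW, TensorProduct.add_tmul, TensorProduct.tmul_add,
      TensorProduct.sub_tmul, TensorProduct.tmul_sub, TensorProduct.neg_tmul,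
      TensorProduct.tmul_neg, map_neg]
    abel

theorem parWW_serreStep (t : WMod k ⊗[k] WMod k) :
    parWW k (serreStep k t) = (-1 : k) • serreStep k (parWW k t) := by
  have hnone : ∀ v, parW k 0 (consW k none v) = (-1 : k) • consW k none (parW k 0 v) := by
    intro v
    rw [parW_consW_none, neg_one_smul]
  induction t with
  | zero => simp only [map_zero, smul_zero]
  | add a b ha hb => simp only [map_add, ha, hb, smul_add]
  | tmul u v =>
    simp only [serreStep, parWW, LinearMap.add_apply, TensorProduct.map_tmul,
      map_add, LinearMap.comp_apply, hnone, parW_consW_some, TensorProduct.tmul_smul,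
      ← TensorProduct.smul_tmul', smul_add]

theorem parWW_iterate (n : ℕ) {t : WMod k ⊗[k] WMod k} (ht : parWW k t = (-1 : k) • t) :
    parWW k ((serreStep k)^[n] t) = (-1 : k) ^ (n + 1) • (serreStep k)^[n] t := by
  induction n with
  | zero => rw [zero_add, pow_one]; exact ht
  | succ n ih =>
    rw [Function.iterate_succ_apply', parWW_serreStep, ih, map_smul, smul_smul, pow_succ' _ (n + 1)]

theorem dWW_iterate (n : ℕ) {t : WMod k ⊗[k] WMod k} (ht : parWW k t = (-1 : k) • t) :
    dWW k ((serreStep k)^[n] t) = (serreStep k)^[n] (dWW k t) +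
      ∑ i ∈ Finset.range n, (-1 : k) ^ (i + 1) •
        ((serreStep k)^[n - 1 - i] (consBoth k true ((serreStep k)^[i] t)) -
          (serreStep k)^[n - 1 - i] (consBoth k false ((serreStep k)^[i] t))) := by
  induction n with
  | zero => simp
  | succ n ih =>
    rw [Function.iterate_succ_apply', dWW_serreStep, ih, Finset.sum_range_succ, map_add, map_sum,
      parWW_iterate k n ht, Function.iterate_succ_apply', add_assoc]
    congr 2
    · refine Finset.sum_congr rfl fun i hi => ?_
      rw [Finset.mem_range] at hi
      rw [show n + 1 - 1 - i = (n - 1 - i) + 1 by omega, Function.iterate_succ_apply',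
        Function.iterate_succ_apply', map_smul, map_sub]
    · simp [smul_sub]

/-- Pairs of words in which each coordinate is free exactly on one side. -/
def IsComplementary (u v : Word) : Prop := List.Forall₂ (fun a b => a = none ↔ b ≠ none) u v

/-- The span of the complementary pairs of words of length `n`. -/
noncomputable def complSpan (n : ℕ) : Submodule k (WMod k ⊗[k] WMod k) :=
  Submodule.span k {t | ∃ u v : Word, u.length = n ∧ IsComplementary u v ∧
    t = Finsupp.single u 1 ⊗ₜ Finsupp.single v 1}

variable {k}

theorem eq_of_mem_complSpan {n : ℕ} {M : Type*} [AddCommMonoid M] [Module k M]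
    {f g : WMod k ⊗[k] WMod k →ₗ[k] M}
    (h : ∀ u v : Word, u.length = n → IsComplementary u v →
      f (Finsupp.single u 1 ⊗ₜ Finsupp.single v 1) = g (Finsupp.single u 1 ⊗ₜ Finsupp.single v 1))
    {t : WMod k ⊗[k] WMod k} (ht : t ∈ complSpan k n) : f t = g t := by
  have : complSpan k n ≤ LinearMap.eqLocus f g := by
    rw [complSpan, Submodule.span_le]
    rintro _ ⟨u, v, hu, hc, rfl⟩
    exact h u v hu hc
  exact this ht

theorem map_mem_of_mem_complSpan {n : ℕ} {M : Type*} [AddCommMonoid M] [Module k M]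
    {f : WMod k ⊗[k] WMod k →ₗ[k] M} {T : Submodule k M}
    (h : ∀ u v : Word, u.length = n → IsComplementary u v →
      f (Finsupp.single u 1 ⊗ₜ Finsupp.single v 1) ∈ T)
    {t : WMod k ⊗[k] WMod k} (ht : t ∈ complSpan k n) : f t ∈ T := by
  have : complSpan k n ≤ T.comap f := by
    rw [complSpan, Submodule.span_le]
    rintro _ ⟨u, v, hu, hc, rfl⟩
    exact h u v hu hc
  exact this ht

theorem serreStep_single (u v : Word) :
    serreStep k (Finsupp.single u 1 ⊗ₜ Finsupp.single v 1) =
      (-1 : k) ^ v.stars • (Finsupp.single (none :: u) 1 ⊗ₜ Finsupp.single (some true :: v) 1) +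
        Finsupp.single (some false :: u) 1 ⊗ₜ Finsupp.single (none :: v) 1 := by
  simp only [serreStep, LinearMap.add_apply, TensorProduct.map_tmul, LinearMap.comp_apply,
    parW_single, map_smul, consW_single, TensorProduct.tmul_smul, add_zero]

theorem serreStep_mem {n : ℕ} {t : WMod k ⊗[k] WMod k} (ht : t ∈ complSpan k n) :
    serreStep k t ∈ complSpan k (n + 1) := by
  refine map_mem_of_mem_complSpan (T := complSpan k (n + 1)) (fun u v hu hc => ?_) ht
  rw [serreStep_single]
  refine Submodule.add_mem _ (Submodule.smul_mem _ _ (Submodule.subset_span ?_))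
    (Submodule.subset_span ?_)
  · exact ⟨none :: u, some true :: v, by simp [hu], .cons (by simp) hc, rfl⟩
  · exact ⟨some false :: u, none :: v, by simp [hu], .cons (by simp) hc, rfl⟩

theorem iterate_mem (n : ℕ) {t : WMod k ⊗[k] WMod k} (ht : t ∈ complSpan k 1) :
    (serreStep k)^[n] t ∈ complSpan k (n + 1) := by
  induction n with
  | zero => exact ht
  | succ n ih => rw [Function.iterate_succ_apply']; exact serreStep_mem ih

theorem IsComplementary.length_eq {u v : Word} (h : IsComplementary u v) :
    u.length = v.length := List.Forall₂.length_eq h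

theorem IsComplementary.stars_add {u v : Word} (h : IsComplementary u v) :
    u.stars + v.stars = u.length := by
  induction h with
  | nil => rfl
  | @cons a b u v hab _ ih =>
    rcases a with _ | ε <;> rcases b with _ | ω <;> simp at hab <;> simp <;> omega

/-- Functionals on words that agree up to the replacement of a given end of the words agree on
the iterated diagonal, up to the same replacement on both sides. -/
theorem map_iterate_congr {M M' : Type*} [AddCommGroup M] [Module k M] [AddCommGroup M']
    [Module k M'] (m : ℕ) (a a' b b' : Word) (hb : b.stars = b'.stars)
    {f g : WMod k →ₗ[k] M} {f' g' : WMod k →ₗ[k] M'}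
    (hf : ∀ c : Word, c.length = m →
      f (Finsupp.single (c ++ a) 1) = g (Finsupp.single (c ++ a') 1))
    (hf' : ∀ c : Word, c.length = m →
      f' (Finsupp.single (c ++ b) 1) = g' (Finsupp.single (c ++ b') 1)) :
    TensorProduct.map f f' ((serreStep k)^[m] (Finsupp.single a 1 ⊗ₜ Finsupp.single b 1)) =
      TensorProduct.map g g' ((serreStep k)^[m] (Finsupp.single a' 1 ⊗ₜ Finsupp.single b' 1)) := by
  induction m generalizing f g f' g' with
  | zero =>
    have h1 := hf [] rfl
    have h2 := hf' [] rfl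
    rw [List.nil_append, List.nil_append] at h1 h2
    rw [Function.iterate_zero, id, id, TensorProduct.map_tmul, TensorProduct.map_tmul, h1, h2]
  | succ m ih =>
    have hstep : ∀ (f : WMod k →ₗ[k] M) (f' : WMod k →ₗ[k] M') (t : WMod k ⊗[k] WMod k),
        TensorProduct.map f f' (serreStep k t) =
          TensorProduct.map (f ∘ₗ consW k none) (f' ∘ₗ consW k (some true) ∘ₗ parW k 0) t +
            TensorProduct.map (f ∘ₗ consW k (some false)) (f' ∘ₗ consW k none) t := by
      intro f f' t
      rw [serreStep, LinearMap.add_apply, map_add, TensorProduct.map_comp, TensorProduct.map_comp]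
      rfl
    have hcons : ∀ (x : Option Bool) (c : Word), c.length = m →
        (f ∘ₗ consW k x) (Finsupp.single (c ++ a) 1) =
          (g ∘ₗ consW k x) (Finsupp.single (c ++ a') 1) := by
      intro x c hc
      simpa using hf (x :: c) (by simp [hc])
    have hcons' : ∀ (x : Option Bool) (c : Word), c.length = m →
        (f' ∘ₗ consW k x) (Finsupp.single (c ++ b) 1) =
          (g' ∘ₗ consW k x) (Finsupp.single (c ++ b') 1) := by
      intro x c hc
      simpa using hf' (x :: c) (by simp [hc])
    rw [Function.iterate_succ_apply', Function.iterate_succ_apply', hstep, hstep]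
    congr 1
    · refine ih (hcons none) fun c hc => ?_
      have hs : Word.stars (c ++ b) = Word.stars (c ++ b') := by
        simp only [Word.stars, List.count_append] at hb ⊢
        rw [hb]
      have := hcons' (some true) c hc
      simp only [LinearMap.comp_apply] at this
      simp only [LinearMap.comp_apply, parW_single, map_smul, this, hs]
    · exact ih (hcons _) (hcons' _)

variable {X : CubicalSet.{u}}

variable (k) in
/-- The evaluation of pairs of words on a cell. -/
noncomputable def evPair (x : Σ n, X.LCell n) : WMod k ⊗[k] WMod k →ₗ[k] CL2 k X :=
  TensorProduct.map (evW k 0 x) (evW k 0 x)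

theorem dTot_act (u : Word) (x : Σ n, X.LCell n) (h : u.length = x.1) :
    dTot k X (gen k X (act 0 u x)) = evW k 0 x (dWord k 0 u) := by
  have h1 := act_fst 0 u x (by omega)
  rw [← sum_faceAt_act k 0 u x (by omega), dTot_gen, show (act 0 u x).1 = u.stars by omega]
  rfl

theorem d2_evPair (x : Σ n, X.LCell n) {t : WMod k ⊗[k] WMod k} (ht : t ∈ complSpan k x.1) :
    d2 k X (evPair k x t) = evPair k x (dWW k t) := by
  refine eq_of_mem_complSpan (f := d2 k X ∘ₗ evPair k x) (g := evPair k x ∘ₗ dWW k)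
    (fun u v hu hc => ?_) ht
  have h1 := act_fst 0 u x (by omega)
  simp only [LinearMap.comp_apply, evPair, d2, dWW, LinearMap.add_apply, map_add,
    TensorProduct.map_tmul, evW_single, dW_single, LinearMap.id_apply]
  rw [dTot_act u x hu, dTot_act v x (hc.length_eq ▸ hu), parity_gen, parW_single, map_smul,
    evW_single, show (act 0 u x).1 = u.stars + 0 by omega]

theorem evPair_mem (x : Σ n, X.LCell n) {t : WMod k ⊗[k] WMod k} (ht : t ∈ complSpan k x.1) :
    evPair k x t ∈ deg2 k X x.1 := by
  refine map_mem_of_mem_complSpan (fun u v hu hc => ?_) ht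
  have h1 := act_fst 0 u x (by omega)
  have h2 := act_fst 0 v x (by have := hc.length_eq; omega)
  have h3 := hc.stars_add
  have h4 := hc.length_eq
  rw [evPair, TensorProduct.map_tmul, evW_single, evW_single]
  exact tmul_mem_tensorDeg (gen_mem_deg1 k X _) (gen_mem_deg1 k X _) (by omega)

/-- `x` is a degeneracy in the direction `j`. -/
def IsDegenAt (j : ℕ) (x : Σ n, X.LCell n) : Prop :=
  ∃ (n : ℕ) (z : X.LCell (n + 1)) (h : j < n + 1) (y : X.cell n),
    x = ⟨n + 1, z⟩ ∧ z.1 = X.degen ⟨j, h⟩ y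

theorem IsDegenAt.faceAt_above {j i : ℕ} {x : Σ n, X.LCell n} (hx : IsDegenAt j x) (hij : j < i)
    (hi : i < x.1) (ε : Bool) : IsDegenAt j (X.faceAt ε i x) := by
  obtain ⟨n, z, hj, y, rfl, hz⟩ := hx
  obtain ⟨n, rfl⟩ : ∃ m, n = m + 1 := ⟨n - 1, by simp at hi; omega⟩
  obtain ⟨i, rfl⟩ : ∃ m, i = m + 1 := ⟨i - 1, by omega⟩
  have hi' : i < n + 1 := by simp at hi; omega
  refine ⟨n, _, by omega, X.face ⟨i, hi'⟩ ε y, faceAt_mk ε hi z, ?_⟩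
  change X.face _ ε z.1 = _
  rw [hz]
  exact X.face_degen_above ⟨j, by omega⟩ ⟨i, hi'⟩ ε y (Fin.mk_le_mk.2 (by omega))

theorem IsDegenAt.faceAt_below {j i : ℕ} {x : Σ n, X.LCell n} (hx : IsDegenAt j x) (hij : i < j)
    (ε : Bool) : IsDegenAt (j - 1) (X.faceAt ε i x) := by
  obtain ⟨n, z, hj, y, rfl, hz⟩ := hx
  obtain ⟨n, rfl⟩ : ∃ m, n = m + 1 := ⟨n - 1, by omega⟩
  obtain ⟨j, rfl⟩ : ∃ m, j = m + 1 := ⟨j - 1, by omega⟩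
  have hj' : j < n + 1 := by omega
  refine ⟨n, _, hj', X.face ⟨i, by omega⟩ ε y, faceAt_mk ε (by omega) z, ?_⟩
  change X.face _ ε z.1 = _
  rw [hz]
  exact X.face_degen_below ⟨j, hj'⟩ ⟨i, by omega⟩ ε y (Fin.mk_le_mk.2 (by omega))

/-- The coordinate with the number `j` is not fixed by the word. -/
def Word.IsFree (j : ℕ) : Word → Prop
  | [] => True
  | a :: u => if j = u.length then a = none else Word.IsFree j u

theorem Word.isFree_of_length_le {j : ℕ} {u : Word} (h : u.length ≤ j) : u.IsFree j := by
  induction u with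
  | nil => trivial
  | cons a u ih =>
    rw [List.length_cons] at h
    rw [Word.IsFree, if_neg (by omega)]
    exact ih (by omega)

theorem IsComplementary.isFree_or {u v : Word} (h : IsComplementary u v) (j : ℕ) :
    u.IsFree j ∨ v.IsFree j := by
  induction h with
  | nil => exact Or.inl trivial
  | @cons a b u v hab huv ih =>
    have := List.Forall₂.length_eq huv
    by_cases hj : j = u.length
    · simp only [Word.IsFree, hj, ← this, if_true]
      tauto
    · simpa only [Word.IsFree, ← this, hj, if_false] using ih

/-- A face of a degenerate cell, in which the degenerate direction stays free, is degenerate. -/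
theorem IsDegenAt.act {u : Word} {j : ℕ} {x : Σ n, X.LCell n} (hx : IsDegenAt j x)
    (hu : u.length ≤ x.1) (hj : u.IsFree j) : ∃ i, IsDegenAt i (act 0 u x) := by
  induction u generalizing x j with
  | nil => exact ⟨j, hx⟩
  | cons a u ih =>
    rw [List.length_cons] at hu
    rcases a with _ | ε
    · refine ih hx (by omega) ?_
      by_cases h : j = u.length
      · exact Word.isFree_of_length_le h.ge
      · simpa only [Word.IsFree, h, if_false] using hj
    · by_cases h : j = u.length
      · simp [Word.IsFree, h] at hj
      · simp only [Word.IsFree, h, if_false] at hj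
        have h1 := faceAt_fst ε (i := u.length) x (by omega)
        rcases Nat.lt_or_gt_of_ne h with hlt | hlt
        · exact ih (hx.faceAt_above hlt (by omega) ε) (by simp only [add_zero]; omega) hj
        · exact ih (hx.faceAt_below hlt ε) (by simp only [add_zero]; omega)
            (Word.isFree_of_length_le (by omega))

theorem gen_of_isDegenAt {j : ℕ} {x : Σ n, X.LCell n} (hx : IsDegenAt j x) : gen k X x = 0 := by
  obtain ⟨n, z, hj, y, rfl, hz⟩ := hx
  exact gen_degen k X ⟨_, y, hz⟩

/-- On one of the two sides of the diagonal the degenerate direction is free. -/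
theorem evPair_degen {n : ℕ} (x : X.LCell n) (hx : X.IsDegen x) {t : WMod k ⊗[k] WMod k}
    (ht : t ∈ complSpan k n) : evPair k ⟨n, x⟩ t = 0 := by
  cases n with
  | zero => exact hx.elim
  | succ n =>
    obtain ⟨i, y, hy⟩ := hx
    have hd : IsDegenAt (i : ℕ) (⟨n + 1, x⟩ : Σ n, X.LCell n) := ⟨n, x, i.2, y, rfl, hy⟩
    refine eq_of_mem_complSpan (g := 0) (fun u v hu hc => ?_) ht
    rw [evPair, TensorProduct.map_tmul, evW_single, evW_single]
    rcases hc.isFree_or i with h | h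
    · obtain ⟨j, hj⟩ := hd.act hu.le h
      rw [gen_of_isDegenAt hj, TensorProduct.zero_tmul, LinearMap.zero_apply]
    · obtain ⟨j, hj⟩ := hd.act (hc.length_eq ▸ hu.le) h
      rw [gen_of_isDegenAt hj, TensorProduct.tmul_zero, LinearMap.zero_apply]

theorem map2_evPair {Y : CubicalSet.{u}} (f : Hom X Y) (x : Σ n, X.LCell n)
    (t : WMod k ⊗[k] WMod k) : map2 k f (evPair k x t) = evPair k (f.sapp x) t := by
  have h : map1 k f ∘ₗ evW k 0 x = evW k 0 (f.sapp x) := hom_ext_word fun u => by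
    rw [LinearMap.comp_apply, evW_single, evW_single, map1_gen, sapp_act]
  rw [map2, evPair, evPair, ← h, TensorProduct.map_comp]
  rfl

end SerreDiagonal

/-! ### The two halves of the diagonal as natural chain maps -/

section Halves

variable (k : Type v) [CommRing k]

/-- A starting term for one half of the diagonal: a combination of complementary words of length
one whose differential vanishes on the cells of `LX`. -/
structure IsSerreStart (t : WMod k ⊗[k] WMod k) : Prop where
  mem : t ∈ complSpan k 1
  sign : parWW k t = (-1 : k) • t
  closed : ∀ (X : CubicalSet.{u}) (n : ℕ) (x : X.LCell (n + 1)),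
    evPair k ⟨n + 1, x⟩ ((serreStep k)^[n] (dWW k t)) = 0

/-- The start `* ⊗ 1` for the half of the diagonal with the first coordinate on the left. -/
noncomputable def startPrec : WMod k ⊗[k] WMod k :=
  Finsupp.single [none] 1 ⊗ₜ Finsupp.single [some true] 1

/-- The start `0 ⊗ *` for the half of the diagonal with the first coordinate on the right. -/
noncomputable def startSucc : WMod k ⊗[k] WMod k :=
  Finsupp.single [some false] 1 ⊗ₜ Finsupp.single [none] 1

/-- The last letter of a word is the first coordinate, and `d_{1,0} = d_{1,1}` on cells of `LX`. -/
theorem gen_act_last {X : CubicalSet.{u}} {n : ℕ} (x : X.LCell (n + 1)) (ε ω : Bool) (c : Word)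
    (hc : c.length = n) :
    evW k 0 ⟨n + 1, x⟩ (Finsupp.single (c ++ [some ε]) 1) =
      evW k 0 ⟨n + 1, x⟩ (Finsupp.single (c ++ [some ω]) 1) := by
  rw [evW_single, evW_single, act_insert _ _ _ _ _ (by simp [hc]),
    act_insert _ _ _ _ _ (by simp [hc])]
  exact congrArg (fun z => gen k X (act 0 (c ++ []) z)) (faceAt_zero_eq ε ω _)

theorem dWord_star : dWord k 0 [none] =
    Finsupp.single [some true] 1 - Finsupp.single [some false] 1 := by
  simp [dWord]

theorem startPrec_isSerreStart : IsSerreStart.{u} k (startPrec k) where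
  mem := Submodule.subset_span ⟨[none], [some true], rfl, .cons (by simp) .nil, rfl⟩
  sign := by
    rw [startPrec, parWW, TensorProduct.map_tmul, parW_single, parW_single]
    simp only [Word.stars_none, Word.stars_some, Word.stars_nil, zero_add, add_zero, pow_one,
      pow_zero, one_smul, ← TensorProduct.smul_tmul']
  closed X n x := by
    have : dWW k (startPrec k) = Finsupp.single [some true] 1 ⊗ₜ Finsupp.single [some true] 1 -
        Finsupp.single [some false] 1 ⊗ₜ Finsupp.single [some true] 1 := by
      rw [startPrec, dWW, LinearMap.add_apply, TensorProduct.map_tmul, TensorProduct.map_tmul,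
        dW_single, dW_single, dWord_star, TensorProduct.sub_tmul]
      simp [dWord]
    rw [this, ← Module.End.coe_pow, map_sub, map_sub, sub_eq_zero, Module.End.coe_pow]
    exact map_iterate_congr n _ _ _ _ rfl (gen_act_last k x true false) fun c _ => rfl

theorem startSucc_isSerreStart : IsSerreStart.{u} k (startSucc k) where
  mem := Submodule.subset_span ⟨[some false], [none], rfl, .cons (by simp) .nil, rfl⟩
  sign := by
    rw [startSucc, parWW, TensorProduct.map_tmul, parW_single, parW_single]
    simp only [Word.stars_none, Word.stars_some, Word.stars_nil, zero_add, add_zero, pow_one,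
      pow_zero, one_smul, TensorProduct.tmul_smul]
  closed X n x := by
    have : dWW k (startSucc k) = Finsupp.single [some false] 1 ⊗ₜ Finsupp.single [some true] 1 -
        Finsupp.single [some false] 1 ⊗ₜ Finsupp.single [some false] 1 := by
      rw [startSucc, dWW, LinearMap.add_apply, TensorProduct.map_tmul, TensorProduct.map_tmul,
        dW_single, dW_single, dWord_star, TensorProduct.tmul_sub]
      simp [dWord]
    rw [this, ← Module.End.coe_pow, map_sub, map_sub, sub_eq_zero, Module.End.coe_pow]
    exact map_iterate_congr n [some false] [some false] [some true] [some false] rfl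
      (f := evW k 0 ⟨n + 1, x⟩) (g := evW k 0 ⟨n + 1, x⟩)
      (f' := evW k 0 ⟨n + 1, x⟩) (g' := evW k 0 ⟨n + 1, x⟩) (fun c _ => rfl)
      (gen_act_last k x true false)

/-- The value of a half of the diagonal on a cell. -/
noncomputable def serreCell {X : CubicalSet.{u}} (t : WMod k ⊗[k] WMod k) :
    (Σ n, X.LCell n) → CL2 k X
  | ⟨0, _⟩ => 0
  | ⟨n + 1, x⟩ => evPair k ⟨n + 1, x⟩ ((serreStep k)^[n] t)

variable {k}

theorem serreCell_of_fst {X : CubicalSet.{u}} (t : WMod k ⊗[k] WMod k) {n : ℕ}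
    (x : Σ n, X.LCell n) (h : x.1 = n + 1) :
    serreCell k t x = evPair k x ((serreStep k)^[n] t) := by
  obtain ⟨m, x⟩ := x
  obtain rfl : m = n + 1 := h
  rfl

theorem IsSerreStart.serreCell_degen {t : WMod k ⊗[k] WMod k} (ht : IsSerreStart.{u} k t)
    (X : CubicalSet.{u}) (n : ℕ) (x : X.LCell n) (hx : X.IsDegen x) :
    serreCell k t (⟨n, x⟩ : Σ n, X.LCell n) = 0 := by
  cases n with
  | zero => rfl
  | succ n => exact evPair_degen x hx (iterate_mem n ht.mem)

/-- A half of the diagonal, as a linear map. -/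
noncomputable def IsSerreStart.diag {t : WMod k ⊗[k] WMod k} (ht : IsSerreStart.{u} k t)
    (X : CubicalSet.{u}) : CLTot k X →ₗ[k] CL2 k X :=
  liftCL k (serreCell k t) (ht.serreCell_degen X)

theorem IsSerreStart.diag_gen {t : WMod k ⊗[k] WMod k} (ht : IsSerreStart.{u} k t)
    {X : CubicalSet.{u}} (x : Σ n, X.LCell n) : ht.diag X (gen k X x) = serreCell k t x :=
  liftCL_gen k _ _ x

theorem IsSerreStart.diag_mem {t : WMod k ⊗[k] WMod k} (ht : IsSerreStart.{u} k t)
    (X : CubicalSet.{u}) (n : ℕ) (v : CLTot k X) (hv : v ∈ deg1 k X n) :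
    ht.diag X v ∈ deg2 k X n := by
  rw [deg1_eq_span] at hv
  refine (Submodule.span_le (p := (deg2 k X n).comap (ht.diag X))).2 ?_ hv
  rintro _ ⟨x, rfl⟩
  rw [SetLike.mem_coe, Submodule.mem_comap, ht.diag_gen]
  cases n with
  | zero => exact Submodule.zero_mem _
  | succ n => exact evPair_mem ⟨n + 1, x⟩ (iterate_mem n ht.mem)

/-- Fixing the coordinate `i + 1` on both sides of the diagonal gives the diagonal of the face. -/
theorem evPair_iterate_consBoth {X : CubicalSet.{u}} {t : WMod k ⊗[k] WMod k}
    (ht : t ∈ complSpan k 1) {n i : ℕ} (hi : i < n) (ε : Bool) (x : Σ n, X.LCell n)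
    (hx : x.1 = n + 1) :
    evPair k x ((serreStep k)^[n - 1 - i] (consBoth k ε ((serreStep k)^[i] t))) =
      serreCell k t (X.faceAt ε (i + 1) x) := by
  have h1 := faceAt_fst ε (i := i + 1) x (by omega)
  rw [serreCell_of_fst (n := n - 1) t _ (by omega),
    show (serreStep k)^[n - 1] t = (serreStep k)^[n - 1 - i] ((serreStep k)^[i] t) by
      rw [← Function.iterate_add_apply]; congr 1; omega, ← Module.End.coe_pow]
  refine eq_of_mem_complSpan (f := evPair k x ∘ₗ (serreStep k ^ (n - 1 - i)) ∘ₗ consBoth k ε)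
    (g := evPair k (X.faceAt ε (i + 1) x) ∘ₗ (serreStep k ^ (n - 1 - i)))
    (fun u v hu hc => ?_) (iterate_mem i ht)
  have hv := hc.length_eq
  simp only [LinearMap.comp_apply, consBoth, TensorProduct.map_tmul, consW_single,
    Module.End.coe_pow]
  refine map_iterate_congr _ _ _ _ _ (by simp) (fun c hc => ?_) fun c hc => ?_
  · rw [evW_single, evW_single, act_insert _ _ _ _ _ (by omega), hu]
  · rw [evW_single, evW_single, act_insert _ _ _ _ _ (by omega), ← hv, hu]

/-- The boundary of the half of the diagonal is the sum over the coordinates but the first, which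
contributes neither to this boundary nor to the boundary of the cell. -/
theorem IsSerreStart.diag_comm {t : WMod k ⊗[k] WMod k} (ht : IsSerreStart.{u} k t)
    (X : CubicalSet.{u}) : d2 k X ∘ₗ ht.diag X = ht.diag X ∘ₗ dTot k X := by
  refine hom_ext_gen fun x => ?_
  rw [LinearMap.comp_apply, LinearMap.comp_apply, ht.diag_gen, dTot_gen]
  obtain ⟨n, x⟩ := x
  cases n with
  | zero => simp [serreCell]
  | succ n =>
    have hl : d2 k X (serreCell k t ⟨n + 1, x⟩) = ∑ i ∈ Finset.range n, (-1 : k) ^ (i + 1) •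
        (serreCell k t (X.faceAt true (i + 1) ⟨n + 1, x⟩) -
          serreCell k t (X.faceAt false (i + 1) ⟨n + 1, x⟩)) := by
      rw [serreCell_of_fst (n := n) t _ rfl, d2_evPair ⟨n + 1, x⟩ (iterate_mem n ht.mem),
        dWW_iterate k n ht.sign, map_add, ht.closed, zero_add]
      refine (map_sum (evPair k ⟨n + 1, x⟩) _ _).trans (Finset.sum_congr rfl fun i hi => ?_)
      rw [Finset.mem_range] at hi
      rw [map_smul, map_sub, evPair_iterate_consBoth ht.mem hi true _ rfl,
        evPair_iterate_consBoth ht.mem hi false _ rfl]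
    rw [hl, Finset.sum_range_succ', faceAt_zero_eq true false ⟨n + 1, x⟩, sub_self,
      smul_zero, add_zero]
    refine Eq.trans (Finset.sum_congr rfl fun i _ => ?_) (map_sum (ht.diag X) _ _).symm
    rw [map_smul, map_sub, ht.diag_gen, ht.diag_gen]

theorem IsSerreStart.diag_natural {t : WMod k ⊗[k] WMod k} (ht : IsSerreStart.{u} k t)
    {X Y : CubicalSet.{u}} (f : Hom X Y) :
    ht.diag Y ∘ₗ map1 k f = map2 k f ∘ₗ ht.diag X := by
  refine hom_ext_gen fun x => ?_
  rw [LinearMap.comp_apply, LinearMap.comp_apply, map1_gen, ht.diag_gen, ht.diag_gen]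
  obtain ⟨n, x⟩ := x
  cases n with
  | zero => simp [serreCell, Hom.sapp]
  | succ n =>
    rw [serreCell_of_fst (n := n) t _ rfl, serreCell_of_fst (n := n) t _ rfl, map2_evPair]

variable (k)

open Classical in
/-- The projection on the chains of positive degree. -/
noncomputable def posPart (X : CubicalSet.{u}) : CLTot k X →ₗ[k] CLTot k X :=
  liftCL k (fun x => if x.1 = 0 then 0 else gen k X x) fun n x hx => by
    cases n with
    | zero => exact hx.elim
    | succ n => simpa using gen_degen k X hx

variable {k}

theorem posPart_of_mem_zero {X : CubicalSet.{u}} {v : CLTot k X} (hv : v ∈ deg1 k X 0) :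
    posPart k X v = 0 := by
  rw [deg1_eq_span] at hv
  refine (Submodule.span_le (p := LinearMap.ker (posPart k X))).2 ?_ hv
  rintro _ ⟨x, rfl⟩
  rw [SetLike.mem_coe, LinearMap.mem_ker, posPart, liftCL_gen]
  simp

theorem posPart_of_mem_succ {X : CubicalSet.{u}} {n : ℕ} {v : CLTot k X}
    (hv : v ∈ deg1 k X (n + 1)) : posPart k X v = v := by
  rw [deg1_eq_span] at hv
  refine (Submodule.span_le (p := LinearMap.eqLocus (posPart k X) LinearMap.id)).2 ?_ hv
  rintro _ ⟨x, rfl⟩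
  rw [SetLike.mem_coe, LinearMap.mem_eqLocus, posPart, liftCL_gen]
  simp

theorem dTot_of_mem_deg1_one {X : CubicalSet.{u}} {v : CLTot k X} (hv : v ∈ deg1 k X 1) :
    dTot k X v = 0 := by
  rw [deg1_eq_span] at hv
  refine (Submodule.span_le (p := LinearMap.ker (dTot k X))).2 ?_ hv
  rintro _ ⟨x, rfl⟩
  rw [SetLike.mem_coe, LinearMap.mem_ker, dTot_gen]
  simp [faceAt_zero_eq true false]

theorem dTot_posPart {X : CubicalSet.{u}} (v : CLTot k X) :
    dTot k X (posPart k X v) = posPart k X (dTot k X v) := by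
  suffices h : dTot k X ∘ₗ posPart k X = posPart k X ∘ₗ dTot k X from LinearMap.congr_fun h v
  refine hom_ext_deg1 k fun n v hv => ?_
  simp only [LinearMap.comp_apply]
  match n, hv with
  | 0, hv => rw [posPart_of_mem_zero hv, dTot_of_mem_deg1_zero k hv, map_zero, map_zero]
  | 1, hv => rw [posPart_of_mem_succ hv, dTot_of_mem_deg1_one hv, map_zero]
  | n + 2, hv => rw [posPart_of_mem_succ hv, posPart_of_mem_succ (dTot_mem_deg1 k hv)]

theorem posPart_mem {X : CubicalSet.{u}} {n : ℕ} {v : CLTot k X} (hv : v ∈ deg1 k X n) :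
    posPart k X v ∈ deg1 k X n := by
  cases n with
  | zero => rw [posPart_of_mem_zero hv]; exact Submodule.zero_mem _
  | succ n => rwa [posPart_of_mem_succ hv]

theorem posPart_map1 {X Y : CubicalSet.{u}} (f : Hom X Y) (v : CLTot k X) :
    posPart k Y (map1 k f v) = map1 k f (posPart k X v) := by
  suffices h : posPart k Y ∘ₗ map1 k f = map1 k f ∘ₗ posPart k X from LinearMap.congr_fun h v
  refine hom_ext_deg1 k fun n v hv => ?_
  simp only [LinearMap.comp_apply]
  cases n with
  | zero => rw [posPart_of_mem_zero hv, posPart_of_mem_zero (map1_mem_deg1 k f hv), map_zero]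
  | succ n => rw [posPart_of_mem_succ hv, posPart_of_mem_succ (map1_mem_deg1 k f hv)]

variable (k)

theorem map1_pt {X Y : CubicalSet.{u}} (f : Hom X Y) :
    map1 k f (gen k X (pt X)) = gen k Y (pt Y) := map1_gen k f _

theorem pt_mem (X : CubicalSet.{u}) : gen k X (pt X) ∈ deg1 k X 0 := gen_mem_deg1 k X (pt X)

/-- The half of the diagonal with the first coordinate on the left, without its term `x ⊗ ⋆`. -/
noncomputable def serrePrec : NatCoproduct.{u} k where
  app X := (startPrec_isSerreStart k).diag X -
    (TensorProduct.mk k _ _).flip (gen k X (pt X)) ∘ₗ posPart k X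
  app_mem X n v hv := by
    refine Submodule.sub_mem _ (IsSerreStart.diag_mem _ X n v hv) ?_
    exact tmul_mem_tensorDeg (posPart_mem hv) (pt_mem k X) (add_zero n)
  comm X := by
    rw [LinearMap.comp_sub, LinearMap.sub_comp, IsSerreStart.diag_comm]
    congr 1
    refine LinearMap.ext fun v => ?_
    simp [d2, dTot_posPart, dTot_of_mem_deg1_zero k (pt_mem k X)]
  natural X Y f := by
    rw [LinearMap.comp_sub, LinearMap.sub_comp, IsSerreStart.diag_natural]
    congr 1
    refine LinearMap.ext fun v => ?_
    simp [map2, posPart_map1, map1_pt]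

/-- The half of the diagonal with the first coordinate on the right, without its term `⋆ ⊗ x`. -/
noncomputable def serreSucc : NatCoproduct.{u} k where
  app X := (startSucc_isSerreStart k).diag X -
    TensorProduct.mk k _ _ (gen k X (pt X)) ∘ₗ posPart k X
  app_mem X n v hv := by
    refine Submodule.sub_mem _ (IsSerreStart.diag_mem _ X n v hv) ?_
    exact tmul_mem_tensorDeg (pt_mem k X) (posPart_mem hv) (zero_add n)
  comm X := by
    rw [LinearMap.comp_sub, LinearMap.sub_comp, IsSerreStart.diag_comm]
    congr 1
    refine LinearMap.ext fun v => ?_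
    simp [d2, dTot_posPart, dTot_of_mem_deg1_zero k (pt_mem k X),
      parity_of_mem_deg1 k (pt_mem k X)]
  natural X Y f := by
    rw [LinearMap.comp_sub, LinearMap.sub_comp, IsSerreStart.diag_natural]
    congr 1
    refine LinearMap.ext fun v => ?_
    simp [map2, posPart_map1, map1_pt]

end Halves

/-! ### The shuffle formula -/

section Subsets

/-- The sign of the shuffle `σ` of `{0, …, N - 1}` that lists first the elements of `A`. -/
def subsetSign (N : ℕ) (A : Finset ℕ) : ℤ :=
  ∏ a ∈ Finset.range N, ∏ b ∈ Finset.range a, if a ∈ A ∧ b ∉ A then -1 else 1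

/-- The word of length `N` that is free exactly in the coordinates in `A` and `0` elsewhere. -/
def wordL : ℕ → Finset ℕ → Word
  | 0, _ => []
  | n + 1, A => (if n ∈ A then none else some false) :: wordL n A

/-- The word of length `N` that is `1` exactly in the coordinates in `A` and free elsewhere. -/
def wordR : ℕ → Finset ℕ → Word
  | 0, _ => []
  | n + 1, A => (if n ∈ A then some true else none) :: wordR n A

theorem wordL_length (N : ℕ) (A : Finset ℕ) : (wordL N A).length = N := by
  induction N with
  | zero => rfl
  | succ n ih => rw [wordL, List.length_cons, ih]

theorem wordR_length (N : ℕ) (A : Finset ℕ) : (wordR N A).length = N := by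
  induction N with
  | zero => rfl
  | succ n ih => rw [wordR, List.length_cons, ih]

theorem wordL_insert (N m : ℕ) (h : N ≤ m) (A : Finset ℕ) :
    wordL N (insert m A) = wordL N A := by
  induction N with
  | zero => rfl
  | succ n ih =>
    have : n ∈ insert m A ↔ n ∈ A := Finset.mem_insert.trans (or_iff_right (by omega))
    simp only [wordL, this, ih (by omega)]

theorem wordR_insert (N m : ℕ) (h : N ≤ m) (A : Finset ℕ) :
    wordR N (insert m A) = wordR N A := by
  induction N with
  | zero => rfl
  | succ n ih =>
    have : n ∈ insert m A ↔ n ∈ A := Finset.mem_insert.trans (or_iff_right (by omega))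
    simp only [wordR, this, ih (by omega)]

theorem subsetSign_insert (N m : ℕ) (h : N ≤ m) (A : Finset ℕ) :
    subsetSign N (insert m A) = subsetSign N A := by
  refine Finset.prod_congr rfl fun a ha => Finset.prod_congr rfl fun b hb => ?_
  rw [Finset.mem_range] at ha hb
  have h1 : a ∈ insert m A ↔ a ∈ A := Finset.mem_insert.trans (or_iff_right (by omega))
  have h2 : b ∈ insert m A ↔ b ∈ A := Finset.mem_insert.trans (or_iff_right (by omega))
  simp only [h1, h2]

theorem prod_notMem (N : ℕ) (A : Finset ℕ) :
    ∏ b ∈ Finset.range N, (if b ∉ A then (-1 : ℤ) else 1) = (-1) ^ (wordR N A).stars := by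
  induction N with
  | zero => rfl
  | succ n ih =>
    rw [Finset.prod_range_succ, ih, wordR]
    by_cases h : n ∈ A <;> simp [h, pow_succ]

theorem subsetSign_succ (N : ℕ) (A : Finset ℕ) :
    subsetSign (N + 1) A = subsetSign N A * if N ∈ A then (-1) ^ (wordR N A).stars else 1 := by
  rw [subsetSign, Finset.prod_range_succ, subsetSign]
  congr 1
  by_cases h : N ∈ A
  · simp only [h, true_and, if_true, prod_notMem]
  · simp [h]

variable {X : CubicalSet.{u}}

theorem faces_append (ε : Bool) (l l' : List ℕ) (x : Σ n, X.LCell n) :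
    X.faces ε (l ++ l') x = X.faces ε l (X.faces ε l' x) := by
  rw [faces, List.foldr_append]; rfl

theorem act_wordL (N : ℕ) (A : Finset ℕ) (x : Σ n, X.LCell n) :
    act 0 (wordL N A) x = X.faces false ((List.range N).filter (· ∉ A)) x := by
  induction N generalizing x with
  | zero => rfl
  | succ n ih =>
    rw [wordL, List.range_succ, List.filter_append, faces_append]
    by_cases h : n ∈ A
    · simp [h, ih, faces]
    · simp [h, ih, faces, wordL_length]

theorem act_wordR (N : ℕ) (A : Finset ℕ) (x : Σ n, X.LCell n) :
    act 0 (wordR N A) x = X.faces true ((List.range N).filter (· ∈ A)) x := by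
  induction N generalizing x with
  | zero => rfl
  | succ n ih =>
    rw [wordR, List.range_succ, List.filter_append, faces_append]
    by_cases h : n ∈ A
    · simp [h, ih, faces, wordR_length]
    · simp [h, ih, faces]

theorem faces_fst (ε : Bool) (N : ℕ) (p : ℕ → Prop) [DecidablePred p] (x : Σ n, X.LCell n)
    (h : N ≤ x.1) :
    (X.faces ε ((List.range N).filter (p ·)) x).1 + ((List.range N).filter (p ·)).length = x.1 := by
  induction N generalizing x with
  | zero => rfl
  | succ n ih =>
    rw [List.range_succ, List.filter_append, faces_append]
    by_cases hp : p n
    · have h1 := faceAt_fst ε (i := n) x (by omega)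
      have h2 := ih (X.faceAt ε n x) (by omega)
      simp [hp, faces] at h2 ⊢
      omega
    · simpa [hp, faces] using ih x (by omega)

variable (k : Type v) [CommRing k]

/-- The term of the diagonal of the cube that belongs to the set `A` of the coordinates that are
free on the left. -/
noncomputable def wordTerm (N : ℕ) (A : Finset ℕ) : WMod k ⊗[k] WMod k :=
  (subsetSign N A : k) • (Finsupp.single (wordL N A) 1 ⊗ₜ Finsupp.single (wordR N A) 1)

theorem serreStep_wordTerm (N : ℕ) (A : Finset ℕ) (hA : A ⊆ Finset.range N) :
    serreStep k (wordTerm k N A) = wordTerm k (N + 1) A + wordTerm k (N + 1) (insert N A) := by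
  have hN : N ∉ A := fun h => by simpa using hA h
  rw [wordTerm, map_smul, serreStep_single, wordTerm, wordTerm, subsetSign_succ, subsetSign_succ,
    subsetSign_insert N N le_rfl, wordR_insert N N le_rfl]
  simp only [wordL, wordR, hN, if_false, Finset.mem_insert_self, if_true, mul_one,
    wordL_insert N N le_rfl, wordR_insert N N le_rfl, smul_add, smul_smul]
  push_cast
  rw [add_comm]

/-- The iterated diagonal is the sum over all sets of coordinates that contain the first one, or
over all those that do not, depending on the start. -/
theorem iterate_eq_sum (c : Prop) [Decidable c] {t : WMod k ⊗[k] WMod k}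
    (ht : t = if c then wordTerm k 1 {0} else wordTerm k 1 ∅) (n : ℕ) :
    (serreStep k)^[n] t = ∑ A ∈ (Finset.range (n + 1)).powerset,
      if (0 ∈ A ↔ c) then wordTerm k (n + 1) A else 0 := by
  induction n with
  | zero =>
    rw [Function.iterate_zero, id, ht, Finset.range_one,
      show ({0} : Finset ℕ).powerset = {∅, {0}} from rfl,
      Finset.sum_pair (Finset.singleton_ne_empty 0).symm]
    by_cases hc : c <;> simp [hc]
  | succ n ih =>
    rw [Function.iterate_succ_apply', ih, Finset.range_add_one (n := n + 1),
      Finset.sum_powerset_insert Finset.notMem_range_self, ← Finset.sum_add_distrib]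
    refine (map_sum (serreStep k) _ _).trans (Finset.sum_congr rfl fun A hA => ?_)
    have h0 : 0 ∈ insert (n + 1) A ↔ 0 ∈ A := by simp
    simp only [h0]
    split_ifs
    · exact serreStep_wordTerm k (n + 1) A (Finset.mem_powerset.1 hA)
    · rw [map_zero, add_zero]

/-- The shuffle term that belongs to the set `A = {σ(1), …, σ(p)}`. -/
noncomputable def subsetTerm (x : Σ n, X.LCell n) (N : ℕ) (A : Finset ℕ) : CL2 k X :=
  (subsetSign N A : k) • (gen k X (X.faces false ((List.range N).filter (· ∉ A)) x) ⊗ₜ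
    gen k X (X.faces true ((List.range N).filter (· ∈ A)) x))

theorem evPair_wordTerm (x : Σ n, X.LCell n) (N : ℕ) (A : Finset ℕ) :
    evPair k x (wordTerm k N A) = subsetTerm k x N A := by
  rw [wordTerm, map_smul, evPair, TensorProduct.map_tmul, evW_single, evW_single, act_wordL,
    act_wordR, subsetTerm]

theorem serreCell_eq_sum (c : Prop) [Decidable c] {t : WMod k ⊗[k] WMod k}
    (ht : t = if c then wordTerm k 1 {0} else wordTerm k 1 ∅) {n : ℕ} (x : X.LCell (n + 1)) :
    serreCell k t ⟨n + 1, x⟩ = ∑ A ∈ (Finset.range (n + 1)).powerset,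
      if (0 ∈ A ↔ c) then subsetTerm k ⟨n + 1, x⟩ (n + 1) A else 0 := by
  rw [serreCell, iterate_eq_sum k c ht]
  refine (map_sum (evPair k _) _ _).trans (Finset.sum_congr rfl fun A hA => ?_)
  split_ifs
  · exact evPair_wordTerm k _ _ _
  · exact map_zero _

end Subsets

section Shuffles

variable {p q : ℕ}

/-- The set `{σ(1), …, σ(p)}`. -/
def shuffleSet (p q : ℕ) (σ : Equiv.Perm (Fin (p + q))) : Finset ℕ :=
  (Finset.univ : Finset (Fin p)).image fun i => (σ (Fin.castAdd q i) : ℕ)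

theorem mem_shuffleSet_castAdd (σ : Equiv.Perm (Fin (p + q))) (i : Fin p) :
    (σ (Fin.castAdd q i) : ℕ) ∈ shuffleSet p q σ :=
  Finset.mem_image_of_mem _ (Finset.mem_univ i)

theorem notMem_shuffleSet_natAdd (σ : Equiv.Perm (Fin (p + q))) (j : Fin q) :
    (σ (Fin.natAdd p j) : ℕ) ∉ shuffleSet p q σ := by
  intro h
  obtain ⟨i, -, hi⟩ := Finset.mem_image.1 h
  have := congrArg Fin.val (σ.injective (Fin.ext hi))
  simp at this
  omega

theorem shuffleSet_mem_powersetCard (σ : Equiv.Perm (Fin (p + q))) :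
    shuffleSet p q σ ∈ Finset.powersetCard p (Finset.range (p + q)) := by
  rw [Finset.mem_powersetCard]
  constructor
  · intro a ha
    obtain ⟨i, -, rfl⟩ := Finset.mem_image.1 ha
    simp
  · rw [shuffleSet, Finset.card_image_of_injective, Finset.card_univ, Fintype.card_fin]
    intro i j hij
    simpa using σ.injective (Fin.ext hij)

theorem IsShuffle.ofFn_castAdd {σ : Equiv.Perm (Fin (p + q))} (h : IsShuffle p q σ) :
    (List.ofFn fun i : Fin p => (σ (Fin.castAdd q i) : ℕ)) =
      (List.range (p + q)).filter (· ∈ shuffleSet p q σ) := by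
  refine List.SortedLT.eq_of_mem_iff (List.sortedLT_ofFn_iff.2 fun i j hij => h.1 i j hij)
    ((List.pairwise_lt_range.filter _).sortedLT) fun a => ?_
  rw [List.mem_ofFn, List.mem_filter, List.mem_range, decide_eq_true_eq]
  constructor
  · rintro ⟨i, rfl⟩
    exact ⟨(σ _).2, mem_shuffleSet_castAdd σ i⟩
  · rintro ⟨-, ha⟩
    obtain ⟨i, -, rfl⟩ := Finset.mem_image.1 ha
    exact ⟨i, rfl⟩

theorem IsShuffle.ofFn_natAdd {σ : Equiv.Perm (Fin (p + q))} (h : IsShuffle p q σ) :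
    (List.ofFn fun j : Fin q => (σ (Fin.natAdd p j) : ℕ)) =
      (List.range (p + q)).filter (· ∉ shuffleSet p q σ) := by
  refine List.SortedLT.eq_of_mem_iff (List.sortedLT_ofFn_iff.2 fun i j hij => h.2 i j hij)
    ((List.pairwise_lt_range.filter _).sortedLT) fun a => ?_
  rw [List.mem_ofFn, List.mem_filter, List.mem_range, decide_eq_true_eq]
  constructor
  · rintro ⟨i, rfl⟩
    exact ⟨(σ _).2, notMem_shuffleSet_natAdd σ i⟩
  · rintro ⟨ha, ha'⟩
    obtain ⟨b, hb⟩ := σ.surjective ⟨a, ha⟩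
    refine Fin.addCases (fun i hi => ?_) (fun j hj => ?_) b hb
    · exact absurd (by simpa [hi] using mem_shuffleSet_castAdd σ i) ha'
    · exact ⟨j, by rw [hj]⟩

theorem IsShuffle.eq_of_shuffleSet_eq {σ ρ : Equiv.Perm (Fin (p + q))} (hσ : IsShuffle p q σ)
    (hρ : IsShuffle p q ρ) (h : shuffleSet p q σ = shuffleSet p q ρ) : σ = ρ := by
  have h1 := List.ofFn_injective ((hσ.ofFn_castAdd.trans (by rw [h])).trans hρ.ofFn_castAdd.symm)
  have h2 := List.ofFn_injective ((hσ.ofFn_natAdd.trans (by rw [h])).trans hρ.ofFn_natAdd.symm)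
  refine Equiv.ext fun b => Fin.addCases (fun i => ?_) (fun j => ?_) b
  · exact Fin.ext (congrFun h1 i)
  · exact Fin.ext (congrFun h2 j)

theorem exists_isShuffle {A : Finset ℕ} (hA : A ∈ Finset.powersetCard p (Finset.range (p + q))) :
    ∃ σ, IsShuffle p q σ ∧ shuffleSet p q σ = A := by
  rw [Finset.mem_powersetCard] at hA
  have hlt : ∀ a ∈ A, a < p + q := fun a ha => Finset.mem_range.1 (hA.1 ha)
  set s : Finset (Fin (p + q)) := Finset.univ.filter fun a => (a : ℕ) ∈ A with hs
  have hsA : s.map Fin.valEmbedding = A := by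
    ext a
    simp only [hs, Finset.mem_map, Finset.mem_filter, Finset.mem_univ, true_and,
      Fin.valEmbedding_apply]
    exact ⟨fun ⟨b, hb, h⟩ => h ▸ hb, fun h => ⟨⟨a, hlt a h⟩, h, rfl⟩⟩
  have h1 : s.card = p := (Finset.card_map Fin.valEmbedding).symm.trans (by rw [hsA, hA.2])
  have h2 : sᶜ.card = q := by rw [Finset.card_compl, h1, Fintype.card_fin]; omega
  refine ⟨finSumFinEquiv.symm.trans (finSumEquivOfFinset h1 h2), ⟨fun i j hij => ?_,
    fun i j hij => ?_⟩, ?_⟩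
  · simpa using hij
  · simpa using hij
  · refine Finset.eq_of_subset_of_card_le (fun a ha => ?_) ?_
    · obtain ⟨i, -, rfl⟩ := Finset.mem_image.1 ha
      have : s.orderEmbOfFin h1 i ∈ s := Finset.orderEmbOfFin_mem s h1 i
      simpa using (Finset.mem_filter.1 this).2
    · rw [hA.2, (Finset.mem_powersetCard.1 (shuffleSet_mem_powersetCard _)).2]

/-- Both sides count the pairs `a < b` that `σ⁻¹` inverts, which are those with `b` in the first
and `a` in the second block of the shuffle. -/
theorem IsShuffle.sign_eq {σ : Equiv.Perm (Fin (p + q))} (h : IsShuffle p q σ) :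
    (Equiv.Perm.sign σ : ℤ) = subsetSign (p + q) (shuffleSet p q σ) := by
  rw [← Equiv.Perm.sign_inv, Equiv.Perm.sign_eq_prod_prod_Iio, subsetSign, Finset.prod_range,
    Units.coe_prod]
  refine Finset.prod_congr rfl fun b _ => ?_
  rw [Units.coe_prod, ← Nat.Iio_eq_range, ← Fin.map_valEmbedding_Iio, Finset.prod_map]
  refine Finset.prod_congr rfl fun a ha => ?_
  rw [Finset.mem_Iio] at ha
  have key : σ⁻¹ a < σ⁻¹ b ↔ ¬ ((b : ℕ) ∈ shuffleSet p q σ ∧ (a : ℕ) ∉ shuffleSet p q σ) := by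
    obtain ⟨a, rfl⟩ := σ.surjective a
    obtain ⟨b, rfl⟩ := σ.surjective b
    have hm1 : StrictMono fun i => σ (Fin.castAdd q i) := fun i j => h.1 i j
    have hm2 : StrictMono fun i => σ (Fin.natAdd p i) := fun i j => h.2 i j
    change σ.symm (σ a) < σ.symm (σ b) ↔ _
    rw [Equiv.symm_apply_apply, Equiv.symm_apply_apply]
    refine Fin.addCases (fun i hi => ?_) (fun i hi => ?_) a ha <;>
    refine Fin.addCases (fun j hj => ?_) (fun j hj => ?_) b hi
    · have := hm1.lt_iff_lt.1 hj
      simp only [mem_shuffleSet_castAdd, not_true_eq_false, and_false, not_false_eq_true, iff_true]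
      exact this
    · simp only [notMem_shuffleSet_natAdd, false_and, not_false_eq_true, iff_true]
      simp [Fin.lt_def]; omega
    · simp only [mem_shuffleSet_castAdd, notMem_shuffleSet_natAdd, not_false_eq_true, and_self,
        not_true_eq_false, iff_false]
      simp [Fin.lt_def]; omega
    · have := hm2.lt_iff_lt.1 hj
      simp only [notMem_shuffleSet_natAdd, false_and, not_false_eq_true, iff_true]
      simpa using this
  simp only [key, Fin.valEmbedding_apply, ite_not]
  split_ifs <;> rfl

theorem isShuffleLeft_iff (hp : 1 ≤ p) (σ : Equiv.Perm (Fin (p + q))) :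
    IsShuffleLeft p q σ ↔ IsShuffle p q σ ∧ (0 ∈ shuffleSet p q σ ↔ True) := by
  refine and_congr_right fun h => ?_
  rw [iff_true]
  constructor
  · intro h0
    have := mem_shuffleSet_castAdd σ ⟨0, hp⟩
    rwa [h0 _ rfl] at this
  · intro h0 j hj
    obtain ⟨i, -, hi⟩ := Finset.mem_image.1 h0
    have hm : StrictMono fun i => σ (Fin.castAdd q i) := fun i j => h.1 i j
    have hle : σ (Fin.castAdd q ⟨0, hp⟩) ≤ σ (Fin.castAdd q i) :=
      hm.monotone (Fin.mk_le_mk.2 (Nat.zero_le _))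
    obtain rfl : j = Fin.castAdd q ⟨0, hp⟩ := Fin.ext hj
    rw [Fin.le_def, hi] at hle
    omega

theorem isShuffleRight_iff (hq : 1 ≤ q) (σ : Equiv.Perm (Fin (p + q))) :
    IsShuffleRight p q σ ↔ IsShuffle p q σ ∧ (0 ∈ shuffleSet p q σ ↔ False) := by
  refine and_congr_right fun h => ?_
  rw [iff_false]
  constructor
  · intro h0
    have := notMem_shuffleSet_natAdd σ ⟨0, hq⟩
    rwa [h0 _ rfl] at this
  · intro h0 j hj
    obtain ⟨b, hb⟩ := σ.surjective ⟨0, by omega⟩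
    have hm : StrictMono fun i => σ (Fin.natAdd p i) := fun i j => h.2 i j
    obtain rfl : j = Fin.natAdd p ⟨0, hq⟩ := Fin.ext hj
    refine Fin.addCases (fun i hi => ?_) (fun i hi => ?_) b hb
    · exact absurd (by simpa [hi] using mem_shuffleSet_castAdd σ i) h0
    · have hle : σ (Fin.natAdd p ⟨0, hq⟩) ≤ σ (Fin.natAdd p i) :=
        hm.monotone (Fin.mk_le_mk.2 (Nat.zero_le _))
      rw [Fin.le_def, hi] at hle
      exact Nat.le_zero.1 hle

variable (k : Type v) [CommRing k] {X : CubicalSet.{u}}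

theorem IsShuffle.shuffleTerm_eq {σ : Equiv.Perm (Fin (p + q))} (h : IsShuffle p q σ)
    (x : Σ n, X.LCell n) :
    shuffleTerm k X x p q σ = subsetTerm k x (p + q) (shuffleSet p q σ) := by
  rw [shuffleTerm, subsetTerm, h.sign_eq, h.ofFn_castAdd, h.ofFn_natAdd]

open Classical in
theorem sum_shuffleTerm (c : Prop) [Decidable c] (p q : ℕ) (x : Σ n, X.LCell n) :
    (∑ σ : Equiv.Perm (Fin (p + q)) with
      (IsShuffle p q σ ∧ (0 ∈ shuffleSet p q σ ↔ c)), shuffleTerm k X x p q σ) =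
      ∑ A ∈ Finset.powersetCard p (Finset.range (p + q)),
        if (0 ∈ A ↔ c) then subsetTerm k x (p + q) A else 0 := by
  rw [← Finset.sum_filter]
  refine Finset.sum_bij (fun σ _ => shuffleSet p q σ) (fun σ hσ => ?_) (fun σ hσ ρ hρ h => ?_)
    (fun A hA => ?_) fun σ hσ => ?_
  · exact Finset.mem_filter.2 ⟨shuffleSet_mem_powersetCard σ, (Finset.mem_filter.1 hσ).2.2⟩
  · exact (Finset.mem_filter.1 hσ).2.1.eq_of_shuffleSet_eq (Finset.mem_filter.1 hρ).2.1 h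
  · obtain ⟨hA, hc⟩ := Finset.mem_filter.1 hA
    obtain ⟨σ, hσ, rfl⟩ := exists_isShuffle hA
    exact ⟨σ, Finset.mem_filter.2 ⟨Finset.mem_univ σ, hσ, hc⟩, rfl⟩
  · exact (Finset.mem_filter.1 hσ).2.1.shuffleTerm_eq k x

theorem sum_antidiagonal_subsetTerm (c : Prop) [Decidable c] (N : ℕ) (x : Σ n, X.LCell n) :
    (∑ p ∈ (Finset.HasAntidiagonal.antidiagonal N).filter (fun p => 1 ≤ p.1 ∧ 1 ≤ p.2),
      ∑ A ∈ Finset.powersetCard p.1 (Finset.range (p.1 + p.2)),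
        if (0 ∈ A ↔ c) then subsetTerm k x (p.1 + p.2) A else 0) =
      ∑ A ∈ (Finset.range N).powerset, if (0 ∈ A ↔ c) ∧ 1 ≤ A.card ∧ A.card < N
        then subsetTerm k x N A else 0 := by
  rw [Finset.sum_powerset, Finset.card_range, Finset.sum_filter,
    Finset.Nat.sum_antidiagonal_eq_sum_range_succ_mk]
  refine Finset.sum_congr rfl fun i hi => ?_
  rw [Finset.mem_range] at hi
  rw [show i + (N - i) = N by omega]
  split_ifs with h
  · refine Finset.sum_congr rfl fun A hA => ?_
    rw [(Finset.mem_powersetCard.1 hA).2]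
    have : i < N := by omega
    simp only [h.1, this, and_self, and_true]
  · refine (Finset.sum_eq_zero fun A hA => ?_).symm
    rw [(Finset.mem_powersetCard.1 hA).2, if_neg]
    omega

theorem subsetTerm_range {n : ℕ} (x : X.LCell n) :
    subsetTerm k ⟨n, x⟩ n (Finset.range n) = gen k X ⟨n, x⟩ ⊗ₜ gen k X (pt X) := by
  have h1 : subsetSign n (Finset.range n) = 1 := by
    refine Finset.prod_eq_one fun a ha => Finset.prod_eq_one fun b hb => if_neg ?_
    rw [Finset.mem_range] at *
    simp only [Finset.mem_range]; omega
  have h2 : (List.range n).filter (· ∉ Finset.range n) = [] := by simp [List.filter_eq_nil_iff]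
  have h3 := faces_fst true n (· ∈ Finset.range n) (X := X) ⟨n, x⟩ le_rfl
  have h4 : ((List.range n).filter (· ∈ Finset.range n)).length = n := by
    rw [List.filter_eq_self.2 (by simp), List.length_range]
  rw [subsetTerm, h1, h2, eq_pt (X.faces true _ ⟨n, x⟩) (by dsimp only at h3 ⊢; omega),
    Int.cast_one, one_smul]
  rfl

theorem subsetTerm_empty {n : ℕ} (x : X.LCell n) :
    subsetTerm k ⟨n, x⟩ n ∅ = gen k X (pt X) ⊗ₜ gen k X ⟨n, x⟩ := by
  have h1 : subsetSign n ∅ = 1 :=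
    Finset.prod_eq_one fun a ha => Finset.prod_eq_one fun b hb => if_neg (by simp)
  have h2 : (List.range n).filter (· ∈ (∅ : Finset ℕ)) = [] := by simp
  have h3 := faces_fst false n (· ∉ (∅ : Finset ℕ)) (X := X) ⟨n, x⟩ le_rfl
  have h4 : ((List.range n).filter (· ∉ (∅ : Finset ℕ))).length = n := by
    rw [List.filter_eq_self.2 (by simp), List.length_range]
  rw [subsetTerm, h1, h2, eq_pt (X.faces false _ ⟨n, x⟩) (by dsimp only at h3 ⊢; omega),
    Int.cast_one, one_smul]
  rfl

theorem startPrec_eq : startPrec k = wordTerm k 1 {0} := by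
  simp [startPrec, wordTerm, wordL, wordR, subsetSign]

theorem startSucc_eq : startSucc k = wordTerm k 1 ∅ := by
  simp [startSucc, wordTerm, wordL, wordR, subsetSign]

theorem posPart_gen_succ {n : ℕ} (x : X.LCell (n + 1)) :
    posPart k X (gen k X ⟨n + 1, x⟩) = gen k X ⟨n + 1, x⟩ :=
  posPart_of_mem_succ (gen_mem_deg1 k X ⟨n + 1, x⟩)

theorem precFormula_eq (x : Σ n, X.LCell n) :
    precFormula k X x = ∑ A ∈ (Finset.range x.1).powerset,
      if (0 ∈ A ↔ True) ∧ 1 ≤ A.card ∧ A.card < x.1 then subsetTerm k x x.1 A else 0 := by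
  classical
  rw [precFormula, ← sum_antidiagonal_subsetTerm]
  refine Finset.sum_congr rfl fun p hp => ?_
  rw [← sum_shuffleTerm]
  refine Finset.sum_congr (Finset.filter_congr fun σ _ => ?_) fun _ _ => rfl
  exact isShuffleLeft_iff (Finset.mem_filter.1 hp).2.1 σ

theorem succFormula_eq (x : Σ n, X.LCell n) :
    succFormula k X x = ∑ A ∈ (Finset.range x.1).powerset,
      if (0 ∈ A ↔ False) ∧ 1 ≤ A.card ∧ A.card < x.1 then subsetTerm k x x.1 A else 0 := by
  classical
  rw [succFormula, ← sum_antidiagonal_subsetTerm]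
  refine Finset.sum_congr rfl fun p hp => ?_
  rw [← sum_shuffleTerm]
  refine Finset.sum_congr (Finset.filter_congr fun σ _ => ?_) fun _ _ => rfl
  exact isShuffleRight_iff (Finset.mem_filter.1 hp).2.2 σ

/-- The set of all coordinates gives the term `x ⊗ ⋆`, which is not part of the shuffle formula and
is subtracted in the definition of `serrePrec`. -/
theorem serrePrec_gen (x : Σ n, X.LCell n) :
    (serrePrec.{u} k).app X (gen k X x) = precFormula k X x := by
  classical
  obtain ⟨n, x⟩ := x
  rw [precFormula_eq]
  change IsSerreStart.diag _ X (gen k X ⟨n, x⟩) - posPart k X (gen k X ⟨n, x⟩) ⊗ₜ _ = _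
  rw [IsSerreStart.diag_gen]
  cases n with
  | zero => simp [serreCell, posPart_of_mem_zero (gen_mem_deg1 k X ⟨0, x⟩)]
  | succ n =>
    rw [serreCell_eq_sum k True (by rw [if_pos trivial, startPrec_eq]), posPart_gen_succ,
      ← subsetTerm_range, sub_eq_iff_eq_add]
    have hr : Finset.range (n + 1) ∈ (Finset.range (n + 1)).powerset :=
      Finset.mem_powerset_self _
    rw [← Finset.sum_ite_eq_of_mem' (Finset.range (n + 1)).powerset (Finset.range (n + 1))
      (fun A => subsetTerm k ⟨n + 1, x⟩ (n + 1) A) hr, ← Finset.sum_add_distrib]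
    refine Finset.sum_congr rfl fun A hA => ?_
    rw [Finset.mem_powerset] at hA
    have hle : A.card ≤ n + 1 := by simpa using Finset.card_le_card hA
    by_cases hAr : A = Finset.range (n + 1)
    · subst hAr
      simp
    · have hlt : A.card < n + 1 := by
        simpa using Finset.card_lt_card (Finset.ssubset_iff_subset_ne.2 ⟨hA, hAr⟩)
      by_cases h0 : 0 ∈ A
      · have : 1 ≤ A.card := Finset.card_pos.2 ⟨0, h0⟩
        simp [h0, hAr, hlt, this]
      · simp [h0, hAr]

/-- The empty set of coordinates gives the term `⋆ ⊗ x`, which is not part of the shuffle formula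
and is subtracted in the definition of `serreSucc`. -/
theorem serreSucc_gen (x : Σ n, X.LCell n) :
    (serreSucc.{u} k).app X (gen k X x) = succFormula k X x := by
  classical
  obtain ⟨n, x⟩ := x
  rw [succFormula_eq]
  change IsSerreStart.diag _ X (gen k X ⟨n, x⟩) - _ ⊗ₜ posPart k X (gen k X ⟨n, x⟩) = _
  rw [IsSerreStart.diag_gen]
  cases n with
  | zero => simp [serreCell, posPart_of_mem_zero (gen_mem_deg1 k X ⟨0, x⟩)]
  | succ n =>
    rw [serreCell_eq_sum k False (by rw [if_neg id, startSucc_eq]), posPart_gen_succ,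
      ← subsetTerm_empty, sub_eq_iff_eq_add]
    have hr : (∅ : Finset ℕ) ∈ (Finset.range (n + 1)).powerset := Finset.empty_mem_powerset _
    rw [← Finset.sum_ite_eq_of_mem' (Finset.range (n + 1)).powerset ∅
      (fun A => subsetTerm k ⟨n + 1, x⟩ (n + 1) A) hr, ← Finset.sum_add_distrib]
    refine Finset.sum_congr rfl fun A hA => ?_
    rw [Finset.mem_powerset] at hA
    by_cases hAr : A = ∅
    · subst hAr
      simp
    · have hpos : 1 ≤ A.card := Finset.card_pos.2 (Finset.nonempty_iff_ne_empty.2 hAr)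
      by_cases h0 : 0 ∈ A
      · simp [h0, hAr]
      · have hlt : A.card < n + 1 := by
          have : A ⊂ Finset.range (n + 1) :=
            (Finset.ssubset_iff_of_subset hA).2 ⟨0, by simp, h0⟩
          simpa using Finset.card_lt_card this
        simp [h0, hAr, hlt, hpos]

end Shuffles

end CubicalSet

/-! ### Chain maps and homotopies into tensor products -/

theorem gradedComm_tmul_of_mem {k : Type*} [CommRing k] {A : ℕ → Type*} [∀ n, AddCommGroup (A n)]
    [∀ n, Module k (A n)] {p q : ℕ} {v w : ⨁ n, A n} (hv : v ∈ sumDeg k A p)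
    (hw : w ∈ sumDeg k A q) :
    TensorProduct.gradedComm k A A (v ⊗ₜ w) = (-1 : k) ^ (p * q) • (w ⊗ₜ[k] v) := by
  obtain ⟨v, rfl⟩ := hv
  obtain ⟨w, rfl⟩ := hw
  rw [TensorProduct.gradedComm_of_tmul_of, mul_comm q p]
  rcases neg_one_pow_eq_or ℤˣ (p * q) with h | h
  · have h' : (-1 : k) ^ (p * q) = 1 := by simpa using congrArg (fun u : ℤˣ => ((u : ℤ) : k)) h
    rw [h, h', one_smul, one_smul]
  · have h' : (-1 : k) ^ (p * q) = -1 := by simpa using congrArg (fun u : ℤˣ => ((u : ℤ) : k)) h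
    rw [h, h', Units.neg_smul, one_smul]
    exact (neg_one_smul k _).symm

section Homotopy

variable {k V W : Type*} [CommRing k] [AddCommGroup V] [Module k V] [AddCommGroup W] [Module k W]
  {e : V →ₗ[k] V} {d : W →ₗ[k] W} {h h' F F' G G' : V →ₗ[k] W}

theorem homotopy_neg (H : d ∘ₗ h + h ∘ₗ e = G - F) : d ∘ₗ (-h) + (-h) ∘ₗ e = F - G := by
  rw [LinearMap.comp_neg, LinearMap.neg_comp, ← neg_add, H, neg_sub]

theorem homotopy_add (H : d ∘ₗ h + h ∘ₗ e = G - F) (H' : d ∘ₗ h' + h' ∘ₗ e = G' - F') :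
    d ∘ₗ (h + h') + (h + h') ∘ₗ e = G + G' - (F + F') := by
  rw [LinearMap.comp_add, LinearMap.add_comp, add_add_add_comm, H, H', add_sub_add_comm]

theorem homotopy_trans (H : d ∘ₗ h + h ∘ₗ e = G - F) (H' : d ∘ₗ h' + h' ∘ₗ e = G' - G) :
    d ∘ₗ (h + h') + (h + h') ∘ₗ e = G' - F := by
  rw [homotopy_add H H', add_comm G, add_sub_add_right_eq_sub]

end Homotopy

namespace CubicalSet

section TensorMaps

variable {k : Type v} [CommRing k] {X : CubicalSet.{u}}

theorem twist_tmul {p q : ℕ} {v w : CLTot k X} (hv : v ∈ deg1 k X p) (hw : w ∈ deg1 k X q) :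
    twist k X (v ⊗ₜ w) = (-1 : k) ^ (p * q) • (w ⊗ₜ[k] v) := gradedComm_tmul_of_mem hv hw

/-- Linear maps on the tensor square agree if they agree on the products of homogeneous elements. -/
theorem hom_ext_deg2 {M : Type*} [AddCommGroup M] [Module k M] {f g : CL2 k X →ₗ[k] M}
    (h : ∀ p q, ∀ v ∈ deg1 k X p, ∀ w ∈ deg1 k X q, f (v ⊗ₜ w) = g (v ⊗ₜ w)) : f = g :=
  TensorProduct.ext (hom_ext_deg1 k fun p v hv => hom_ext_deg1 k fun q w hw => h p q v hv w hw)

theorem d2_tmul {p : ℕ} {v : CLTot k X} (hv : v ∈ deg1 k X p) (w : CLTot k X) :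
    d2 k X (v ⊗ₜ w) = dTot k X v ⊗ₜ w + (-1 : k) ^ p • (v ⊗ₜ dTot k X w) := by
  rw [d2, LinearMap.add_apply, TensorProduct.map_tmul, TensorProduct.map_tmul, LinearMap.id_apply,
    parity_of_mem_deg1 k hv, TensorProduct.smul_tmul']

theorem d2_comp_twist : d2 k X ∘ₗ twist k X = twist k X ∘ₗ d2 k X := by
  refine hom_ext_deg2 fun p q v hv w hw => ?_
  rw [LinearMap.comp_apply, LinearMap.comp_apply, twist_tmul hv hw, map_smul, d2_tmul hw,
    d2_tmul hv, map_add, map_smul]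
  have h1 : twist k X (dTot k X v ⊗ₜ w) =
      ((-1 : k) ^ (p * q) * (-1) ^ q) • (w ⊗ₜ[k] dTot k X v) := by
    cases p with
    | zero => simp [dTot_of_mem_deg1_zero k hv]
    | succ p =>
      rw [twist_tmul (dTot_mem_deg1 k hv) hw, add_mul, one_mul, pow_add, mul_assoc, ← pow_add,
        Even.neg_one_pow ⟨q, rfl⟩, mul_one]
  have h2 : twist k X (v ⊗ₜ dTot k X w) =
      ((-1 : k) ^ (p * q) * (-1) ^ p) • (dTot k X w ⊗ₜ[k] v) := by
    cases q with
    | zero => simp [dTot_of_mem_deg1_zero k hw]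
    | succ q =>
      rw [twist_tmul hv (dTot_mem_deg1 k hw), mul_add, mul_one, pow_add, mul_assoc, ← pow_add,
        Even.neg_one_pow ⟨p, rfl⟩, mul_one]
  have h3 : (-1 : k) ^ p * ((-1) ^ (p * q) * (-1) ^ p) = (-1) ^ (p * q) := by
    rw [mul_left_comm, ← pow_add, Even.neg_one_pow ⟨p, rfl⟩, mul_one]
  rw [h1, h2, smul_add, smul_smul, smul_smul, h3, add_comm]

theorem twist_mem {n : ℕ} {t : CL2 k X} (ht : t ∈ deg2 k X n) : twist k X t ∈ deg2 k X n := by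
  refine tensorDeg_le (T := (deg2 k X n).comap (twist k X)) (fun p q h v hv w hw => ?_) ht
  rw [Submodule.mem_comap, twist_tmul hv hw]
  exact Submodule.smul_mem _ _ (tmul_mem_tensorDeg hw hv (by omega))

theorem twist_comp_map2 {Y : CubicalSet.{u}} (f : Hom X Y) :
    twist k Y ∘ₗ map2 k f = map2 k f ∘ₗ twist k X := by
  refine hom_ext_deg2 fun p q v hv w hw => ?_
  rw [LinearMap.comp_apply, LinearMap.comp_apply, twist_tmul hv hw, map_smul, map2,
    TensorProduct.map_tmul, TensorProduct.map_tmul,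
    twist_tmul (map1_mem_deg1 k f hv) (map1_mem_deg1 k f hw)]

theorem map2_comp_d2 {Y : CubicalSet.{u}} (f : Hom X Y) :
    map2 k f ∘ₗ d2 k X = d2 k Y ∘ₗ map2 k f := by
  have h1 := LinearMap.congr_fun (map1_comp_dTot k f)
  have h2 := LinearMap.congr_fun (map1_comp_parity k f)
  simp only [LinearMap.comp_apply] at h1 h2
  refine TensorProduct.ext' fun v w => ?_
  simp [map2, d2, h1, h2]

theorem map3_comp_d3 {Y : CubicalSet.{u}} (f : Hom X Y) :
    map3 k f ∘ₗ d3 k X = d3 k Y ∘ₗ map3 k f := by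
  have h1 := LinearMap.congr_fun (map1_comp_dTot k f)
  have h2 := LinearMap.congr_fun (map1_comp_parity k f)
  have h3 := LinearMap.congr_fun (map2_comp_d2 (k := k) f)
  simp only [LinearMap.comp_apply] at h1 h2 h3
  refine TensorProduct.ext' fun v w => ?_
  simp [map3, d3, h1, h2, h3]

theorem map2_mem {Y : CubicalSet.{u}} (f : Hom X Y) {n : ℕ} {t : CL2 k X} (ht : t ∈ deg2 k X n) :
    map2 k f t ∈ deg2 k Y n := by
  refine tensorDeg_le (T := (deg2 k Y n).comap (map2 k f)) (fun p q h v hv w hw => ?_) ht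
  exact tmul_mem_tensorDeg (map1_mem_deg1 k f hv) (map1_mem_deg1 k f hw) h

theorem map3_mem {Y : CubicalSet.{u}} (f : Hom X Y) {n : ℕ} {t : CL3 k X} (ht : t ∈ deg3 k X n) :
    map3 k f t ∈ deg3 k Y n := by
  refine tensorDeg_le (T := (deg3 k Y n).comap (map3 k f)) (fun p q h v hv w hw => ?_) ht
  exact tmul_mem_tensorDeg (map1_mem_deg1 k f hv) (map2_mem f hw) h

theorem map1_comp {Y Z : CubicalSet.{u}} (g : Hom Y Z) (f : Hom X Y) :
    map1 k (g.comp f) = map1 k g ∘ₗ map1 k f :=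
  hom_ext_gen fun x => by
    rw [LinearMap.comp_apply, map1_gen, map1_gen, map1_gen, Hom.comp_sapp]

theorem map2_comp {Y Z : CubicalSet.{u}} (g : Hom Y Z) (f : Hom X Y) :
    map2 k (g.comp f) = map2 k g ∘ₗ map2 k f := by
  rw [map2, map1_comp, TensorProduct.map_comp]; rfl

theorem map3_comp {Y Z : CubicalSet.{u}} (g : Hom Y Z) (f : Hom X Y) :
    map3 k (g.comp f) = map3 k g ∘ₗ map3 k f := by
  rw [map3, map1_comp, map2_comp, TensorProduct.map_comp]; rfl

variable (k X) in
/-- The sign of the tensor square. -/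
noncomputable def parity2 : CL2 k X →ₗ[k] CL2 k X :=
  TensorProduct.map (parity k X) (parity k X)

theorem parity2_of_mem {n : ℕ} {t : CL2 k X} (ht : t ∈ deg2 k X n) :
    parity2 k X t = (-1 : k) ^ n • t := by
  refine tensorDeg_le (T := LinearMap.eqLocus (parity2 k X) ((-1 : k) ^ n • LinearMap.id))
    (fun p q h v hv w hw => ?_) ht
  rw [LinearMap.mem_eqLocus, parity2, TensorProduct.map_tmul, parity_of_mem_deg1 k hv,
    parity_of_mem_deg1 k hw, TensorProduct.smul_tmul_smul, ← pow_add, h]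
  rfl

/-- The map `a ⊗ b ↦ F a ⊗ b`. -/
noncomputable def leftMap (F : CLTot k X →ₗ[k] CL2 k X) : CL2 k X →ₗ[k] CL3 k X :=
  (TensorProduct.assoc k _ _ _).toLinearMap ∘ₗ TensorProduct.map F LinearMap.id

/-- The map `a ⊗ b ↦ a ⊗ F b`. -/
noncomputable def rightMap (F : CLTot k X →ₗ[k] CL2 k X) : CL2 k X →ₗ[k] CL3 k X :=
  TensorProduct.map LinearMap.id F

theorem d3_assoc (t : CL2 k X) (b : CLTot k X) :
    d3 k X (TensorProduct.assoc k _ _ _ (t ⊗ₜ b)) =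
      TensorProduct.assoc k _ _ _ (d2 k X t ⊗ₜ b + parity2 k X t ⊗ₜ dTot k X b) := by
  induction t using TensorProduct.induction_on with
  | zero => simp
  | add s t hs ht =>
    rw [TensorProduct.add_tmul, map_add, map_add, hs, ht, ← map_add]
    simp only [map_add, TensorProduct.add_tmul]
    abel
  | tmul v w =>
    simp [d3, d2, parity2, TensorProduct.add_tmul, TensorProduct.tmul_add, add_assoc]

theorem d3_leftMap (F : CLTot k X →ₗ[k] CL2 k X) (a b : CLTot k X) :
    d3 k X (leftMap F (a ⊗ₜ b)) = TensorProduct.assoc k _ _ _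
      (d2 k X (F a) ⊗ₜ b + parity2 k X (F a) ⊗ₜ dTot k X b) := by
  rw [← d3_assoc]; rfl

theorem leftMap_mem {e : ℕ} {F : CLTot k X →ₗ[k] CL2 k X}
    (hF : ∀ n, ∀ v ∈ deg1 k X n, F v ∈ deg2 k X (n + e)) {n : ℕ} {t : CL2 k X}
    (ht : t ∈ deg2 k X n) : leftMap F t ∈ deg3 k X (n + e) := by
  refine tensorDeg_le (T := (deg3 k X (n + e)).comap (leftMap F)) (fun p q h v hv w hw => ?_) ht
  have : ∀ s ∈ deg2 k X (p + e), TensorProduct.assoc k _ _ _ (s ⊗ₜ w) ∈ deg3 k X (n + e) := by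
    intro s hs
    refine tensorDeg_le (T := (deg3 k X (n + e)).comap
      ((TensorProduct.assoc k _ _ _).toLinearMap ∘ₗ (TensorProduct.mk k _ _).flip w))
      (fun p' q' h' v' hv' w' hw' => ?_) hs
    exact tmul_mem_tensorDeg hv' (tmul_mem_tensorDeg hw' hw rfl) (by omega)
  exact this _ (hF p v hv)

theorem rightMap_mem {e : ℕ} {F : CLTot k X →ₗ[k] CL2 k X}
    (hF : ∀ n, ∀ v ∈ deg1 k X n, F v ∈ deg2 k X (n + e)) {n : ℕ} {t : CL2 k X}
    (ht : t ∈ deg2 k X n) : rightMap F t ∈ deg3 k X (n + e) := by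
  refine tensorDeg_le (T := (deg3 k X (n + e)).comap (rightMap F)) (fun p q h v hv w hw => ?_) ht
  exact tmul_mem_tensorDeg hv (hF q w hw) (by omega)

theorem leftMap_natural {Y : CubicalSet.{u}} (f : Hom X Y) {F : CLTot k X →ₗ[k] CL2 k X}
    {G : CLTot k Y →ₗ[k] CL2 k Y} (h : G ∘ₗ map1 k f = map2 k f ∘ₗ F) :
    leftMap G ∘ₗ map2 k f = map3 k f ∘ₗ leftMap F := by
  have h' := LinearMap.congr_fun h
  simp only [LinearMap.comp_apply] at h'
  refine TensorProduct.ext' fun v w => ?_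
  have : ∀ t : CL2 k X, TensorProduct.assoc k _ _ _ (map2 k f t ⊗ₜ map1 k f w) =
      map3 k f (TensorProduct.assoc k _ _ _ (t ⊗ₜ w)) := by
    intro t
    induction t using TensorProduct.induction_on with
    | zero => simp
    | add s t hs ht => simp only [map_add, TensorProduct.add_tmul, hs, ht]
    | tmul a b => simp [map2, map3]
  simp only [LinearMap.comp_apply, leftMap]
  rw [map2, TensorProduct.map_tmul, TensorProduct.map_tmul, TensorProduct.map_tmul, h']
  exact this _

theorem rightMap_natural {Y : CubicalSet.{u}} (f : Hom X Y) {F : CLTot k X →ₗ[k] CL2 k X}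
    {G : CLTot k Y →ₗ[k] CL2 k Y} (h : G ∘ₗ map1 k f = map2 k f ∘ₗ F) :
    rightMap G ∘ₗ map2 k f = map3 k f ∘ₗ rightMap F := by
  have h' := LinearMap.congr_fun h
  simp only [LinearMap.comp_apply] at h'
  refine TensorProduct.ext' fun v w => ?_
  simp only [LinearMap.comp_apply, rightMap]
  rw [map2, TensorProduct.map_tmul, TensorProduct.map_tmul, TensorProduct.map_tmul, h']
  rfl

end TensorMaps

section NatChain

variable {k : Type v} [CommRing k]

/-- Natural chain maps `CL_• → CL_• ⊗ CL_•` of degree `0`. -/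
structure IsNatChain2 (F : ∀ X : CubicalSet.{u}, CLTot k X →ₗ[k] CL2 k X) : Prop where
  mem : ∀ (X : CubicalSet.{u}) (n : ℕ), ∀ v ∈ deg1 k X n, F X v ∈ deg2 k X n
  comm : ∀ (X : CubicalSet.{u}) (v : CLTot k X), d2 k X (F X v) = F X (dTot k X v)
  natural : ∀ (X Y : CubicalSet.{u}) (f : Hom X Y), F Y ∘ₗ map1 k f = map2 k f ∘ₗ F X

/-- Natural chain maps `CL_• → CL_• ⊗ CL_• ⊗ CL_•` of degree `0`. -/
structure IsNatChain3 (F : ∀ X : CubicalSet.{u}, CLTot k X →ₗ[k] CL3 k X) : Prop where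
  mem : ∀ (X : CubicalSet.{u}) (n : ℕ), ∀ v ∈ deg1 k X n, F X v ∈ deg3 k X n
  comm : ∀ (X : CubicalSet.{u}) (v : CLTot k X), d3 k X (F X v) = F X (dTot k X v)
  natural : ∀ (X Y : CubicalSet.{u}) (f : Hom X Y), F Y ∘ₗ map1 k f = map3 k f ∘ₗ F X

variable {F G H F' G' : ∀ X : CubicalSet.{u}, CLTot k X →ₗ[k] CL2 k X}
  {A B C : ∀ X : CubicalSet.{u}, CLTot k X →ₗ[k] CL3 k X}

theorem NatCoproduct.isNatChain2 (P : NatCoproduct.{u} k) : IsNatChain2 P.app :=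
  ⟨P.app_mem, fun X => LinearMap.congr_fun (P.comm X), P.natural⟩

theorem IsNatChain2.add (hF : IsNatChain2 F) (hG : IsNatChain2 G) :
    IsNatChain2 fun X => F X + G X where
  mem X n v hv := Submodule.add_mem _ (hF.mem X n v hv) (hG.mem X n v hv)
  comm X v := by simp [hF.comm, hG.comm]
  natural X Y f := by
    rw [LinearMap.add_comp, LinearMap.comp_add, hF.natural, hG.natural]

theorem IsNatChain2.twist (hF : IsNatChain2 F) : IsNatChain2 fun X => twist k X ∘ₗ F X where
  mem X n v hv := twist_mem (hF.mem X n v hv)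
  comm X v := by
    have := LinearMap.congr_fun (d2_comp_twist (k := k) (X := X)) (F X v)
    simp only [LinearMap.comp_apply] at this ⊢
    rw [this, hF.comm]
  natural X Y f := by
    rw [LinearMap.comp_assoc, hF.natural, ← LinearMap.comp_assoc, twist_comp_map2]
    rfl

theorem parity2_apply {F : ∀ X : CubicalSet.{u}, CLTot k X →ₗ[k] CL2 k X}
    (hF : ∀ (X : CubicalSet.{u}) (n : ℕ), ∀ v ∈ deg1 k X n, F X v ∈ deg2 k X n)
    (X : CubicalSet.{u}) (v : CLTot k X) : parity2 k X (F X v) = F X (parity k X v) := by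
  suffices h : parity2 k X ∘ₗ F X = F X ∘ₗ parity k X from LinearMap.congr_fun h v
  refine hom_ext_deg1 k fun n v hv => ?_
  rw [LinearMap.comp_apply, LinearMap.comp_apply, parity2_of_mem (hF X n v hv),
    parity_of_mem_deg1 k hv, map_smul]

theorem parity2_apply_of_deg_one {h : ∀ X : CubicalSet.{u}, CLTot k X →ₗ[k] CL2 k X}
    (hh : ∀ (X : CubicalSet.{u}) (n : ℕ), ∀ v ∈ deg1 k X n, h X v ∈ deg2 k X (n + 1))
    (X : CubicalSet.{u}) (v : CLTot k X) : parity2 k X (h X v) = (-1 : k) • h X (parity k X v) := by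
  suffices h : parity2 k X ∘ₗ h X = (-1 : k) • (h X ∘ₗ parity k X) from LinearMap.congr_fun h v
  refine hom_ext_deg1 k fun n v hv => ?_
  rw [LinearMap.comp_apply, LinearMap.smul_apply, LinearMap.comp_apply,
    parity2_of_mem (hh X n v hv), parity_of_mem_deg1 k hv, map_smul, pow_succ', mul_smul]

theorem IsNatChain2.d3_leftMap (hF : IsNatChain2 F) (X : CubicalSet.{u}) (t : CL2 k X) :
    d3 k X (leftMap (F X) t) = leftMap (F X) (d2 k X t) := by
  induction t using TensorProduct.induction_on with
  | zero => simp
  | add s t hs ht => simp only [map_add, hs, ht]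
  | tmul a b =>
    rw [CubicalSet.d3_leftMap, hF.comm, parity2_apply hF.mem, d2, LinearMap.add_apply, map_add,
      map_add]
    rfl

theorem IsNatChain2.d3_rightMap (hF : IsNatChain2 F) (X : CubicalSet.{u}) (t : CL2 k X) :
    d3 k X (rightMap (F X) t) = rightMap (F X) (d2 k X t) := by
  induction t using TensorProduct.induction_on with
  | zero => simp
  | add s t hs ht => simp only [map_add, hs, ht]
  | tmul a b =>
    rw [rightMap, TensorProduct.map_tmul, d3, LinearMap.add_apply, TensorProduct.map_tmul,
      TensorProduct.map_tmul, LinearMap.id_apply, LinearMap.id_apply, hF.comm, d2,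
      LinearMap.add_apply, map_add]
    rfl

theorem IsNatChain2.leftIter (hF : IsNatChain2 F) (hG : IsNatChain2 G) :
    IsNatChain3 fun X => leftIter (F X) (G X) where
  mem X n v hv := leftMap_mem (e := 0) (hF.mem X) (hG.mem X n v hv)
  comm X v := (hF.d3_leftMap X (G X v)).trans (congrArg _ (hG.comm X v))
  natural X Y f := by
    have h := leftMap_natural f (hF.natural X Y f)
    change (leftMap (F Y) ∘ₗ G Y) ∘ₗ _ = _ ∘ₗ leftMap (F X) ∘ₗ G X
    rw [LinearMap.comp_assoc, hG.natural, ← LinearMap.comp_assoc, h, LinearMap.comp_assoc]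

theorem IsNatChain2.rightIter (hF : IsNatChain2 F) (hG : IsNatChain2 G) :
    IsNatChain3 fun X => rightIter (F X) (G X) where
  mem X n v hv := rightMap_mem (e := 0) (hF.mem X) (hG.mem X n v hv)
  comm X v := (hF.d3_rightMap X (G X v)).trans (congrArg _ (hG.comm X v))
  natural X Y f := by
    have h := rightMap_natural f (hF.natural X Y f)
    change (rightMap (F Y) ∘ₗ G Y) ∘ₗ _ = _ ∘ₗ rightMap (F X) ∘ₗ G X
    rw [LinearMap.comp_assoc, hG.natural, ← LinearMap.comp_assoc, h, LinearMap.comp_assoc]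

theorem NatHomotopic2.refl (F : ∀ X : CubicalSet.{u}, CLTot k X →ₗ[k] CL2 k X) :
    NatHomotopic2 F F :=
  ⟨fun _ => 0, fun _ _ _ _ => Submodule.zero_mem _, fun X => by simp [sub_self (F X)],
    fun X Y f => by simp⟩

theorem NatHomotopic2.add (h : NatHomotopic2 F G) (h' : NatHomotopic2 F' G') :
    NatHomotopic2 (fun X => F X + F' X) fun X => G X + G' X := by
  obtain ⟨h, h1, h2, h3⟩ := h
  obtain ⟨h', h1', h2', h3'⟩ := h'
  refine ⟨fun X => h X + h' X, fun X n v hv => Submodule.add_mem _ (h1 X n v hv) (h1' X n v hv),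
    fun X => ?_, fun X Y f => ?_⟩
  · exact homotopy_add (h2 X) (h2' X)
  · rw [LinearMap.comp_add, LinearMap.add_comp, h3, h3']

theorem NatHomotopic3.symm (h : NatHomotopic3 A B) : NatHomotopic3 B A := by
  obtain ⟨h, h1, h2, h3⟩ := h
  refine ⟨fun X => -h X, fun X n v hv => Submodule.neg_mem _ (h1 X n v hv), fun X => ?_,
    fun X Y f => ?_⟩
  · exact homotopy_neg (h2 X)
  · rw [LinearMap.comp_neg, LinearMap.neg_comp, h3]

theorem NatHomotopic3.trans (h : NatHomotopic3 A B) (h' : NatHomotopic3 B C) :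
    NatHomotopic3 A C := by
  obtain ⟨h, h1, h2, h3⟩ := h
  obtain ⟨h', h1', h2', h3'⟩ := h'
  refine ⟨fun X => h X + h' X, fun X n v hv => Submodule.add_mem _ (h1 X n v hv) (h1' X n v hv),
    fun X => ?_, fun X Y f => ?_⟩
  · exact homotopy_trans (h2 X) (h2' X)
  · rw [LinearMap.comp_add, LinearMap.add_comp, h3, h3']

/-- If `h` and `h'` are homotopies from `F` to `G` and from `F'` to `G'`, then
`(h ⊗ id) F' + (G ⊗ id) h'` is a homotopy from `(F ⊗ id) F'` to `(G ⊗ id) G'`. -/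
theorem NatHomotopic2.leftIter (hFG : NatHomotopic2 F G) (hF'G' : NatHomotopic2 F' G')
    (hG : IsNatChain2 G) (hF' : IsNatChain2 F') :
    NatHomotopic3 (fun X => leftIter (F X) (F' X)) fun X => leftIter (G X) (G' X) := by
  obtain ⟨h, h1, h2, h3⟩ := hFG
  obtain ⟨h', h1', h2', h3'⟩ := hF'G'
  refine ⟨fun X => leftMap (h X) ∘ₗ F' X + leftMap (G X) ∘ₗ h' X, fun X n v hv => ?_,
    fun X => LinearMap.ext fun v => ?_, fun X Y f => ?_⟩
  · exact Submodule.add_mem _ (leftMap_mem (h1 X) (hF'.mem X n v hv))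
      (leftMap_mem (e := 0) (hG.mem X) (h1' X n v hv))
  · have key : ∀ t, d3 k X (leftMap (h X) t) =
        leftMap (G X) t - leftMap (F X) t - leftMap (h X) (d2 k X t) := by
      intro t
      induction t using TensorProduct.induction_on with
      | zero => simp
      | add s t hs ht => simp only [map_add, hs, ht]; abel
      | tmul a b =>
        have e := LinearMap.congr_fun (h2 X) a
        simp only [LinearMap.add_apply, LinearMap.comp_apply, LinearMap.sub_apply] at e
        have e' : ∀ (s : CL2 k X) (c : CLTot k X), TensorProduct.assoc k _ _ _
            (((-1 : k) • s) ⊗ₜ c) = -TensorProduct.assoc k _ _ _ (s ⊗ₜ c) := fun s c => by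
          rw [← TensorProduct.smul_tmul', map_smul]
          exact neg_one_smul k (TensorProduct.assoc k _ (CLTot k X) (CLTot k X) (s ⊗ₜ c))
        rw [d3_leftMap, parity2_apply_of_deg_one h1, eq_sub_of_add_eq e]
        simp only [leftMap, d2, LinearMap.comp_apply, LinearMap.add_apply, map_add,
          TensorProduct.map_tmul, LinearMap.id_apply, LinearEquiv.coe_coe, TensorProduct.sub_tmul,
          e', map_sub]
        abel
    have e := LinearMap.congr_fun (h2' X) v
    simp only [LinearMap.add_apply, LinearMap.comp_apply, LinearMap.sub_apply] at e ⊢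
    rw [map_add, key, hG.d3_leftMap, eq_sub_of_add_eq e, hF'.comm, map_sub, map_sub]
    change _ = leftMap (G X) (G' X v) - leftMap (F X) (F' X v)
    abel
  · have e1 := leftMap_natural f (h3 X Y f)
    have e2 := leftMap_natural f (hG.natural X Y f)
    rw [LinearMap.add_comp, LinearMap.comp_add, LinearMap.comp_assoc, LinearMap.comp_assoc,
      hF'.natural, h3', ← LinearMap.comp_assoc, ← LinearMap.comp_assoc, e1, e2,
      LinearMap.comp_assoc, LinearMap.comp_assoc]

/-- If `h` and `h'` are homotopies from `F` to `G` and from `F'` to `G'`, then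
`(id ⊗ h) F' + (id ⊗ G) h'` is a homotopy from `(id ⊗ F) F'` to `(id ⊗ G) G'`. -/
theorem NatHomotopic2.rightIter (hFG : NatHomotopic2 F G) (hF'G' : NatHomotopic2 F' G')
    (hG : IsNatChain2 G) (hF' : IsNatChain2 F') :
    NatHomotopic3 (fun X => rightIter (F X) (F' X)) fun X => rightIter (G X) (G' X) := by
  obtain ⟨h, h1, h2, h3⟩ := hFG
  obtain ⟨h', h1', h2', h3'⟩ := hF'G'
  -- By the Koszul rule, `h` passes the first tensor factor with a sign.
  refine ⟨fun X => TensorProduct.map (parity k X) (h X) ∘ₗ F' X + rightMap (G X) ∘ₗ h' X,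
    fun X n v hv => ?_, fun X => LinearMap.ext fun v => ?_, fun X Y f => ?_⟩
  · refine Submodule.add_mem _ ?_ (rightMap_mem (e := 0) (hG.mem X) (h1' X n v hv))
    refine tensorDeg_le (T := (deg3 k X (n + 1)).comap (TensorProduct.map (parity k X) (h X)))
      (fun p q e v hv w hw => ?_) (hF'.mem X n v hv)
    rw [Submodule.mem_comap, TensorProduct.map_tmul, parity_of_mem_deg1 k hv]
    exact tmul_mem_tensorDeg (Submodule.smul_mem _ _ hv) (h1 X q w hw) (by omega)
  · have key : ∀ t, d3 k X (TensorProduct.map (parity k X) (h X) t) =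
        rightMap (G X) t - rightMap (F X) t -
          TensorProduct.map (parity k X) (h X) (d2 k X t) := by
      intro t
      induction t using TensorProduct.induction_on with
      | zero => simp
      | add s t hs ht => simp only [map_add, hs, ht]; abel
      | tmul a b =>
        have e := LinearMap.congr_fun (h2 X) b
        have e1 := LinearMap.congr_fun (dTot_comp_parity k (X := X)) a
        have e2 := LinearMap.congr_fun (parity_comp_parity k (X := X)) a
        simp only [LinearMap.add_apply, LinearMap.comp_apply, LinearMap.sub_apply,
          LinearMap.neg_apply, LinearMap.id_apply] at e e1 e2
        rw [d3, LinearMap.add_apply, TensorProduct.map_tmul, TensorProduct.map_tmul,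
          TensorProduct.map_tmul, e1, e2, eq_sub_of_add_eq e]
        simp only [rightMap, d2, LinearMap.add_apply, map_add, TensorProduct.map_tmul,
          LinearMap.id_apply, e2, TensorProduct.tmul_sub, TensorProduct.neg_tmul]
        abel
    have e := LinearMap.congr_fun (h2' X) v
    simp only [LinearMap.add_apply, LinearMap.comp_apply, LinearMap.sub_apply] at e ⊢
    rw [map_add, key, hG.d3_rightMap, eq_sub_of_add_eq e, hF'.comm, map_sub, map_sub]
    change _ = rightMap (G X) (G' X v) - rightMap (F X) (F' X v)
    abel
  · have e1 : TensorProduct.map (parity k Y) (h Y) ∘ₗ map2 k f =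
        map3 k f ∘ₗ TensorProduct.map (parity k X) (h X) := by
      rw [map2, map3, ← TensorProduct.map_comp, ← TensorProduct.map_comp, h3,
        map1_comp_parity]
    have e2 := rightMap_natural f (hG.natural X Y f)
    rw [LinearMap.add_comp, LinearMap.comp_add, LinearMap.comp_assoc, LinearMap.comp_assoc,
      hF'.natural, h3', ← LinearMap.comp_assoc, ← LinearMap.comp_assoc, e1, e2,
      LinearMap.comp_assoc, LinearMap.comp_assoc]

theorem eq_of_gen_eq {M : Type*} [AddCommGroup M] [Module k M] {X : CubicalSet.{u}} {n : ℕ}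
    {f g : CLTot k X →ₗ[k] M} (h : ∀ x : X.LCell n, f (gen k X ⟨n, x⟩) = g (gen k X ⟨n, x⟩))
    {v : CLTot k X} (hv : v ∈ deg1 k X n) : f v = g v := by
  rw [deg1_eq_span] at hv
  refine (Submodule.span_le (p := LinearMap.eqLocus f g)).2 ?_ hv
  rintro _ ⟨x, rfl⟩
  exact h x

/-- Natural chain maps into the tensor square that agree in the degrees `≤ 2` are homotopic. -/
theorem IsNatChain2.natHomotopic (hF : IsNatChain2 F) (hG : IsNatChain2 G)
    (h : ∀ X, ∀ n ≤ 2, ∀ x : X.LCell n, F X (gen k X ⟨n, x⟩) = G X (gen k X ⟨n, x⟩)) :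
    NatHomotopic2 F G := by
  obtain ⟨h, h1, h2, h3⟩ := exists_nullHomotopy.{u, v} (T := fun X => CL2 k X) 2 (d2 k) (deg2 k)
    (fun f => map2 k f) (fun g f => map2_comp g f) (fun f => LinearMap.congr_fun (map2_comp_d2 f))
    (fun f n t ht => map2_mem f ht)
    (fun n m hm t ht hd => by
      obtain ⟨s, π, hc⟩ := model_isContraction2.{u} k n
      exact hc.exists_eq hm ht hd)
    (fun X => G X - F X) (fun X n v hv => Submodule.sub_mem _ (hG.mem X n v hv) (hF.mem X n v hv))
    (fun X v => by simp [hF.comm, hG.comm])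
    (fun X Y f v => by
      have e1 := LinearMap.congr_fun (hF.natural X Y f) v
      have e2 := LinearMap.congr_fun (hG.natural X Y f) v
      simp only [LinearMap.comp_apply] at e1 e2
      simp [e1, e2])
    (fun X n hn v hv => sub_eq_zero.2 (eq_of_gen_eq (h X n hn) hv).symm)
  exact ⟨h, h1, fun X => LinearMap.ext (h2 X), fun X Y f => LinearMap.ext (h3 X Y f)⟩

/-- Natural chain maps into the tensor cube that agree in the degrees `≤ 3` are homotopic. -/
theorem IsNatChain3.natHomotopic (hA : IsNatChain3 A) (hB : IsNatChain3 B)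
    (h : ∀ X, ∀ n ≤ 3, ∀ x : X.LCell n, A X (gen k X ⟨n, x⟩) = B X (gen k X ⟨n, x⟩)) :
    NatHomotopic3 A B := by
  obtain ⟨h, h1, h2, h3⟩ := exists_nullHomotopy.{u, v} (T := fun X => CL3 k X) 3 (d3 k) (deg3 k)
    (fun f => map3 k f) (fun g f => map3_comp g f) (fun f => LinearMap.congr_fun (map3_comp_d3 f))
    (fun f n t ht => map3_mem f ht)
    (fun n m hm t ht hd => by
      obtain ⟨s, π, hc⟩ := model_isContraction3.{u} k n
      exact hc.exists_eq hm ht hd)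
    (fun X => B X - A X) (fun X n v hv => Submodule.sub_mem _ (hB.mem X n v hv) (hA.mem X n v hv))
    (fun X v => by simp [hA.comm, hB.comm])
    (fun X Y f v => by
      have e1 := LinearMap.congr_fun (hA.natural X Y f) v
      have e2 := LinearMap.congr_fun (hB.natural X Y f) v
      simp only [LinearMap.comp_apply] at e1 e2
      simp [e1, e2])
    (fun X n hn v hv => sub_eq_zero.2 (eq_of_gen_eq (h X n hn) hv).symm)
  exact ⟨h, h1, fun X => LinearMap.ext (h2 X), fun X Y f => LinearMap.ext (h3 X Y f)⟩

end NatChain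

/-! ### The codendriform relations -/

section LowDegrees

variable {k : Type v} [CommRing k] {X : CubicalSet.{u}}

theorem sum_powerset_range_two {M : Type*} [AddCommMonoid M] (f : Finset ℕ → M) :
    ∑ A ∈ (Finset.range 2).powerset, f A = f ∅ + f {0} + (f {1} + f {1, 0}) := by
  rw [Finset.range_add_one, Finset.sum_powerset_insert Finset.notMem_range_self, Finset.range_one,
    show ({0} : Finset ℕ).powerset = {∅, {0}} from rfl,
    Finset.sum_pair (Finset.singleton_ne_empty 0).symm,
    Finset.sum_pair (Finset.singleton_ne_empty 0).symm]
  rfl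

theorem sum_powerset_range_three {M : Type*} [AddCommMonoid M] (f : Finset ℕ → M) :
    ∑ A ∈ (Finset.range 3).powerset, f A = f ∅ + f {0} + (f {1} + f {1, 0}) +
      (f {2} + f {2, 0} + (f {2, 1} + f {2, 1, 0})) := by
  rw [Finset.range_add_one, Finset.sum_powerset_insert Finset.notMem_range_self,
    sum_powerset_range_two, sum_powerset_range_two]
  rfl

theorem subsetTerm_eq {N : ℕ} {A : Finset ℕ} {s : ℤ} {l l' : List ℕ} (x : Σ n, X.LCell n)
    (hs : subsetSign N A = s) (hl : (List.range N).filter (· ∉ A) = l)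
    (hl' : (List.range N).filter (· ∈ A) = l') :
    subsetTerm k x N A =
      (s : k) • (gen k X (X.faces false l x) ⊗ₜ gen k X (X.faces true l' x)) := by
  rw [subsetTerm, hs, hl, hl']

theorem serrePrec_of_le_one {x : Σ n, X.LCell n} (hx : x.1 ≤ 1) :
    (serrePrec.{u} k).app X (gen k X x) = 0 := by
  rw [serrePrec_gen, precFormula_eq]
  exact Finset.sum_eq_zero fun A _ => if_neg (by omega)

theorem serreSucc_of_le_one {x : Σ n, X.LCell n} (hx : x.1 ≤ 1) :
    (serreSucc.{u} k).app X (gen k X x) = 0 := by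
  rw [serreSucc_gen, succFormula_eq]
  exact Finset.sum_eq_zero fun A _ => if_neg (by omega)

theorem serrePrec_two (x : X.LCell 2) : (serrePrec.{u} k).app X (gen k X ⟨2, x⟩) =
    gen k X (X.faceAt false 1 ⟨2, x⟩) ⊗ₜ gen k X (X.faceAt true 0 ⟨2, x⟩) := by
  rw [serrePrec_gen, precFormula_eq, sum_powerset_range_two]
  simp [subsetTerm_eq (k := k) (N := 2) (A := {0}) (s := 1) (l := [1]) (l' := [0]) ⟨2, x⟩
    (by decide) (by decide) (by decide), faces]

theorem serreSucc_two (x : X.LCell 2) : (serreSucc.{u} k).app X (gen k X ⟨2, x⟩) =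
    -(gen k X (X.faceAt false 0 ⟨2, x⟩) ⊗ₜ gen k X (X.faceAt true 1 ⟨2, x⟩)) := by
  rw [serreSucc_gen, succFormula_eq, sum_powerset_range_two]
  simp [subsetTerm_eq (k := k) (N := 2) (A := {1}) (s := -1) (l := [0]) (l' := [1]) ⟨2, x⟩
    (by decide) (by decide) (by decide), faces]
  exact neg_one_smul k
    (gen k X (X.faceAt false 0 ⟨2, x⟩) ⊗ₜ[k] gen k X (X.faceAt true 1 ⟨2, x⟩))

theorem serrePrec_three (x : X.LCell 3) : (serrePrec.{u} k).app X (gen k X ⟨3, x⟩) =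
    gen k X (X.faceAt false 1 (X.faceAt false 2 ⟨3, x⟩)) ⊗ₜ gen k X (X.faceAt true 0 ⟨3, x⟩) +
    gen k X (X.faceAt false 2 ⟨3, x⟩) ⊗ₜ gen k X (X.faceAt true 0 (X.faceAt true 1 ⟨3, x⟩)) +
    (-1 : k) • (gen k X (X.faceAt false 1 ⟨3, x⟩) ⊗ₜ
      gen k X (X.faceAt true 0 (X.faceAt true 2 ⟨3, x⟩))) := by
  rw [serrePrec_gen, precFormula_eq, sum_powerset_range_three,
    subsetTerm_eq (N := 3) (A := {0}) (s := 1) (l := [1, 2]) (l' := [0]) ⟨3, x⟩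
      (by decide) (by decide) (by decide),
    subsetTerm_eq (N := 3) (A := {1, 0}) (s := 1) (l := [2]) (l' := [0, 1]) ⟨3, x⟩
      (by decide) (by decide) (by decide),
    subsetTerm_eq (N := 3) (A := {2, 0}) (s := -1) (l := [1]) (l' := [0, 2]) ⟨3, x⟩
      (by decide) (by decide) (by decide)]
  simp [faces]

theorem serreSucc_three (x : X.LCell 3) : (serreSucc.{u} k).app X (gen k X ⟨3, x⟩) =
    (-1 : k) • (gen k X (X.faceAt false 0 (X.faceAt false 2 ⟨3, x⟩)) ⊗ₜ
      gen k X (X.faceAt true 1 ⟨3, x⟩)) +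
    gen k X (X.faceAt false 0 (X.faceAt false 1 ⟨3, x⟩)) ⊗ₜ gen k X (X.faceAt true 2 ⟨3, x⟩) +
    gen k X (X.faceAt false 0 ⟨3, x⟩) ⊗ₜ gen k X (X.faceAt true 1 (X.faceAt true 2 ⟨3, x⟩)) := by
  rw [serreSucc_gen, succFormula_eq, sum_powerset_range_three,
    subsetTerm_eq (N := 3) (A := {1}) (s := -1) (l := [0, 2]) (l' := [1]) ⟨3, x⟩
      (by decide) (by decide) (by decide),
    subsetTerm_eq (N := 3) (A := {2}) (s := 1) (l := [0, 1]) (l' := [2]) ⟨3, x⟩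
      (by decide) (by decide) (by decide),
    subsetTerm_eq (N := 3) (A := {2, 1}) (s := 1) (l := [0]) (l' := [1, 2]) ⟨3, x⟩
      (by decide) (by decide) (by decide)]
  simp [faces, add_assoc]

theorem serrePrec_extendsPrec : (serrePrec.{u} k).ExtendsPrec := fun _ =>
  ⟨fun _ => serrePrec_of_le_one (Nat.zero_le 1), fun _ => serrePrec_of_le_one le_rfl,
    fun x => serrePrec_two x⟩

theorem serreSucc_extendsSucc : (serreSucc.{u} k).ExtendsSucc := fun _ =>
  ⟨fun _ => serreSucc_of_le_one (Nat.zero_le 1), fun _ => serreSucc_of_le_one le_rfl,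
    fun x => serreSucc_two x⟩

end LowDegrees

section Codendriform

variable {k : Type v} [CommRing k]

theorem NatCoproduct.ExtendsPrec.natHomotopic {P P' : NatCoproduct.{u} k} (hP : P.ExtendsPrec)
    (hP' : P'.ExtendsPrec) : NatHomotopic2 P.app P'.app := by
  refine P.isNatChain2.natHomotopic P'.isNatChain2 fun X n hn x => ?_
  match n, hn, x with
  | 0, _, x => rw [(hP X).1, (hP' X).1]
  | 1, _, x => rw [(hP X).2.1, (hP' X).2.1]
  | 2, _, x => rw [(hP X).2.2, (hP' X).2.2]

theorem NatCoproduct.ExtendsSucc.natHomotopic {S S' : NatCoproduct.{u} k} (hS : S.ExtendsSucc)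
    (hS' : S'.ExtendsSucc) : NatHomotopic2 S.app S'.app := by
  refine S.isNatChain2.natHomotopic S'.isNatChain2 fun X n hn x => ?_
  match n, hn, x with
  | 0, _, x => rw [(hS X).1, (hS' X).1]
  | 1, _, x => rw [(hS X).2.1, (hS' X).2.1]
  | 2, _, x => rw [(hS X).2.2, (hS' X).2.2]

variable (k) in
/-- The linear map that is `x ↦ d_{1,0} x ⊗ x` in degree `2` and zero in the other degrees. -/
noncomputable def symmHomotopy (X : CubicalSet.{u}) : CLTot k X →ₗ[k] CL2 k X :=
  liftCL k (fun x => if x.1 = 2 then gen k X (X.faceAt false 0 x) ⊗ₜ gen k X x else 0)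
    fun n x hx => by
      rw [gen_degen (x := ⟨n, x⟩) k X hx, TensorProduct.tmul_zero, ite_self]

theorem symmHomotopy_gen {X : CubicalSet.{u}} (x : Σ n, X.LCell n) : symmHomotopy k X (gen k X x) =
    if x.1 = 2 then gen k X (X.faceAt false 0 x) ⊗ₜ gen k X x else 0 := liftCL_gen k _ _ x

theorem symmHomotopy_two {X : CubicalSet.{u}} (x : X.LCell 2) : symmHomotopy k X (gen k X ⟨2, x⟩) =
    gen k X (X.faceAt false 0 ⟨2, x⟩) ⊗ₜ gen k X ⟨2, x⟩ :=
  (symmHomotopy_gen _).trans (if_pos rfl)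

theorem symmHomotopy_of_ne {X : CubicalSet.{u}} {n : ℕ} (hn : n ≠ 2) {v : CLTot k X}
    (hv : v ∈ deg1 k X n) : symmHomotopy k X v = 0 :=
  eq_of_gen_eq (g := 0) (fun _ => (symmHomotopy_gen _).trans (if_neg hn)) hv

theorem symmHomotopy_mem (X : CubicalSet.{u}) (n : ℕ) (v : CLTot k X) (hv : v ∈ deg1 k X n) :
    symmHomotopy k X v ∈ deg2 k X (n + 1) := by
  by_cases hn : n = 2
  · subst hn
    rw [deg1_eq_span] at hv
    refine (Submodule.span_le (p := (deg2 k X 3).comap (symmHomotopy k X))).2 ?_ hv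
    rintro _ ⟨x, rfl⟩
    rw [SetLike.mem_coe, Submodule.mem_comap, symmHomotopy_two]
    exact tmul_mem_tensorDeg (gen_mem_deg1 k X (X.faceAt false 0 ⟨2, x⟩))
      (gen_mem_deg1 k X ⟨2, x⟩) rfl
  · rw [symmHomotopy_of_ne hn hv]
    exact Submodule.zero_mem _

theorem symmHomotopy_natural {X Y : CubicalSet.{u}} (f : Hom X Y) :
    symmHomotopy k Y ∘ₗ map1 k f = map2 k f ∘ₗ symmHomotopy k X := by
  refine hom_ext_gen fun x => ?_
  rw [LinearMap.comp_apply, LinearMap.comp_apply, map1_gen, symmHomotopy_gen, symmHomotopy_gen,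
    show (f.sapp x).1 = x.1 from rfl]
  by_cases hx : x.1 = 2
  · rw [if_pos hx, if_pos hx, map2, TensorProduct.map_tmul, map1_gen, map1_gen, Hom.sapp_faceAt]
  · rw [if_neg hx, if_neg hx, map_zero]

/-- In degree `2`, where `d_{1,0} x = d_{1,1} x`, the difference between `τ Δ≺ x` and `Δ≻ x` is the
boundary of `d_{1,0} x ⊗ x`; the higher degrees follow by acyclic models. -/
theorem natHomotopic_twist {P S : NatCoproduct.{u} k} (hP : P.ExtendsPrec) (hS : S.ExtendsSucc) :
    NatHomotopic2 S.app fun X => twist k X ∘ₗ P.app X := by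
  have hT := P.isNatChain2.twist
  have hS2 := S.isNatChain2
  set B : ∀ X : CubicalSet.{u}, CLTot k X →ₗ[k] CL2 k X := fun X =>
    d2 k X ∘ₗ symmHomotopy k X + symmHomotopy k X ∘ₗ dTot k X with hB
  have d2d2 : ∀ (X : CubicalSet.{u}) (t : CL2 k X), d2 k X (d2 k X t) = 0 := by
    intro X t
    suffices h : d2 k X ∘ₗ d2 k X = 0 from LinearMap.congr_fun h t
    refine TensorProduct.ext' fun a b => ?_
    have e1 := LinearMap.congr_fun (dTot_comp_parity k (X := X)) a
    simp only [LinearMap.comp_apply, LinearMap.neg_apply] at e1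
    simp [d2, dTot_dTot, e1, TensorProduct.neg_tmul]
  have hBchain : IsNatChain2 fun X => S.app X + B X := by
    refine hS2.add ⟨fun X n v hv => ?_, fun X v => ?_, fun X Y f => ?_⟩
    · refine Submodule.add_mem _ ?_ ?_
      · have := symmHomotopy_mem X n v hv
        refine tensorDeg_le (T := (deg2 k X n).comap (d2 k X)) (fun p q h a ha b hb => ?_) this
        rw [Submodule.mem_comap, d2_tmul ha]
        refine Submodule.add_mem _ ?_ (Submodule.smul_mem _ _ ?_)
        · cases p with
          | zero =>
            rw [dTot_of_mem_deg1_zero k ha, TensorProduct.zero_tmul]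
            exact Submodule.zero_mem _
          | succ p => exact tmul_mem_tensorDeg (dTot_mem_deg1 k ha) hb (by omega)
        · cases q with
          | zero =>
            rw [dTot_of_mem_deg1_zero k hb, TensorProduct.tmul_zero]
            exact Submodule.zero_mem _
          | succ q => exact tmul_mem_tensorDeg ha (dTot_mem_deg1 k hb) (by omega)
      · cases n with
        | zero =>
          rw [LinearMap.comp_apply, dTot_of_mem_deg1_zero k hv, map_zero]
          exact Submodule.zero_mem _
        | succ n => exact symmHomotopy_mem X n _ (dTot_mem_deg1 k hv)
    · simp only [hB, LinearMap.add_apply, LinearMap.comp_apply, map_add, d2d2, dTot_dTot, map_zero,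
        zero_add, add_zero]
    · have e1 := symmHomotopy_natural (k := k) f
      have e2 := map2_comp_d2 (k := k) f
      have e3 := map1_comp_dTot k f
      simp only [hB]
      rw [LinearMap.add_comp, LinearMap.comp_add, LinearMap.comp_assoc, LinearMap.comp_assoc, e1,
        ← e3, ← LinearMap.comp_assoc, ← LinearMap.comp_assoc, ← e2, e1]
      rfl
  -- `S + B` and `τ P` agree in degrees `≤ 2`.
  obtain ⟨h, h1, h2, h3⟩ := hBchain.natHomotopic hT fun X n hn x => by
    match n, hn, x with
    | 0, _, x =>
      have hx : gen k X ⟨0, x⟩ ∈ deg1 k X 0 := gen_mem_deg1 k X ⟨0, x⟩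
      simp [hB, (hP X).1, (hS X).1, symmHomotopy_of_ne (by decide) hx, dTot_of_mem_deg1_zero k hx]
    | 1, _, x =>
      have hx : gen k X ⟨1, x⟩ ∈ deg1 k X 1 := gen_mem_deg1 k X ⟨1, x⟩
      simp [hB, (hP X).2.1, (hS X).2.1, symmHomotopy_of_ne (by decide) hx, dTot_of_mem_deg1_one hx]
    | 2, _, x =>
      have hx : gen k X ⟨2, x⟩ ∈ deg1 k X 2 := gen_mem_deg1 k X ⟨2, x⟩
      have hface : ∀ ε i, gen k X (X.faceAt ε i ⟨2, x⟩) ∈ deg1 k X (X.faceAt ε i ⟨2, x⟩).1 :=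
        fun ε i => gen_mem_deg1 k X _
      have h0 : ∀ ε, gen k X (X.faceAt ε 0 ⟨2, x⟩) ∈ deg1 k X 1 := fun ε => hface ε 0
      have h1 : ∀ ε, gen k X (X.faceAt ε 1 ⟨2, x⟩) ∈ deg1 k X 1 := fun ε => hface ε 1
      have hd : dTot k X (gen k X ⟨2, x⟩) =
          (-1 : k) • (gen k X (X.faceAt true 1 ⟨2, x⟩) - gen k X (X.faceAt false 1 ⟨2, x⟩)) := by
        rw [dTot_gen, Finset.sum_range_succ, Finset.sum_range_one,
          faceAt_zero_eq true false ⟨2, x⟩, sub_self, smul_zero, zero_add, pow_one]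
      have hP2 : P.app X (gen k X ⟨2, x⟩) =
        gen k X (X.faceAt false 1 ⟨2, x⟩) ⊗ₜ gen k X (X.faceAt true 0 ⟨2, x⟩) := (hP X).2.2 x
      have hS2 : S.app X (gen k X ⟨2, x⟩) =
        -(gen k X (X.faceAt false 0 ⟨2, x⟩) ⊗ₜ gen k X (X.faceAt true 1 ⟨2, x⟩)) := (hS X).2.2 x
      rw [LinearMap.add_apply, hS2, LinearMap.comp_apply, hP2, twist_tmul (h1 false) (h0 true), hB]
      simp only [LinearMap.add_apply, LinearMap.comp_apply]
      rw [symmHomotopy_of_ne (by decide) (dTot_mem_deg1 k hx), add_zero, symmHomotopy_two,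
        d2_tmul (h0 false), dTot_of_mem_deg1_one (h0 false), hd, faceAt_zero_eq true false ⟨2, x⟩,
        TensorProduct.zero_tmul, zero_add, TensorProduct.tmul_smul, smul_smul,
        TensorProduct.tmul_sub]
      have key : ∀ a b : CL2 k X, -a + (a - b) = (-1 : k) • b := fun a b =>
        (by abel : -a + (a - b) = -b).trans (neg_one_smul k b).symm
      simp only [pow_one, mul_one, neg_mul, one_mul, neg_neg, one_smul]
      exact key _ _
  refine ⟨fun X => symmHomotopy k X + h X, fun X n v hv => Submodule.add_mem _
    (symmHomotopy_mem X n v hv) (h1 X n v hv),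
    fun X => homotopy_trans (G := S.app X + B X) ?_ (h2 X),
    fun X Y f => ?_⟩
  · exact (add_sub_cancel_left (S.app X) (B X)).symm
  · rw [LinearMap.add_comp, LinearMap.comp_add, symmHomotopy_natural, h3]

/-- Maps that vanish in degrees `≤ 1` and take a `2`-cell to a multiple of a product of
`1`-cells. -/
structure IsReducedLow (F : ∀ X : CubicalSet.{u}, CLTot k X →ₗ[k] CL2 k X) : Prop where
  low : ∀ (X : CubicalSet.{u}) (x : Σ n, X.LCell n), x.1 ≤ 1 → F X (gen k X x) = 0
  two : ∀ (X : CubicalSet.{u}) (x : Σ n, X.LCell n), x.1 = 2 → ∃ (c : k) (a b : Σ n, X.LCell n),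
    a.1 = 1 ∧ b.1 = 1 ∧ F X (gen k X x) = c • (gen k X a ⊗ₜ gen k X b)

theorem serrePrec_isReducedLow : IsReducedLow (serrePrec.{u} k).app where
  low X x hx := serrePrec_of_le_one hx
  two X := fun ⟨n, x⟩ hx => by
    obtain rfl : n = 2 := hx
    exact ⟨1, _, _, rfl, rfl, (serrePrec_two x).trans (one_smul k _).symm⟩

theorem serreSucc_isReducedLow : IsReducedLow (serreSucc.{u} k).app where
  low X x hx := serreSucc_of_le_one hx
  two X := fun ⟨n, x⟩ hx => by
    obtain rfl : n = 2 := hx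
    exact ⟨-1, _, _, rfl, rfl, (serreSucc_two x).trans (neg_one_smul k _).symm⟩

variable {F G : ∀ X : CubicalSet.{u}, CLTot k X →ₗ[k] CL2 k X}

theorem leftIter_of_le_two
    (hF : ∀ (X : CubicalSet.{u}) (x : Σ n, X.LCell n), x.1 ≤ 1 → F X (gen k X x) = 0)
    (hG : IsReducedLow G) (X : CubicalSet.{u}) (x : Σ n, X.LCell n) (hx : x.1 ≤ 2) :
    leftIter (F X) (G X) (gen k X x) = 0 := by
  simp only [leftIter, LinearMap.comp_apply]
  rcases Nat.lt_or_ge x.1 2 with h | h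
  · rw [hG.low X x (by omega), map_zero, map_zero]
  · obtain ⟨c, a, b, ha, hb, e⟩ := hG.two X x (by omega)
    rw [e, map_smul, TensorProduct.map_tmul, hF X a ha.le, TensorProduct.zero_tmul, smul_zero,
      map_zero]

theorem rightIter_of_le_two
    (hF : ∀ (X : CubicalSet.{u}) (x : Σ n, X.LCell n), x.1 ≤ 1 → F X (gen k X x) = 0)
    (hG : IsReducedLow G) (X : CubicalSet.{u}) (x : Σ n, X.LCell n) (hx : x.1 ≤ 2) :
    rightIter (F X) (G X) (gen k X x) = 0 := by
  simp only [rightIter, LinearMap.comp_apply]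
  rcases Nat.lt_or_ge x.1 2 with h | h
  · rw [hG.low X x (by omega), map_zero]
  · obtain ⟨c, a, b, ha, hb, e⟩ := hG.two X x (by omega)
    rw [e, map_smul, TensorProduct.map_tmul, hF X b hb.le, TensorProduct.tmul_zero, smul_zero]

variable {X : CubicalSet.{u}}

theorem leftIter_prec_three {F : CLTot k X →ₗ[k] CL2 k X}
    (hF : ∀ x : Σ n, X.LCell n, x.1 ≤ 1 → F (gen k X x) = 0) (x : X.LCell 3) :
    leftIter F ((serrePrec.{u} k).app X) (gen k X ⟨3, x⟩) =
      TensorProduct.assoc k _ _ _ (F (gen k X (X.faceAt false 2 ⟨3, x⟩)) ⊗ₜ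
        gen k X (X.faceAt true 0 (X.faceAt true 1 ⟨3, x⟩))) +
      (-1 : k) • TensorProduct.assoc k _ _ _ (F (gen k X (X.faceAt false 1 ⟨3, x⟩)) ⊗ₜ
        gen k X (X.faceAt true 0 (X.faceAt true 2 ⟨3, x⟩))) := by
  simp only [leftIter, LinearMap.comp_apply, serrePrec_three, map_add, map_smul,
    TensorProduct.map_tmul, LinearMap.id_apply, LinearEquiv.coe_coe]
  rw [hF (X.faceAt false 1 (X.faceAt false 2 ⟨3, x⟩)) (le_refl 1), TensorProduct.zero_tmul,
    map_zero, zero_add]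

theorem rightIter_prec_three {F : CLTot k X →ₗ[k] CL2 k X}
    (hF : ∀ x : Σ n, X.LCell n, x.1 ≤ 1 → F (gen k X x) = 0) (x : X.LCell 3) :
    rightIter F ((serrePrec.{u} k).app X) (gen k X ⟨3, x⟩) =
      gen k X (X.faceAt false 1 (X.faceAt false 2 ⟨3, x⟩)) ⊗ₜ
        F (gen k X (X.faceAt true 0 ⟨3, x⟩)) := by
  simp only [rightIter, LinearMap.comp_apply, serrePrec_three, map_add, map_smul,
    TensorProduct.map_tmul, LinearMap.id_apply]
  rw [hF (X.faceAt true 0 (X.faceAt true 1 ⟨3, x⟩)) (le_refl 1),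
    hF (X.faceAt true 0 (X.faceAt true 2 ⟨3, x⟩)) (le_refl 1), TensorProduct.tmul_zero,
    TensorProduct.tmul_zero, smul_zero, add_zero, add_zero]

theorem leftIter_succ_three {F : CLTot k X →ₗ[k] CL2 k X}
    (hF : ∀ x : Σ n, X.LCell n, x.1 ≤ 1 → F (gen k X x) = 0) (x : X.LCell 3) :
    leftIter F ((serreSucc.{u} k).app X) (gen k X ⟨3, x⟩) =
      TensorProduct.assoc k _ _ _ (F (gen k X (X.faceAt false 0 ⟨3, x⟩)) ⊗ₜ
        gen k X (X.faceAt true 1 (X.faceAt true 2 ⟨3, x⟩))) := by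
  simp only [leftIter, LinearMap.comp_apply, serreSucc_three, map_add, map_smul,
    TensorProduct.map_tmul, LinearMap.id_apply, LinearEquiv.coe_coe]
  rw [hF (X.faceAt false 0 (X.faceAt false 2 ⟨3, x⟩)) (le_refl 1),
    hF (X.faceAt false 0 (X.faceAt false 1 ⟨3, x⟩)) (le_refl 1), TensorProduct.zero_tmul,
    TensorProduct.zero_tmul, map_zero, smul_zero, zero_add, zero_add]

theorem rightIter_succ_three {F : CLTot k X →ₗ[k] CL2 k X}
    (hF : ∀ x : Σ n, X.LCell n, x.1 ≤ 1 → F (gen k X x) = 0) (x : X.LCell 3) :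
    rightIter F ((serreSucc.{u} k).app X) (gen k X ⟨3, x⟩) =
      (-1 : k) • (gen k X (X.faceAt false 0 (X.faceAt false 2 ⟨3, x⟩)) ⊗ₜ
        F (gen k X (X.faceAt true 1 ⟨3, x⟩))) +
      gen k X (X.faceAt false 0 (X.faceAt false 1 ⟨3, x⟩)) ⊗ₜ
        F (gen k X (X.faceAt true 2 ⟨3, x⟩)) := by
  simp only [rightIter, LinearMap.comp_apply, serreSucc_three, map_add, map_smul,
    TensorProduct.map_tmul, LinearMap.id_apply]
  rw [hF (X.faceAt true 1 (X.faceAt true 2 ⟨3, x⟩)) (le_refl 1), TensorProduct.tmul_zero, add_zero]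

theorem add_low {F G : CLTot k X →ₗ[k] CL2 k X}
    (hF : ∀ x : Σ n, X.LCell n, x.1 ≤ 1 → F (gen k X x) = 0)
    (hG : ∀ x : Σ n, X.LCell n, x.1 ≤ 1 → G (gen k X x) = 0) :
    ∀ x : Σ n, X.LCell n, x.1 ≤ 1 → (F + G) (gen k X x) = 0 := fun x hx => by
  rw [LinearMap.add_apply, hF x hx, hG x hx, add_zero]

theorem serrePrec_of_two (x : Σ n, X.LCell n) (hx : x.1 = 2) :
    (serrePrec.{u} k).app X (gen k X x) =
      gen k X (X.faceAt false 1 x) ⊗ₜ gen k X (X.faceAt true 0 x) := by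
  obtain ⟨n, x⟩ := x
  obtain rfl : n = 2 := hx
  exact serrePrec_two x

theorem serreSucc_of_two (x : Σ n, X.LCell n) (hx : x.1 = 2) :
    (serreSucc.{u} k).app X (gen k X x) =
      (-1 : k) • (gen k X (X.faceAt false 0 x) ⊗ₜ gen k X (X.faceAt true 1 x)) := by
  obtain ⟨n, x⟩ := x
  obtain rfl : n = 2 := hx
  exact (serreSucc_two x).trans (neg_one_smul k _).symm

theorem faceAt_faceAt_three (ε ω : Bool) {i j : ℕ} (hij : i ≤ j) (x : X.LCell 3)
    (h : j + 1 < 3) : X.faceAt ω j (X.faceAt ε i ⟨3, x⟩) =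
      X.faceAt ε i (X.faceAt ω (j + 1) ⟨3, x⟩) := faceAt_faceAt ε ω hij _ h

theorem serre_left (x : X.LCell 3) :
    leftIter ((serrePrec.{u} k).app X) ((serrePrec k).app X) (gen k X ⟨3, x⟩) =
      rightIter ((serrePrec k).app X + (serreSucc k).app X) ((serrePrec k).app X)
        (gen k X ⟨3, x⟩) := by
  rw [leftIter_prec_three fun _ => serrePrec_of_le_one,
    rightIter_prec_three (add_low (fun _ => serrePrec_of_le_one) fun _ => serreSucc_of_le_one),
    LinearMap.add_apply, serrePrec_of_two (X.faceAt false 2 _) rfl,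
    serrePrec_of_two (X.faceAt false 1 _) rfl, serrePrec_of_two (X.faceAt true 0 _) rfl,
    serreSucc_of_two (X.faceAt true 0 _) rfl, TensorProduct.assoc_tmul, TensorProduct.assoc_tmul,
    TensorProduct.tmul_add, TensorProduct.tmul_smul]
  rw [faceAt_faceAt_three true false (i := 0) (j := 1) (by decide) x (by decide),
    faceAt_faceAt_three true true (i := 0) (j := 0) (by decide) x (by decide),
    faceAt_faceAt_three false false (i := 1) (j := 1) (by decide) x (by decide),
    faceAt_faceAt_three true false (i := 0) (j := 0) (by decide) x (by decide),
    faceAt_faceAt_three true true (i := 0) (j := 1) (by decide) x (by decide)]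

theorem serre_middle (x : X.LCell 3) :
    leftIter ((serreSucc.{u} k).app X) ((serrePrec k).app X) (gen k X ⟨3, x⟩) =
      rightIter ((serrePrec k).app X) ((serreSucc k).app X) (gen k X ⟨3, x⟩) := by
  rw [leftIter_prec_three fun _ => serreSucc_of_le_one,
    rightIter_succ_three fun _ => serrePrec_of_le_one, serreSucc_of_two (X.faceAt false 2 _) rfl,
    serreSucc_of_two (X.faceAt false 1 _) rfl, serrePrec_of_two (X.faceAt true 1 _) rfl,
    serrePrec_of_two (X.faceAt true 2 _) rfl, ← TensorProduct.smul_tmul',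
    ← TensorProduct.smul_tmul', map_smul, map_smul, TensorProduct.assoc_tmul,
    TensorProduct.assoc_tmul, smul_smul, neg_one_mul, neg_neg, one_smul]
  rw [faceAt_faceAt_three true false (i := 1) (j := 1) (by decide) x (by decide),
    faceAt_faceAt_three false true (i := 1) (j := 1) (by decide) x (by decide)]

theorem serre_right (x : X.LCell 3) :
    rightIter ((serreSucc.{u} k).app X) ((serreSucc k).app X) (gen k X ⟨3, x⟩) =
      leftIter ((serrePrec k).app X + (serreSucc k).app X) ((serreSucc k).app X)
        (gen k X ⟨3, x⟩) := by
  rw [rightIter_succ_three fun _ => serreSucc_of_le_one,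
    leftIter_succ_three (add_low (fun _ => serrePrec_of_le_one) fun _ => serreSucc_of_le_one),
    LinearMap.add_apply, serrePrec_of_two (X.faceAt false 0 _) rfl,
    serreSucc_of_two (X.faceAt false 0 _) rfl, serreSucc_of_two (X.faceAt true 1 _) rfl,
    serreSucc_of_two (X.faceAt true 2 _) rfl, TensorProduct.add_tmul, map_add,
    ← TensorProduct.smul_tmul', map_smul, TensorProduct.assoc_tmul, TensorProduct.assoc_tmul,
    TensorProduct.tmul_smul, TensorProduct.tmul_smul, smul_smul, neg_one_mul, neg_neg, one_smul]
  rw [faceAt_faceAt_three false false (i := 0) (j := 1) (by decide) x (by decide),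
    faceAt_faceAt_three false true (i := 0) (j := 0) (by decide) x (by decide),
    faceAt_faceAt_three false false (i := 0) (j := 0) (by decide) x (by decide),
    faceAt_faceAt_three false true (i := 0) (j := 1) (by decide) x (by decide),
    faceAt_faceAt_three true true (i := 1) (j := 1) (by decide) x (by decide)]

theorem natHomotopic3_of_three {A B : ∀ X : CubicalSet.{u}, CLTot k X →ₗ[k] CL3 k X}
    (hA : IsNatChain3 A) (hB : IsNatChain3 B)
    (hA2 : ∀ (X : CubicalSet.{u}) (x : Σ n, X.LCell n), x.1 ≤ 2 → A X (gen k X x) = 0)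
    (hB2 : ∀ (X : CubicalSet.{u}) (x : Σ n, X.LCell n), x.1 ≤ 2 → B X (gen k X x) = 0)
    (h3 : ∀ (X : CubicalSet.{u}) (x : X.LCell 3), A X (gen k X ⟨3, x⟩) = B X (gen k X ⟨3, x⟩)) :
    NatHomotopic3 A B := by
  refine hA.natHomotopic hB fun X n hn x => ?_
  rcases Nat.lt_or_ge n 3 with h | h
  · rw [hA2 X ⟨n, x⟩ (Nat.le_of_lt_succ h), hB2 X ⟨n, x⟩ (Nat.le_of_lt_succ h)]
  · obtain rfl : n = 3 := le_antisymm hn h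
    exact h3 X x

theorem serre_add_low (X : CubicalSet.{u}) : ∀ x : Σ n, X.LCell n, x.1 ≤ 1 →
    ((serrePrec.{u} k).app X + (serreSucc k).app X) (gen k X x) = 0 :=
  add_low (fun _ => serrePrec_of_le_one) fun _ => serreSucc_of_le_one

theorem serre_isHomotopyCodendriform :
    IsHomotopyCodendriform (serrePrec.{u} k) (serreSucc k) where
  left := natHomotopic3_of_three ((serrePrec k).isNatChain2.leftIter (serrePrec k).isNatChain2)
    (((serrePrec k).isNatChain2.add (serreSucc k).isNatChain2).rightIter
      (serrePrec k).isNatChain2)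
    (leftIter_of_le_two serrePrec_isReducedLow.low serrePrec_isReducedLow)
    (rightIter_of_le_two serre_add_low serrePrec_isReducedLow)
    fun _ => serre_left
  middle := natHomotopic3_of_three ((serreSucc k).isNatChain2.leftIter (serrePrec k).isNatChain2)
    ((serrePrec k).isNatChain2.rightIter (serreSucc k).isNatChain2)
    (leftIter_of_le_two serreSucc_isReducedLow.low serrePrec_isReducedLow)
    (rightIter_of_le_two serrePrec_isReducedLow.low serreSucc_isReducedLow)
    fun _ => serre_middle
  right := natHomotopic3_of_three ((serreSucc k).isNatChain2.rightIter (serreSucc k).isNatChain2)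
    (((serrePrec k).isNatChain2.add (serreSucc k).isNatChain2).leftIter
      (serreSucc k).isNatChain2)
    (rightIter_of_le_two serreSucc_isReducedLow.low serreSucc_isReducedLow)
    (leftIter_of_le_two serre_add_low serreSucc_isReducedLow)
    fun _ => serre_right

theorem isHomotopyCodendriform {P S : NatCoproduct.{u} k} (hP : P.ExtendsPrec)
    (hS : S.ExtendsSucc) : IsHomotopyCodendriform P S := by
  have p := hP.natHomotopic serrePrec_extendsPrec
  have s := hS.natHomotopic serreSucc_extendsSucc
  have ps := p.add s
  have cP := P.isNatChain2
  have cS := S.isNatChain2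
  have cP0 := (serrePrec.{u} k).isNatChain2
  have cS0 := (serreSucc.{u} k).isNatChain2
  have h := serre_isHomotopyCodendriform.{u} (k := k)
  exact ⟨((p.leftIter p cP0 cP).trans h.left).trans (ps.rightIter p (cP0.add cS0) cP).symm,
    ((s.leftIter p cS0 cP).trans h.middle).trans (p.rightIter s cP0 cS).symm,
    ((s.rightIter s cS0 cS).trans h.right).trans (ps.leftIter s (cP0.add cS0) cS).symm⟩

theorem isHomotopyCoZinbiel {P S : NatCoproduct.{u} k} (hP : P.ExtendsPrec)
    (hS : S.ExtendsSucc) : IsHomotopyCoZinbiel P S := by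
  have h := isHomotopyCodendriform hP hS
  have hs := natHomotopic_twist hP hS
  have cP := P.isNatChain2
  exact ⟨h, hs, h.left.trans (((NatHomotopic2.refl P.app).add hs).rightIter
    (NatHomotopic2.refl P.app) (cP.add cP.twist) cP)⟩

end Codendriform

end CubicalSet

/-! ### Chains over a field -/

theorem exists_pseudoInverse {K V W : Type*} [Field K] [AddCommGroup V] [Module K V]
    [AddCommGroup W] [Module K W] (f : V →ₗ[K] W) : ∃ g : W →ₗ[K] V, ∀ v, f (g (f v)) = f v := by
  obtain ⟨s, hs⟩ := f.rangeRestrict.exists_rightInverse_of_surjective f.range_rangeRestrict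
  obtain ⟨p, hp⟩ := (LinearMap.range f).subtype.exists_leftInverse_of_injective
    (Submodule.ker_subtype _)
  refine ⟨s ∘ₗ p, fun v => ?_⟩
  have h1 : p (f v) = f.rangeRestrict v := LinearMap.congr_fun hp (f.rangeRestrict v)
  have h2 := LinearMap.congr_fun hs (f.rangeRestrict v)
  rw [LinearMap.comp_apply, h1]
  exact congrArg Subtype.val h2

theorem IsField.exists_pseudoInverse {k V W : Type*} [CommRing k] (hk : IsField k) [AddCommGroup V]
    [Module k V] [AddCommGroup W] [Module k W] (f : V →ₗ[k] W) :
    ∃ g : W →ₗ[k] V, ∀ v, f (g (f v)) = f v := by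
  let _ := hk.toField
  exact _root_.exists_pseudoInverse f

namespace CubicalSet

section FieldCase

variable {k : Type v} [CommRing k] {X : CubicalSet.{u}}

theorem cyclesIncl_lof (n : ℕ) (z : cycles k X n) :
    cyclesIncl k X (DirectSum.lof k ℕ _ n z) = DirectSum.lof k ℕ (CL k X) n z.1 := by
  rw [cyclesIncl, DirectSum.lmap_lof]; rfl

theorem cyclesProj_lof (n : ℕ) (z : cycles k X n) :
    cyclesProj k X (DirectSum.lof k ℕ _ n z) = DirectSum.lof k ℕ (HL k X) n (mkHL k X n z) := by
  rw [cyclesProj, DirectSum.lmap_lof]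

theorem mkHL_surjective (n : ℕ) : Function.Surjective (mkHL k X n) := Submodule.mkQ_surjective _

theorem cyclesProj_surjective : Function.Surjective (cyclesProj k X) :=
  (DirectSum.lmap_surjective _).2 mkHL_surjective

theorem dTot_cyclesIncl (z : cyclesTot k X) : dTot k X (cyclesIncl k X z) = 0 := by
  suffices h : dTot k X ∘ₗ cyclesIncl k X = 0 from LinearMap.congr_fun h z
  refine DirectSum.linearMap_ext _ fun n => LinearMap.ext fun z => ?_
  simp only [LinearMap.comp_apply, cyclesIncl_lof, LinearMap.zero_apply]
  cases n with
  | zero => exact dTot_lof_zero k _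
  | succ n => rw [dTot_lof_succ, LinearMap.mem_ker.1 z.2, map_zero]

section Splitting

variable (g : ∀ n, CL k X n →ₗ[k] CL k X (n + 1))

/-- The endomorphism `1 - d g - g d` of the chain complex. If `d g d = d`, then it takes values in
the cycles and kills the boundaries. -/
noncomputable def splitProj : ∀ n, CL k X n →ₗ[k] CL k X n
  | 0 => LinearMap.id - dCL k X 0 ∘ₗ g 0
  | n + 1 => LinearMap.id - dCL k X (n + 1) ∘ₗ g (n + 1) - g n ∘ₗ dCL k X n

/-- The map `g` on the total module. -/
noncomputable def splitHomotopy : CLTot k X →ₗ[k] CLTot k X :=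
  DirectSum.toModule k ℕ _ fun n => DirectSum.lof k ℕ (CL k X) (n + 1) ∘ₗ g n

theorem splitHomotopy_lof (n : ℕ) (v : CL k X n) : splitHomotopy g (DirectSum.lof k ℕ _ n v) =
    DirectSum.lof k ℕ (CL k X) (n + 1) (g n v) := by
  rw [splitHomotopy, DirectSum.toModule_lof]; rfl

theorem splitProj_of_mem_cycles {n : ℕ} {v : CL k X n} (hv : v ∈ cycles k X n) :
    splitProj g n v = v - dCL k X n (g n v) := by
  cases n with
  | zero => rfl
  | succ n =>
    change v - dCL k X (n + 1) (g (n + 1) v) - g n (dCL k X n v) = _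
    rw [LinearMap.mem_ker.1 hv, map_zero, sub_zero]

theorem dCL_mem_cycles {n : ℕ} (v : CL k X (n + 1)) : dCL k X n v ∈ cycles k X n := by
  cases n with
  | zero => exact Submodule.mem_top
  | succ n => exact LinearMap.mem_ker.2 (dCL_dCL k X n v)

theorem isHomotopyToId_split :
    IsHomotopyToId (deg1 k X) (dTot k X) (splitHomotopy g) (DirectSum.lmap (splitProj g)) where
  homotopy v := by
    suffices h : dTot k X ∘ₗ splitHomotopy g + splitHomotopy g ∘ₗ dTot k X =
        LinearMap.id - DirectSum.lmap (splitProj g) from LinearMap.congr_fun h v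
    refine DirectSum.linearMap_ext _ fun n => LinearMap.ext fun v => ?_
    simp only [LinearMap.comp_apply, LinearMap.add_apply, LinearMap.sub_apply, LinearMap.id_apply,
      splitHomotopy_lof, dTot_lof_succ, DirectSum.lmap_lof]
    cases n with
    | zero =>
      rw [dTot_lof_zero, map_zero, add_zero]
      change _ = _ - DirectSum.lof k ℕ _ 0 (v - dCL k X 0 (g 0 v))
      rw [map_sub, sub_sub_cancel]
    | succ n =>
      rw [dTot_lof_succ, splitHomotopy_lof]
      change _ = _ - DirectSum.lof k ℕ _ (n + 1)
        (v - dCL k X (n + 1) (g (n + 1) v) - g n (dCL k X n v))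
      rw [map_sub, map_sub]
      abel
  s_mem n v hv := by
    obtain ⟨v, rfl⟩ := hv
    exact ⟨g n v, (splitHomotopy_lof g n v).symm⟩
  π_mem n v hv := by
    obtain ⟨v, rfl⟩ := hv
    exact ⟨splitProj g n v, (DirectSum.lmap_lof _ _ _).symm⟩

variable {g} (hg : ∀ n v, dCL k X n (g n (dCL k X n v)) = dCL k X n v)

include hg in
theorem splitProj_mem_cycles (n : ℕ) (v : CL k X n) : splitProj g n v ∈ cycles k X n := by
  cases n with
  | zero => exact Submodule.mem_top
  | succ n =>
    refine LinearMap.mem_ker.2 ?_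
    change dCL k X n (v - dCL k X (n + 1) (g (n + 1) v) - g n (dCL k X n v)) = 0
    rw [map_sub, map_sub, dCL_dCL, hg, sub_zero, sub_self]

include hg in
theorem splitProj_dCL (n : ℕ) (v : CL k X (n + 1)) : splitProj g n (dCL k X n v) = 0 := by
  rw [splitProj_of_mem_cycles g (dCL_mem_cycles v), hg, sub_self]

end Splitting

/-- Over a field, the homology is a retract of the chain complex up to homotopy: there are a
projection `R` of the chains on cycles which kills the boundaries, and a section `j` of the
projection of the cycles on the homology, by which `R` factors on cycles. -/
theorem exists_splitting (hk : IsField k) (X : CubicalSet.{u}) :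
    ∃ (R : CLTot k X →ₗ[k] cyclesTot k X) (G : CLTot k X →ₗ[k] CLTot k X)
      (j : HLTot k X →ₗ[k] cyclesTot k X),
      IsHomotopyToId (deg1 k X) (dTot k X) G (cyclesIncl k X ∘ₗ R) ∧
      (∀ v, R (dTot k X v) = 0) ∧
      (∀ z, cyclesProj k X (R (cyclesIncl k X z)) = cyclesProj k X z) ∧
      (∀ z, j (cyclesProj k X z) = R (cyclesIncl k X z)) ∧
      ∀ n, ∀ v ∈ deg1 k X n, cyclesProj k X (R v) ∈ sumDeg k (HL k X) n := by
  choose g hg using fun n => hk.exists_pseudoInverse (dCL k X n)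
  let R' : ∀ n, CL k X n →ₗ[k] cycles k X n := fun n =>
    (splitProj g n).codRestrict (cycles k X n) (splitProj_mem_cycles hg n)
  have hR'd : ∀ n (v : CL k X (n + 1)), R' n (dCL k X n v) = 0 := fun n v =>
    Subtype.ext (splitProj_dCL hg n v)
  let j' : ∀ n, HL k X n →ₗ[k] cycles k X n := fun n =>
    Submodule.liftQ _ (R' n ∘ₗ (cycles k X n).subtype) <| by
      rintro ⟨z, hz⟩ hz'
      obtain ⟨v, hv⟩ := Submodule.mem_comap.1 hz'
      change dCL k X n v = z at hv
      subst hv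
      exact LinearMap.mem_ker.2 (hR'd n v)
  have hj' : ∀ n (z : cycles k X n), j' n (mkHL k X n z) = R' n z.1 := fun n z => rfl
  refine ⟨DirectSum.lmap R', splitHomotopy g, DirectSum.lmap j', ?_, fun v => ?_, fun z => ?_,
    fun z => ?_, fun n v hv => ?_⟩
  · have : cyclesIncl k X ∘ₗ DirectSum.lmap R' = DirectSum.lmap (splitProj g) := by
      rw [cyclesIncl, ← DirectSum.lmap_comp]
      rfl
    rw [this]
    exact isHomotopyToId_split g
  · suffices h : DirectSum.lmap R' ∘ₗ dTot k X = 0 from LinearMap.congr_fun h v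
    refine DirectSum.linearMap_ext _ fun n => LinearMap.ext fun v => ?_
    simp only [LinearMap.comp_apply, LinearMap.zero_apply]
    cases n with
    | zero => rw [dTot_lof_zero, map_zero]
    | succ n => rw [dTot_lof_succ, DirectSum.lmap_lof, hR'd, map_zero]
  · suffices h : cyclesProj k X ∘ₗ DirectSum.lmap R' ∘ₗ cyclesIncl k X = cyclesProj k X from
      LinearMap.congr_fun h z
    refine DirectSum.linearMap_ext _ fun n => LinearMap.ext fun z => ?_
    simp only [LinearMap.comp_apply, cyclesIncl_lof, DirectSum.lmap_lof, cyclesProj_lof]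
    congr 1
    refine (Submodule.Quotient.eq _).2 (Submodule.mem_comap.2 ⟨-g n z.1, ?_⟩)
    change dCL k X n (-g n z.1) = splitProj g n z.1 - z.1
    rw [splitProj_of_mem_cycles g z.2, map_neg]
    abel
  · suffices h : DirectSum.lmap j' ∘ₗ cyclesProj k X = DirectSum.lmap R' ∘ₗ cyclesIncl k X from
      LinearMap.congr_fun h z
    refine DirectSum.linearMap_ext _ fun n => LinearMap.ext fun z => ?_
    simp only [LinearMap.comp_apply, cyclesIncl_lof, DirectSum.lmap_lof, cyclesProj_lof, hj']
  · obtain ⟨v, rfl⟩ := hv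
    rw [DirectSum.lmap_lof, cyclesProj_lof]
    exact ⟨_, rfl⟩

/-! ### The coproduct on the homology -/

/-- The data over a field by which the homology is computed: a retraction `r` of the chains on the
homology, and the coproduct `δ` on the homology that `Δ` induces. -/
structure IsHomologyCoproduct (Δ : CLTot k X →ₗ[k] CL2 k X) (r : CLTot k X →ₗ[k] HLTot k X)
    (δ : HLTot k X →ₗ[k] HLTot k X ⊗[k] HLTot k X) : Prop where
  r_incl : ∀ z, r (cyclesIncl k X z) = cyclesProj k X z
  r_d : ∀ v, r (dTot k X v) = 0
  r_mem : ∀ n, ∀ v ∈ deg1 k X n, r v ∈ sumDeg k (HL k X) n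
  induces : Induces Δ δ
  delta_proj : ∀ z, δ (cyclesProj k X z) = TensorProduct.map r r (Δ (cyclesIncl k X z))

theorem map_r_d2 {r : CLTot k X →ₗ[k] HLTot k X} (hr : ∀ v, r (dTot k X v) = 0) (t : CL2 k X) :
    TensorProduct.map r r (d2 k X t) = 0 := by
  suffices h : TensorProduct.map r r ∘ₗ d2 k X = 0 from LinearMap.congr_fun h t
  refine TensorProduct.ext' fun a b => ?_
  simp [d2, hr]

theorem map_r_d3 {r : CLTot k X →ₗ[k] HLTot k X} (hr : ∀ v, r (dTot k X v) = 0) (t : CL3 k X) :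
    TensorProduct.map r (TensorProduct.map r r) (d3 k X t) = 0 := by
  suffices h : TensorProduct.map r (TensorProduct.map r r) ∘ₗ d3 k X = 0 from
    LinearMap.congr_fun h t
  refine TensorProduct.ext' fun a b => ?_
  simp only [LinearMap.comp_apply, d3, LinearMap.add_apply, map_add, TensorProduct.map_tmul, hr,
    map_r_d2 hr, TensorProduct.zero_tmul, TensorProduct.tmul_zero, add_zero, LinearMap.zero_apply]

/-- If `δ'` is induced by `Δ`, then `δ'` is determined by a retraction on the homology. -/
theorem Induces.delta_proj {Δ : CLTot k X →ₗ[k] CL2 k X} {r : CLTot k X →ₗ[k] HLTot k X}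
    (r_incl : ∀ z, r (cyclesIncl k X z) = cyclesProj k X z) (r_d : ∀ v, r (dTot k X v) = 0)
    {δ' : HLTot k X →ₗ[k] HLTot k X ⊗[k] HLTot k X} (h : Induces Δ δ') (z : cyclesTot k X) :
    δ' (cyclesProj k X z) = TensorProduct.map r r (Δ (cyclesIncl k X z)) := by
  obtain ⟨t, ht, u, hu⟩ := h z
  have e : r ∘ₗ cyclesIncl k X = cyclesProj k X := LinearMap.ext r_incl
  rw [ht, eq_add_of_sub_eq hu.symm, map_add, map_r_d2 r_d, zero_add, TensorProduct.map_map, e]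

/-- The coproduct is `δ = (r ⊗ r) Δ j`, where `j` is a section of the projection of the cycles on
the homology. It is induced by `Δ` because `r`, followed by the inclusion of representing cycles, is
homotopic to the identity, and so is its tensor square. -/
theorem exists_isHomologyCoproduct (hk : IsField k) (P : NatCoproduct.{u} k) (X : CubicalSet.{u}) :
    ∃ (r : CLTot k X →ₗ[k] HLTot k X) (δ : HLTot k X →ₗ[k] HLTot k X ⊗[k] HLTot k X)
      (j : HLTot k X →ₗ[k] cyclesTot k X), IsHomologyCoproduct (P.app X) r δ ∧ ∀ z : cyclesTot k X,
      ∃ b, cyclesIncl k X (j (cyclesProj k X z)) = cyclesIncl k X z - dTot k X b := by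
  obtain ⟨R, G, j, hG, hRd, hpR, hj, hmem⟩ := exists_splitting hk X
  have hR : ∀ z, cyclesIncl k X (R (cyclesIncl k X z)) =
      cyclesIncl k X z - dTot k X (G (cyclesIncl k X z)) := by
    intro z
    have := hG.homotopy (cyclesIncl k X z)
    rw [dTot_cyclesIncl, map_zero, add_zero] at this
    rw [this, sub_sub_cancel]
    rfl
  have hPc : ∀ v, d2 k X (P.app X v) = P.app X (dTot k X v) := P.isNatChain2.comm X
  have hrd : ∀ v, (cyclesProj k X ∘ₗ R) (dTot k X v) = 0 := fun v => by
    rw [LinearMap.comp_apply, hRd, map_zero]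
  let δ := TensorProduct.map (cyclesProj k X ∘ₗ R) (cyclesProj k X ∘ₗ R) ∘ₗ P.app X ∘ₗ
    cyclesIncl k X ∘ₗ j
  have hδ : ∀ z, δ (cyclesProj k X z) = TensorProduct.map (cyclesProj k X ∘ₗ R)
      (cyclesProj k X ∘ₗ R) (P.app X (cyclesIncl k X z)) := by
    intro z
    change TensorProduct.map _ _ (P.app X (cyclesIncl k X (j (cyclesProj k X z)))) = _
    rw [hj, hR, map_sub, map_sub, ← hPc, map_r_d2 hrd, sub_zero]
  refine ⟨cyclesProj k X ∘ₗ R, δ, j, ⟨hpR, hrd, hmem, fun z => ?_, hδ⟩,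
    fun z => ⟨G (cyclesIncl k X z), by rw [hj, hR]⟩⟩
  have H : IsHomotopyToId (deg2 k X) (d2 k X) _
      (TensorProduct.map (cyclesIncl k X ∘ₗ R) (cyclesIncl k X ∘ₗ R)) :=
    hG.tensor hG (iSup_deg1 k X) (fun _ _ => parity_of_mem_deg1 k)
      (LinearMap.congr_fun (dTot_comp_parity k)) (dTot_dTot k)
  have hw := H.homotopy (P.app X (cyclesIncl k X z))
  rw [hPc, dTot_cyclesIncl, map_zero, map_zero, add_zero] at hw
  refine ⟨TensorProduct.map R R (P.app X (cyclesIncl k X z)), ?_, ?_⟩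
  · rw [hδ, TensorProduct.map_map]
  · rw [TensorProduct.map_map]
    exact ⟨_, hw⟩

end FieldCase

section HomologyCoalgebra

variable {k : Type v} [CommRing k] {X : CubicalSet.{u}}

theorem exists_cyclesProj_lof {n : ℕ} {x : HLTot k X} (hx : x ∈ sumDeg k (HL k X) n) :
    ∃ z : cycles k X n, cyclesProj k X (DirectSum.lof k ℕ _ n z) = x := by
  obtain ⟨a, rfl⟩ := hx
  obtain ⟨z, rfl⟩ := mkHL_surjective n a
  exact ⟨z, cyclesProj_lof n z⟩

theorem cyclesIncl_lof_mem {n : ℕ} (z : cycles k X n) :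
    cyclesIncl k X (DirectSum.lof k ℕ _ n z) ∈ deg1 k X n :=
  ⟨z.1, (cyclesIncl_lof n z).symm⟩

section

variable {Δ : CLTot k X →ₗ[k] CL2 k X} {r : CLTot k X →ₗ[k] HLTot k X}
  {δ : HLTot k X →ₗ[k] HLTot k X ⊗[k] HLTot k X}

theorem IsHomologyCoproduct.leftIter_proj (D : IsHomologyCoproduct Δ r δ)
    {F : CLTot k X →ₗ[k] CL2 k X} (hF : ∀ t, d3 k X (leftMap F t) = leftMap F (d2 k X t))
    {F' : HLTot k X →ₗ[k] HLTot k X ⊗[k] HLTot k X}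
    (hF' : ∀ z, F' (cyclesProj k X z) = TensorProduct.map r r (F (cyclesIncl k X z)))
    (z : cyclesTot k X) : leftIter F' δ (cyclesProj k X z) =
      TensorProduct.map r (TensorProduct.map r r) (leftIter F Δ (cyclesIncl k X z)) := by
  obtain ⟨t, ht, u, hu⟩ := D.induces z
  have e1 : F' ∘ₗ cyclesProj k X = TensorProduct.map r r ∘ₗ F ∘ₗ cyclesIncl k X :=
    LinearMap.ext hF'
  have e2 : r ∘ₗ cyclesIncl k X = cyclesProj k X := LinearMap.ext D.r_incl
  have h : leftIter F Δ (cyclesIncl k X z) = leftMap F (Δ (cyclesIncl k X z)) := rfl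
  rw [h, eq_add_of_sub_eq hu.symm, map_add, ← hF, map_add, map_r_d3 D.r_d, zero_add]
  simp only [leftIter, leftMap, LinearMap.comp_apply, LinearEquiv.coe_coe]
  rw [ht, TensorProduct.map_map, LinearMap.id_comp, e1, ← e2, TensorProduct.map_map,
    TensorProduct.map_map_assoc, TensorProduct.map_map]
  rfl

theorem IsHomologyCoproduct.rightIter_proj (D : IsHomologyCoproduct Δ r δ)
    {F : CLTot k X →ₗ[k] CL2 k X} (hF : ∀ t, d3 k X (rightMap F t) = rightMap F (d2 k X t))
    {F' : HLTot k X →ₗ[k] HLTot k X ⊗[k] HLTot k X}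
    (hF' : ∀ z, F' (cyclesProj k X z) = TensorProduct.map r r (F (cyclesIncl k X z)))
    (z : cyclesTot k X) : rightIter F' δ (cyclesProj k X z) =
      TensorProduct.map r (TensorProduct.map r r) (rightIter F Δ (cyclesIncl k X z)) := by
  obtain ⟨t, ht, u, hu⟩ := D.induces z
  have e1 : F' ∘ₗ cyclesProj k X = TensorProduct.map r r ∘ₗ F ∘ₗ cyclesIncl k X :=
    LinearMap.ext hF'
  have e2 : r ∘ₗ cyclesIncl k X = cyclesProj k X := LinearMap.ext D.r_incl
  have h : rightIter F Δ (cyclesIncl k X z) = rightMap F (Δ (cyclesIncl k X z)) := rfl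
  rw [h, eq_add_of_sub_eq hu.symm, map_add, ← hF, map_add, map_r_d3 D.r_d, zero_add]
  simp only [rightIter, rightMap, LinearMap.comp_apply]
  rw [ht, TensorProduct.map_map, LinearMap.id_comp, e1, ← e2, TensorProduct.map_map,
    TensorProduct.map_map]
  rfl

theorem IsHomologyCoproduct.gradedComm_map (D : IsHomologyCoproduct Δ r δ) (t : CL2 k X) :
    TensorProduct.gradedComm k (HL k X) (HL k X) (TensorProduct.map r r t) =
      TensorProduct.map r r (twist k X t) := by
  suffices h : (TensorProduct.gradedComm k (HL k X) (HL k X)).toLinearMap ∘ₗ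
      TensorProduct.map r r = TensorProduct.map r r ∘ₗ twist k X from LinearMap.congr_fun h t
  refine hom_ext_deg2 fun p q v hv w hw => ?_
  simp only [LinearMap.comp_apply, LinearEquiv.coe_coe, TensorProduct.map_tmul, twist_tmul hv hw,
    map_smul]
  exact gradedComm_tmul_of_mem (D.r_mem p v hv) (D.r_mem q w hw)

end

section

variable {P : NatCoproduct.{u} k} {r : CLTot k X →ₗ[k] HLTot k X}
  {δ : HLTot k X →ₗ[k] HLTot k X ⊗[k] HLTot k X}

theorem IsHomologyCoproduct.coZinbiel (D : IsHomologyCoproduct (P.app X) r δ)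
    (hP : P.ExtendsPrec) : leftIter δ δ =
      rightIter (δ + (TensorProduct.gradedComm k (HL k X) (HL k X)).toLinearMap ∘ₗ δ) δ := by
  refine LinearMap.ext fun x => ?_
  obtain ⟨z, rfl⟩ := cyclesProj_surjective x
  have cP := P.isNatChain2
  have cT := cP.add cP.twist
  rw [D.leftIter_proj (cP.d3_leftMap X) D.delta_proj,
    D.rightIter_proj (F := P.app X + twist k X ∘ₗ P.app X) (cT.d3_rightMap X) fun z => by
      rw [LinearMap.add_apply, LinearMap.comp_apply, LinearEquiv.coe_coe, D.delta_proj,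
        D.gradedComm_map, LinearMap.add_apply, map_add, LinearMap.comp_apply]]
  obtain ⟨h, -, hh, -⟩ := (isHomotopyCoZinbiel hP (serreSucc_extendsSucc (k := k))).coZinbiel
  have e := LinearMap.congr_fun (hh X) (cyclesIncl k X z)
  simp only [LinearMap.add_apply, LinearMap.comp_apply, LinearMap.sub_apply, dTot_cyclesIncl,
    map_zero, add_zero] at e
  have e' := congrArg (TensorProduct.map r (TensorProduct.map r r)) e
  rw [map_r_d3 D.r_d, map_sub] at e'
  exact (sub_eq_zero.1 e'.symm).symm

/-- The induced coproduct may be computed by the shuffle formula. -/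
theorem IsHomologyCoproduct.delta_proj_serrePrec (D : IsHomologyCoproduct (P.app X) r δ)
    (hP : P.ExtendsPrec) (z : cyclesTot k X) : δ (cyclesProj k X z) =
      TensorProduct.map r r ((serrePrec.{u} k).app X (cyclesIncl k X z)) := by
  obtain ⟨h, -, hh, -⟩ := hP.natHomotopic (serrePrec_extendsPrec.{u} (k := k))
  have e := LinearMap.congr_fun (hh X) (cyclesIncl k X z)
  simp only [LinearMap.add_apply, LinearMap.comp_apply, LinearMap.sub_apply, dTot_cyclesIncl,
    map_zero, add_zero] at e
  rw [eq_add_of_sub_eq e.symm, map_add, map_r_d2 D.r_d, zero_add, D.delta_proj]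

variable (k X) in
/-- The part of degree `n` of the tensor square of the homology in positive degrees. -/
noncomputable def posTensor (n : ℕ) : Submodule k (HLTot k X ⊗[k] HLTot k X) :=
  Submodule.span k {t | ∃ (p q : ℕ) (a b : HLTot k X), 1 ≤ p ∧ 1 ≤ q ∧ p + q = n ∧
    a ∈ sumDeg k (HL k X) p ∧ b ∈ sumDeg k (HL k X) q ∧ t = a ⊗ₜ b}

theorem IsShuffle.faces_natAdd_fst {p q : ℕ} {σ : Equiv.Perm (Fin (p + q))} (h : IsShuffle p q σ)
    (x : Σ n, X.LCell n) (hx : p + q = x.1) :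
    (X.faces false (List.ofFn fun j : Fin q => (σ (Fin.natAdd p j) : ℕ)) x).1 = p := by
  have hl := congrArg List.length h.ofFn_natAdd
  rw [List.length_ofFn] at hl
  have := faces_fst false (p + q) (· ∉ shuffleSet p q σ) x hx.le
  rw [h.ofFn_natAdd]
  omega

theorem IsShuffle.faces_castAdd_fst {p q : ℕ} {σ : Equiv.Perm (Fin (p + q))} (h : IsShuffle p q σ)
    (x : Σ n, X.LCell n) (hx : p + q = x.1) :
    (X.faces true (List.ofFn fun i : Fin p => (σ (Fin.castAdd q i) : ℕ)) x).1 = q := by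
  have hl := congrArg List.length h.ofFn_castAdd
  rw [List.length_ofFn] at hl
  have := faces_fst true (p + q) (· ∈ shuffleSet p q σ) x hx.le
  rw [h.ofFn_castAdd]
  omega

/-- In the shuffle formula both tensor factors have positive degree. -/
theorem IsHomologyCoproduct.delta_mem (D : IsHomologyCoproduct (P.app X) r δ)
    (hP : P.ExtendsPrec) {n : ℕ} {x : HLTot k X} (hx : x ∈ sumDeg k (HL k X) n) :
    δ x ∈ posTensor k X n := by
  classical
  obtain ⟨z, rfl⟩ := exists_cyclesProj_lof hx
  rw [D.delta_proj_serrePrec hP]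
  have hz := cyclesIncl_lof_mem z
  rw [deg1_eq_span] at hz
  refine (Submodule.span_le (p := (posTensor k X n).comap
    (TensorProduct.map r r ∘ₗ (serrePrec.{u} k).app X))).2 ?_ hz
  rintro _ ⟨x, rfl⟩
  rw [SetLike.mem_coe, Submodule.mem_comap, LinearMap.comp_apply, serrePrec_gen, precFormula,
    map_sum]
  refine Submodule.sum_mem _ fun p hp => ?_
  rw [map_sum]
  refine Submodule.sum_mem _ fun σ hσ => ?_
  obtain ⟨hp, hp1, hp2⟩ := Finset.mem_filter.1 hp
  rw [Finset.HasAntidiagonal.mem_antidiagonal] at hp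
  have hs := ((@Finset.mem_filter _ _ (_) _ _).1 hσ).2.1
  rw [shuffleTerm, map_smul, TensorProduct.map_tmul]
  refine Submodule.smul_mem _ _ (Submodule.subset_span ⟨_, _, _, _, ?_, ?_, ?_,
    D.r_mem _ _ (gen_mem_deg1 k X _), D.r_mem _ _ (gen_mem_deg1 k X _), rfl⟩)
  · rwa [hs.faces_natAdd_fst ⟨n, x⟩ hp]
  · rwa [hs.faces_castAdd_fst ⟨n, x⟩ hp]
  · rwa [hs.faces_natAdd_fst ⟨n, x⟩ hp, hs.faces_castAdd_fst ⟨n, x⟩ hp]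

end

variable (k X) in
/-- The augmentation of the chain complex, with the value `1` on the point. -/
noncomputable def augmentation : CLTot k X →ₗ[k] k :=
  liftCL k (fun x => if x.1 = 0 then 1 else 0) fun n x hx => by
    cases n with
    | zero => exact hx.elim
    | succ n => rfl

theorem augmentation_of_pos {n : ℕ} (hn : n ≠ 0) {v : CLTot k X} (hv : v ∈ deg1 k X n) :
    augmentation k X v = 0 :=
  eq_of_gen_eq (g := 0) (fun _ => (liftCL_gen k _ _ _).trans (if_neg hn)) hv

theorem augmentation_dTot (v : CLTot k X) : augmentation k X (dTot k X v) = 0 := by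
  suffices h : augmentation k X ∘ₗ dTot k X = 0 from LinearMap.congr_fun h v
  refine hom_ext_deg1 k fun n v hv => ?_
  rw [LinearMap.comp_apply, LinearMap.zero_apply]
  match n, hv with
  | 0, hv => rw [dTot_of_mem_deg1_zero k hv, map_zero]
  | 1, hv => rw [dTot_of_mem_deg1_one hv, map_zero]
  | n + 2, hv => exact augmentation_of_pos (Nat.succ_ne_zero n) (dTot_mem_deg1 k hv)

variable (k X) in
/-- The cycle of the point. -/
noncomputable def pointCycle : cycles k X 0 :=
  ⟨mkCL k X 0 (Finsupp.single PUnit.unit 1), Submodule.mem_top⟩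

theorem cyclesProj_pointCycle : cyclesProj k X (DirectSum.lof k ℕ _ 0 (pointCycle k X)) =
    DirectSum.lof k ℕ (HL k X) 0 (pointClass k X) := cyclesProj_lof 0 _

theorem cyclesIncl_pointCycle : cyclesIncl k X (DirectSum.lof k ℕ _ 0 (pointCycle k X)) =
    gen k X (pt X) := cyclesIncl_lof 0 _

theorem mem_span_pointClass (a : HL k X 0) : a ∈ Submodule.span k {pointClass k X} := by
  obtain ⟨⟨z, hz⟩, rfl⟩ := mkHL_surjective 0 a
  obtain ⟨v, rfl⟩ := mkCL_surjective k X 0 z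
  refine Submodule.mem_span_singleton.2 ⟨v PUnit.unit, ?_⟩
  rw [pointClass, ← map_smul]
  congr 1
  have hv : v PUnit.unit • Finsupp.single PUnit.unit (1 : k) = v := by
    rw [Finsupp.smul_single, smul_eq_mul, mul_one]
    exact Finsupp.ext fun _ => Finsupp.single_eq_same
  exact Subtype.ext ((map_smul (mkCL k X 0) _ _).symm.trans (congrArg _ hv))

/-- The positive degree part of the homology lies in the primitive filtration. -/
theorem sumDeg_le_primitiveFiltration {c : HLTot k X →ₗ[k] k}
    {δ : HLTot k X →ₗ[k] HLTot k X ⊗[k] HLTot k X}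
    (hc : ∀ n, ∀ x ∈ sumDeg k (HL k X) (n + 1), c x = 0)
    (hδ : ∀ n, ∀ x ∈ sumDeg k (HL k X) n, δ x ∈ posTensor k X n) (N m : ℕ) (hm : m ≤ N) :
    sumDeg k (HL k X) (m + 1) ≤ primitiveFiltration c δ N := by
  induction N generalizing m with
  | zero =>
    obtain rfl : m = 0 := Nat.le_zero.1 hm
    refine fun x hx => ⟨hc 0 x hx, ?_⟩
    have : posTensor k X 1 = ⊥ := by
      refine (Submodule.span_eq_bot).2 ?_
      rintro _ ⟨p, q, a, b, hp, hq, hpq, -⟩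
      omega
    simpa [this] using hδ 1 x hx
  | succ N ih =>
    refine fun x hx => ⟨hc m x hx, ?_⟩
    suffices h : posTensor k X (m + 1) ≤ Submodule.map₂ (TensorProduct.mk k _ _)
        (primitiveFiltration c δ N) (primitiveFiltration c δ N) from h (hδ (m + 1) x hx)
    refine Submodule.span_le.2 ?_
    rintro _ ⟨p, q, a, b, hp, hq, hpq, ha, hb, rfl⟩
    obtain ⟨p, rfl⟩ : ∃ p', p = p' + 1 := ⟨p - 1, by omega⟩
    obtain ⟨q, rfl⟩ : ∃ q', q = q' + 1 := ⟨q - 1, by omega⟩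
    exact Submodule.apply_mem_map₂ _ (ih p (by omega) ha) (ih q (by omega) hb)

/-- Over a field, `Δ≺` induces a unique coproduct on the homology. The counit is the augmentation of
representing cycles. -/
theorem exists_isConnectedCoZinbiel (hk : IsField k) (P : NatCoproduct.{u} k) (hP : P.ExtendsPrec)
    (X : CubicalSet.{u}) :
    ∃ δ : HLTot k X →ₗ[k] HLTot k X ⊗[k] HLTot k X, Induces (P.app X) δ ∧
      (∀ δ', Induces (P.app X) δ' → δ' = δ) ∧
      ∃ c : HLTot k X →ₗ[k] k, IsConnectedCoZinbiel (pointClass k X) c δ := by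
  obtain ⟨r, δ, j, D, hj⟩ := exists_isHomologyCoproduct hk P X
  refine ⟨δ, D.induces, fun δ' h => LinearMap.ext fun x => ?_,
    augmentation k X ∘ₗ cyclesIncl k X ∘ₗ j, ?_⟩
  · obtain ⟨z, rfl⟩ := cyclesProj_surjective x
    rw [D.delta_proj, h.delta_proj D.r_incl D.r_d]
  set c := augmentation k X ∘ₗ cyclesIncl k X ∘ₗ j with hcdef
  have hc : ∀ z, c (cyclesProj k X z) = augmentation k X (cyclesIncl k X z) := by
    intro z
    obtain ⟨b, hb⟩ := hj z
    rw [hcdef, LinearMap.comp_apply, LinearMap.comp_apply, hb, map_sub, augmentation_dTot, sub_zero]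
  have hone : c (DirectSum.lof k ℕ (HL k X) 0 (pointClass k X)) = 1 := by
    rw [← cyclesProj_pointCycle, hc, cyclesIncl_pointCycle, augmentation, liftCL_gen]
    exact if_pos rfl
  have hpos : ∀ n, ∀ x ∈ sumDeg k (HL k X) (n + 1), c x = 0 := by
    intro n x hx
    obtain ⟨z, rfl⟩ := exists_cyclesProj_lof hx
    rw [hc, augmentation_of_pos (Nat.succ_ne_zero n) (cyclesIncl_lof_mem z)]
  have hδ : ∀ n, ∀ x ∈ sumDeg k (HL k X) n, δ x ∈ posTensor k X n := fun n x hx => D.delta_mem hP hx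
  have hpos' : ∀ n, 1 ≤ n → ∀ x ∈ sumDeg k (HL k X) n, c x = 0 := fun n hn x hx => by
    obtain ⟨m, rfl⟩ : ∃ m, n = m + 1 := ⟨n - 1, by omega⟩
    exact hpos m x hx
  -- `δ` takes values in the tensor square of the part of positive degree, where `c` vanishes.
  have hleft : TensorProduct.map c LinearMap.id ∘ₗ δ = 0 := by
    refine DirectSum.linearMap_ext _ fun n => LinearMap.ext fun a => ?_
    refine (Submodule.span_le (p := LinearMap.ker (TensorProduct.map c LinearMap.id))).2 ?_
      (hδ n _ ⟨a, rfl⟩)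
    rintro _ ⟨p, q, a, b, hp, hq, -, ha, hb, rfl⟩
    rw [SetLike.mem_coe, LinearMap.mem_ker, TensorProduct.map_tmul, hpos' p hp a ha,
      TensorProduct.zero_tmul]
  have hright : TensorProduct.map LinearMap.id c ∘ₗ δ = 0 := by
    refine DirectSum.linearMap_ext _ fun n => LinearMap.ext fun a => ?_
    refine (Submodule.span_le (p := LinearMap.ker (TensorProduct.map LinearMap.id c))).2 ?_
      (hδ n _ ⟨a, rfl⟩)
    rintro _ ⟨p, q, a, b, hp, hq, -, ha, hb, rfl⟩
    rw [SetLike.mem_coe, LinearMap.mem_ker, TensorProduct.map_tmul, hpos' q hq b hb,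
      TensorProduct.tmul_zero]
  refine ⟨hone, fun n a => hpos n _ ⟨a, rfl⟩, mem_span_pointClass, ?_, fun n x hx => ?_,
    fun x hx => ?_, fun x hx => ?_, D.coZinbiel hP, le_antisymm ?_ ?_⟩
  · rw [← cyclesProj_pointCycle, D.delta_proj, cyclesIncl_pointCycle]
    exact (congrArg _ ((hP X).1 _)).trans (map_zero _)
  · refine (Submodule.span_le.2 ?_ : posTensor k X n ≤ _) (hδ n x hx)
    rintro _ ⟨p, q, a, b, -, -, hpq, ha, hb, rfl⟩
    exact tmul_mem_tensorDeg ha hb hpq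
  · rw [map_add, show TensorProduct.map c LinearMap.id (δ x) = 0 from LinearMap.congr_fun hleft x,
      zero_add, TensorProduct.map_tmul, hx, TensorProduct.zero_tmul, map_zero]
  · rw [map_add, show TensorProduct.map LinearMap.id c (δ x) = 0 from LinearMap.congr_fun hright x,
      zero_add, TensorProduct.map_tmul, hone, TensorProduct.rid_tmul, one_smul, LinearMap.id_apply]
  · refine iSup_le fun N => ?_
    cases N <;> exact inf_le_left
  · -- The projection `x ↦ x - c x • 1` on `ker c` takes values in the union of the filtration.
    have key : ∀ x, x - c x • DirectSum.lof k ℕ (HL k X) 0 (pointClass k X) ∈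
        ⨆ N, primitiveFiltration c δ N := by
      intro x
      induction x using DirectSum.induction_on with
      | zero => simp
      | of n a =>
        change DirectSum.lof k ℕ (HL k X) n a - c (DirectSum.lof k ℕ (HL k X) n a) • _ ∈ _
        cases n with
        | zero =>
          obtain ⟨b, rfl⟩ := Submodule.mem_span_singleton.1 (mem_span_pointClass a)
          rw [map_smul, map_smul, hone, smul_eq_mul, mul_one, sub_self]
          exact Submodule.zero_mem _
        | succ n =>
          rw [hpos n _ ⟨a, rfl⟩, zero_smul, sub_zero]
          exact Submodule.mem_iSup_of_mem n
            (sumDeg_le_primitiveFiltration hpos hδ n n le_rfl ⟨a, rfl⟩)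
      | add x y hx hy =>
        rw [map_add, add_smul, add_sub_add_comm]
        exact Submodule.add_mem _ hx hy
    intro x hx
    have := key x
    rwa [LinearMap.mem_ker.1 hx, zero_smul, sub_zero] at this

end HomologyCoalgebra

end CubicalSet

theorem mainTheorem1 (k : Type v) [CommRing k] :
    (∃ P S : CubicalSet.NatCoproduct.{u} k,
      (∀ (X : CubicalSet.{u}) (x : Σ n, X.LCell n),
        P.app X (CubicalSet.gen k X x) = CubicalSet.precFormula k X x) ∧
      (∀ (X : CubicalSet.{u}) (x : Σ n, X.LCell n),
        S.app X (CubicalSet.gen k X x) = CubicalSet.succFormula k X x) ∧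
      P.ExtendsPrec ∧ S.ExtendsSucc) ∧
    (∀ P P' : CubicalSet.NatCoproduct.{u} k, P.ExtendsPrec → P'.ExtendsPrec →
      CubicalSet.NatHomotopic2 P.app P'.app) ∧
    (∀ S S' : CubicalSet.NatCoproduct.{u} k, S.ExtendsSucc → S'.ExtendsSucc →
      CubicalSet.NatHomotopic2 S.app S'.app) ∧
    (∀ P S : CubicalSet.NatCoproduct.{u} k, P.ExtendsPrec → S.ExtendsSucc →
      CubicalSet.IsHomotopyCoZinbiel P S) ∧
    (IsField k → ∀ P : CubicalSet.NatCoproduct.{u} k, P.ExtendsPrec →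
      ∀ X : CubicalSet.{u},
        ∃ δ : CubicalSet.HLTot k X →ₗ[k] CubicalSet.HLTot k X ⊗[k] CubicalSet.HLTot k X,
          CubicalSet.Induces (P.app X) δ ∧
          (∀ δ', CubicalSet.Induces (P.app X) δ' → δ' = δ) ∧
          ∃ c : CubicalSet.HLTot k X →ₗ[k] k,
            IsConnectedCoZinbiel (CubicalSet.pointClass k X) c δ) := by
  refine ⟨⟨CubicalSet.serrePrec k, CubicalSet.serreSucc k,
    fun X x => CubicalSet.serrePrec_gen k x, fun X x => CubicalSet.serreSucc_gen k x,
    CubicalSet.serrePrec_extendsPrec, CubicalSet.serreSucc_extendsSucc⟩,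
    fun P P' hP hP' => hP.natHomotopic hP', fun S S' hS hS' => hS.natHomotopic hS',
    fun P S hP hS => CubicalSet.isHomotopyCoZinbiel hP hS,
    fun hk P hP X => CubicalSet.exists_isConnectedCoZinbiel hk P hP X⟩
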